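/- **Setting.** Let $(X,Y)$ be a random element of $\mathbb R^p\times\mathbb R$, let $\Theta\subset\mathbb R^d$, and let $g:\mathbb R^p\times\Theta\to\mathbb R$, with gradient $\dot g(x,\theta)=\partial g(x,\theta)/\partial\theta\in\mathbb R^d$. The null hypothesis is $$H_0:\quad Y=g(X,\theta_0)+\varepsilon \ \text{ a.s. for some } \theta_0\in\Theta,\ \text{ where } \varepsilon \text{ is independent of } X \text{ and } E\varepsilon=0 .$$ **The statistic.** From the sample $(x_1,y_1),\dots,(x_n,y_n)$ let $\hat\theta_n\in\Theta$ be a (measurable) minimizer of $\sum_{j=1}^n[y_j-g(x_j,\theta)]^2$ over $\Theta$, and let $\hat\eta_j=y_j-g(x_j,\hat\theta_n)$. Put $$\hat m_n(t)=\frac1n\sum_{j=1}^n x_je^{it\hat\eta_j},\qquad \hat M_n=\frac1n\sum_{k=1}^n\hat m_n(\hat\eta_k)\,\hat m_n(\hat\eta_k)^H,$$ let $\hat\lambda_1\ge\dots\ge\hat\lambda_p\ge0$ be the eigenvalues of $\hat M_n$, with $\hat\lambda_j=0$ for $j>p$, and, with ridges $c_{1n},c_{2n}$, let $$\hat s_j=\frac{\hat\lambda_j}{\hat\lambda_j+1},\qquad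 \hat s_j^*=\frac{\hat s_j^2+c_{1n}}{\hat s_{j+1}^2+c_{1n}}-1,\qquad \hat r_j=\frac{\hat s_{j+1}^*+c_{2n}}{\hat s_j^*+c_{2n}} .$$ For a threshold $0<\tau<1$ let $\hat q$ be the largest $j\in\{1,\dots,p\}$ with $\hat r_j\le\tau$, and $\hat q=0$ if there is no such $j$. With a measurable weight function $w:\mathbb R^p\to\mathbb R$, a kernel $K:\mathbb R^p\to\mathbb R$ and a bandwidth $h=h_n$, let $$V_0=\frac1n\sum_{j=1}^n\hat\eta_jw(x_j),\qquad V_1=\frac1{n(n-1)}\sum_{j=1}^n\sum_{k\ne j}\hat\eta_j\hat\eta_k\frac1{h^p}K\Big(\frac{x_j-x_k}h\Big),\qquad V_n=\big|V_0^2\,I(\hat q=0)+V_1\,I(\hat q>0)\big| .$$ With $\dot g_{j,n}=\dot g(x_j,\hat\theta_n)$, $w_j=w(x_j)$, $a_n=\frac1n\sum_j\dot g_{j,n}w_j$ and $\hat G_n=\frac1n\sum_j\dot g_{j,n}\dot g_{j,n}^\top$, let $$\hat\sigma_0^2=\Big(\frac1n\sum_{j=1}^n\hat\eta_j^2\Big)\Big[\frac1n\sum_{j=1}^nw_j^2-a_n^\top\hat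 G_n^{-1}a_n\Big],\qquad T_n=\frac{nV_n}{\hat\sigma_0^2}.$$ **Regularity conditions.** 1. $(x_i,y_i)$, $i\ge1$, are i.i.d. copies of $(X,Y)$, and $EY^2<\infty$. 2. $\Theta$ is compact and convex. 3. $g(\cdot,\theta)$ is Borel measurable for each $\theta\in\Theta$, and $g(x,\cdot)$ is twice continuously differentiable on $\Theta$ for each $x$. 4. With Euclidean (Frobenius) norms, the random variables $\sup_{\theta\in\Theta}g^2(X,\theta)$, $\sup_{\theta\in\Theta}\|\dot g\dot g^\top(X,\theta)\|$, $\sup_{\theta\in\Theta}\|[Y-g(X,\theta)]^2\dot g\dot g^\top(X,\theta)\|$ and $\sup_{\theta\in\Theta}\|[Y-g(X,\theta)]^2\,\partial^2g(X,\theta)/\partial\theta\partial\theta^\top\|$ have finite expectations. 5. $\theta\mapsto E\{Y-g(X,\theta)\}^2$ has a unique minimizer $\theta^*$ on $\Theta$, and under $H_0$ it is an interior point of $\Theta$. 6. $E\{\dot g(X,\theta^*)\dot g(X,\theta^*)^\top\}$ is nonsingular. 7. $K$ is symmetric, nonnegative, continuous and bounded, with $\int K(u)\,du=1$; $h>0$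 for all large $n$, $h\to0$ and $nh^p\to\infty$. 8. $E(X)=0$ and $E\|X\|^2<\infty$. 9. The ridges are positive for all large $n$, $c_{1n}\to0$, $c_{2n}\to0$ and $n^2c_{1n}c_{2n}\to\infty$. 10. $E\,w(X)^2<\infty$ (for example $w(x)=c\,e^{-\|x\|}$ with $c>0$), and, with $\eta=Y-g(X,\theta^*)$ (which is $\varepsilon$ under $H_0$), $\dot g=\dot g(X,\theta^*)$ and $w=w(X)$, $$\sigma_0^2=\mathrm{Var}(\eta)\big[E(w^2)-E(\dot gw)^\top E(\dot g\dot g^\top)^{-1}E(\dot gw)\big]>0 .$$ **Theorem.** Under $H_0$ and these conditions, $T_n$ converges in distribution, as $n\to\infty$, to the chi-square distribution $\chi^2_1$ with one degree of freedom. -/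

import Mathlib

open MeasureTheory ProbabilityTheory Filter Topology
open scoped ENNReal

noncomputable section

namespace HybridTest

/-! ### Derivatives of the regression function in the parameter

The regression function is `g : ℝ^p → ℝ^d → ℝ`, `g x θ`; only its values for `θ ∈ Θ` matter.
Derivatives are taken within `Θ` (convex with non-empty interior whenever they are used below),
so they agree with the usual ones in the interior of `Θ`. -/

/-- The gradient `∂g(x,θ)/∂θ`, a vector of length `d`. -/
def grad {p d : ℕ} (g : EuclideanSpace ℝ (Fin p) → EuclideanSpace ℝ (Fin d) → ℝ)
    (Θ : Set (EuclideanSpace ℝ (Fin d))) (x : EuclideanSpace ℝ (Fin p))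
    (θ : EuclideanSpace ℝ (Fin d)) : Fin d → ℝ :=
  fun i => fderivWithin ℝ (g x) Θ θ (EuclideanSpace.single i 1)

/-- The Hessian `∂²g(x,θ)/∂θ∂θᵀ`, a `d × d` matrix. -/
def hess {p d : ℕ} (g : EuclideanSpace ℝ (Fin p) → EuclideanSpace ℝ (Fin d) → ℝ)
    (Θ : Set (EuclideanSpace ℝ (Fin d))) (x : EuclideanSpace ℝ (Fin p))
    (θ : EuclideanSpace ℝ (Fin d)) : Matrix (Fin d) (Fin d) ℝ :=
  Matrix.of fun i j =>
    fderivWithin ℝ (fun θ' => grad g Θ x θ' i) Θ θ (EuclideanSpace.single j 1)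

/-- The Euclidean (Frobenius) norm of a real matrix. -/
def frobNorm {d : ℕ} (A : Matrix (Fin d) (Fin d) ℝ) : ℝ :=
  Real.sqrt (∑ i, ∑ j, A i j ^ 2)

/-! ### Sample quantities

`xs 0, …, xs (n-1)` and `ys 0, …, ys (n-1)` are the observed data, `θ` is the plugged-in
parameter (the least squares estimate in the theorem). -/

/-- `θ` is a least squares estimate from the first `n` observations: it lies in `Θ` and minimizes
`∑ [y_j - g(x_j,θ)]²` over `Θ`. -/
def IsLeastSquares {p d : ℕ} (g : EuclideanSpace ℝ (Fin p) → EuclideanSpace ℝ (Fin d) → ℝ)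
    (Θ : Set (EuclideanSpace ℝ (Fin d))) (n : ℕ) (xs : ℕ → EuclideanSpace ℝ (Fin p))
    (ys : ℕ → ℝ) (θ : EuclideanSpace ℝ (Fin d)) : Prop :=
  θ ∈ Θ ∧ IsMinOn (fun θ' => ∑ j ∈ Finset.range n, (ys j - g (xs j) θ') ^ 2) Θ θ

/-- The residual `η̂_j = y_j - g(x_j,θ)`. -/
def residual {p d : ℕ} (g : EuclideanSpace ℝ (Fin p) → EuclideanSpace ℝ (Fin d) → ℝ)
    (xs : ℕ → EuclideanSpace ℝ (Fin p)) (ys : ℕ → ℝ) (θ : EuclideanSpace ℝ (Fin d))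
    (j : ℕ) : ℝ :=
  ys j - g (xs j) θ

/-- `m̂_n(t) = n⁻¹ ∑_j x_j exp(i t η̂_j) ∈ ℂ^p`, for residuals `η`. -/
def mHat {p : ℕ} (n : ℕ) (xs : ℕ → EuclideanSpace ℝ (Fin p)) (η : ℕ → ℝ) (t : ℝ) :
    Fin p → ℂ :=
  fun i => (n : ℂ)⁻¹ * ∑ j ∈ Finset.range n,
    (xs j i : ℂ) * Complex.exp (Complex.I * (t : ℂ) * (η j : ℂ))

/-- `M̂_n = n⁻¹ ∑_k m̂_n(η̂_k) m̂_n(η̂_k)ᴴ`. -/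
def MHat {p : ℕ} (n : ℕ) (xs : ℕ → EuclideanSpace ℝ (Fin p)) (η : ℕ → ℝ) :
    Matrix (Fin p) (Fin p) ℂ :=
  (n : ℝ)⁻¹ • ∑ k ∈ Finset.range n,
    Matrix.vecMulVec (mHat n xs η (η k)) (star (mHat n xs η (η k)))

theorem MHat_isHermitian {p : ℕ} (n : ℕ) (xs : ℕ → EuclideanSpace ℝ (Fin p)) (η : ℕ → ℝ) :
    (MHat n xs η).IsHermitian := by
  simp [MHat, Matrix.IsHermitian, Matrix.conjTranspose_smul, Matrix.conjTranspose_sum,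
    Matrix.conjTranspose_vecMulVec]

/-- The `j`-th largest eigenvalue `λ̂_j` of `M̂_n`, `j = 1, …, p`, with multiplicity, and
`λ̂_j = 0` for `j > p` (the criterion below involves the indices `p + 1` and `p + 2`). -/
def lambdaHat {p : ℕ} (n : ℕ) (xs : ℕ → EuclideanSpace ℝ (Fin p)) (η : ℕ → ℝ) (j : ℕ) : ℝ :=
  if hj : 1 ≤ j ∧ j ≤ p then
    (MHat_isHermitian n xs η).eigenvalues₀
      ⟨j - 1, by rw [Fintype.card_fin]; omega⟩
  else 0

/-- `ŝ_j = λ̂_j / (λ̂_j + 1)`. -/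
def sHat {p : ℕ} (n : ℕ) (xs : ℕ → EuclideanSpace ℝ (Fin p)) (η : ℕ → ℝ) (j : ℕ) : ℝ :=
  lambdaHat n xs η j / (lambdaHat n xs η j + 1)

/-- `ŝ*_j = (ŝ_j² + c₁) / (ŝ_{j+1}² + c₁) - 1`. -/
def sStar {p : ℕ} (n : ℕ) (xs : ℕ → EuclideanSpace ℝ (Fin p)) (η : ℕ → ℝ) (c₁ : ℝ)
    (j : ℕ) : ℝ :=
  (sHat n xs η j ^ 2 + c₁) / (sHat n xs η (j + 1) ^ 2 + c₁) - 1

/-- `r̂_j = (ŝ*_{j+1} + c₂) / (ŝ*_j + c₂)`. -/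
def rHat {p : ℕ} (n : ℕ) (xs : ℕ → EuclideanSpace ℝ (Fin p)) (η : ℕ → ℝ) (c₁ c₂ : ℝ)
    (j : ℕ) : ℝ :=
  (sStar n xs η c₁ (j + 1) + c₂) / (sStar n xs η c₁ j + c₂)

open Classical in
/-- The estimated indicative dimension `q̂`: the largest `j ∈ {1, …, p}` with `r̂_j ≤ τ`, and `0`
if there is none. -/
def qHat {p : ℕ} (n : ℕ) (xs : ℕ → EuclideanSpace ℝ (Fin p)) (η : ℕ → ℝ) (c₁ c₂ τ : ℝ) : ℕ :=
  ((Finset.Icc 1 p).filter fun j => rHat n xs η c₁ c₂ j ≤ τ).sup id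

/-- `V₀ = n⁻¹ ∑_j η̂_j w(x_j)`. -/
def V0 {p : ℕ} (w : EuclideanSpace ℝ (Fin p) → ℝ) (n : ℕ)
    (xs : ℕ → EuclideanSpace ℝ (Fin p)) (η : ℕ → ℝ) : ℝ :=
  (n : ℝ)⁻¹ * ∑ j ∈ Finset.range n, η j * w (xs j)

/-- `V₁ = (n(n-1))⁻¹ ∑_j ∑_{k ≠ j} η̂_j η̂_k h⁻ᵖ K((x_j - x_k)/h)`. -/
def V1 {p : ℕ} (K : EuclideanSpace ℝ (Fin p) → ℝ) (h : ℝ) (n : ℕ)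
    (xs : ℕ → EuclideanSpace ℝ (Fin p)) (η : ℕ → ℝ) : ℝ :=
  1 / ((n : ℝ) * ((n : ℝ) - 1)) *
    ∑ j ∈ Finset.range n, ∑ k ∈ (Finset.range n).erase j,
      η j * η k * (1 / h ^ p) * K (h⁻¹ • (xs j - xs k))

open Classical in
/-- `V_n = |V₀² I(q̂ = 0) + V₁ I(q̂ > 0)|`. -/
def Vn {p : ℕ} (w K : EuclideanSpace ℝ (Fin p) → ℝ) (h c₁ c₂ τ : ℝ) (n : ℕ)
    (xs : ℕ → EuclideanSpace ℝ (Fin p)) (η : ℕ → ℝ) : ℝ :=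
  |V0 w n xs η ^ 2 * (if qHat n xs η c₁ c₂ τ = 0 then 1 else 0) +
    V1 K h n xs η * (if 0 < qHat n xs η c₁ c₂ τ then 1 else 0)|

/-- The variance estimator `σ̂₀²`: with `a = n⁻¹ ∑ ġ_j w_j` and `Ĝ = n⁻¹ ∑ ġ_j ġ_jᵀ`, where
`ġ_j = ġ(x_j,θ)`, it is `(n⁻¹ ∑ η̂_j²) [n⁻¹ ∑ w_j² - aᵀ Ĝ⁻¹ a]`. -/
def sigmaHatSq {p d : ℕ} (g : EuclideanSpace ℝ (Fin p) → EuclideanSpace ℝ (Fin d) → ℝ)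
    (Θ : Set (EuclideanSpace ℝ (Fin d))) (w : EuclideanSpace ℝ (Fin p) → ℝ) (n : ℕ)
    (xs : ℕ → EuclideanSpace ℝ (Fin p)) (ys : ℕ → ℝ) (θ : EuclideanSpace ℝ (Fin d)) : ℝ :=
  let a : Fin d → ℝ := (n : ℝ)⁻¹ • ∑ j ∈ Finset.range n, w (xs j) • grad g Θ (xs j) θ
  let G : Matrix (Fin d) (Fin d) ℝ := (n : ℝ)⁻¹ • ∑ j ∈ Finset.range n,
    Matrix.vecMulVec (grad g Θ (xs j) θ) (grad g Θ (xs j) θ)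
  ((n : ℝ)⁻¹ * ∑ j ∈ Finset.range n, residual g xs ys θ j ^ 2) *
    (((n : ℝ)⁻¹ * ∑ j ∈ Finset.range n, w (xs j) ^ 2) - a ⬝ᵥ Matrix.mulVec G⁻¹ a)

/-- The hybrid statistic `T_n = n V_n / σ̂₀²`. -/
def Tn {p d : ℕ} (g : EuclideanSpace ℝ (Fin p) → EuclideanSpace ℝ (Fin d) → ℝ)
    (Θ : Set (EuclideanSpace ℝ (Fin d))) (w K : EuclideanSpace ℝ (Fin p) → ℝ)
    (h c₁ c₂ τ : ℝ) (n : ℕ)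
    (xs : ℕ → EuclideanSpace ℝ (Fin p)) (ys : ℕ → ℝ) (θ : EuclideanSpace ℝ (Fin d)) : ℝ :=
  (n : ℝ) * Vn w K h c₁ c₂ τ n xs (residual g xs ys θ) / sigmaHatSq g Θ w n xs ys θ

/-! ### The model -/

/-- The null hypothesis: `Y = g(X,θ₀) + ε` almost surely for some `θ₀ ∈ Θ` and an error `ε` that
is independent of `X` and has mean zero. -/
def NullHypothesis {Ω : Type*} [MeasurableSpace Ω] (P : Measure Ω) {p d : ℕ}
    (X : Ω → EuclideanSpace ℝ (Fin p)) (Y : Ω → ℝ)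
    (g : EuclideanSpace ℝ (Fin p) → EuclideanSpace ℝ (Fin d) → ℝ)
    (Θ : Set (EuclideanSpace ℝ (Fin d))) : Prop :=
  ∃ θ₀ ∈ Θ, ∃ ε : Ω → ℝ, Integrable ε P ∧ ∫ ω, ε ω ∂P = 0 ∧ IndepFun X ε P ∧
    ∀ᵐ ω ∂P, Y ω = g (X ω) θ₀ + ε ω

/-- `G = E[ġ(X,θ) ġ(X,θ)ᵀ]`. -/
def gramMatrix {Ω : Type*} [MeasurableSpace Ω] (P : Measure Ω) {p d : ℕ}
    (X : Ω → EuclideanSpace ℝ (Fin p))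
    (g : EuclideanSpace ℝ (Fin p) → EuclideanSpace ℝ (Fin d) → ℝ)
    (Θ : Set (EuclideanSpace ℝ (Fin d))) (θ : EuclideanSpace ℝ (Fin d)) :
    Matrix (Fin d) (Fin d) ℝ :=
  Matrix.of fun i j => ∫ ω, grad g Θ (X ω) θ i * grad g Θ (X ω) θ j ∂P

/-- `E[ġ(X,θ) w(X)]`. -/
def gradWeight {Ω : Type*} [MeasurableSpace Ω] (P : Measure Ω) {p d : ℕ}
    (X : Ω → EuclideanSpace ℝ (Fin p))
    (g : EuclideanSpace ℝ (Fin p) → EuclideanSpace ℝ (Fin d) → ℝ)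
    (Θ : Set (EuclideanSpace ℝ (Fin d))) (w : EuclideanSpace ℝ (Fin p) → ℝ)
    (θ : EuclideanSpace ℝ (Fin d)) : Fin d → ℝ :=
  fun i => ∫ ω, grad g Θ (X ω) θ i * w (X ω) ∂P

/-- `σ₀² = Var(η) [E w² - E(ġw)ᵀ E(ġġᵀ)⁻¹ E(ġw)]` with `η = Y - g(X,θ)` and `ġ = ġ(X,θ)`, at the
least squares parameter `θ = θ*`; under the null hypothesis `η` is the error `ε`. -/
def sigmaSq {Ω : Type*} [MeasurableSpace Ω] (P : Measure Ω) {p d : ℕ}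
    (X : Ω → EuclideanSpace ℝ (Fin p)) (Y : Ω → ℝ)
    (g : EuclideanSpace ℝ (Fin p) → EuclideanSpace ℝ (Fin d) → ℝ)
    (Θ : Set (EuclideanSpace ℝ (Fin d))) (w : EuclideanSpace ℝ (Fin p) → ℝ)
    (θ : EuclideanSpace ℝ (Fin d)) : ℝ :=
  variance (fun ω => Y ω - g (X ω) θ) P *
    ((∫ ω, w (X ω) ^ 2 ∂P) - gradWeight P X g Θ w θ ⬝ᵥ
      Matrix.mulVec (gramMatrix P X g Θ θ)⁻¹ (gradWeight P X g Θ w θ))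

/-- The regularity conditions on the sample, the model, the least squares parameter `θs`, the
kernel `K` and the bandwidths `h n`. -/
structure Regularity {Ω : Type*} [MeasurableSpace Ω] (P : Measure Ω) {p d : ℕ}
    (X : Ω → EuclideanSpace ℝ (Fin p)) (Y : Ω → ℝ)
    (x : ℕ → Ω → EuclideanSpace ℝ (Fin p)) (y : ℕ → Ω → ℝ)
    (g : EuclideanSpace ℝ (Fin p) → EuclideanSpace ℝ (Fin d) → ℝ)
    (Θ : Set (EuclideanSpace ℝ (Fin d))) (θs : EuclideanSpace ℝ (Fin d))
    (K : EuclideanSpace ℝ (Fin p) → ℝ) (h : ℕ → ℝ) : Prop where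
  measurable_X : Measurable X
  measurable_Y : Measurable Y
  measurable_x : ∀ j, Measurable (x j)
  measurable_y : ∀ j, Measurable (y j)
  indep : iIndepFun (fun j ω => (x j ω, y j ω)) P
  identDistrib : ∀ j, IdentDistrib (fun ω => (x j ω, y j ω)) (fun ω => (X ω, Y ω)) P P
  memLp_Y : MemLp Y 2 P
  compact_Theta : IsCompact Θ
  convex_Theta : Convex ℝ Θ
  measurable_g : ∀ θ ∈ Θ, Measurable fun u => g u θ
  contDiffOn_g : ∀ u, ContDiffOn ℝ 2 (g u) Θ
  sup_g : ∫⁻ ω, ⨆ θ ∈ Θ, ENNReal.ofReal (g (X ω) θ ^ 2) ∂P < ∞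
  sup_grad : ∫⁻ ω, ⨆ θ ∈ Θ, ENNReal.ofReal
    (frobNorm (Matrix.vecMulVec (grad g Θ (X ω) θ) (grad g Θ (X ω) θ))) ∂P < ∞
  sup_res_grad : ∫⁻ ω, ⨆ θ ∈ Θ, ENNReal.ofReal
    (frobNorm ((Y ω - g (X ω) θ) ^ 2 •
      Matrix.vecMulVec (grad g Θ (X ω) θ) (grad g Θ (X ω) θ))) ∂P < ∞
  sup_res_hess : ∫⁻ ω, ⨆ θ ∈ Θ, ENNReal.ofReal
    (frobNorm ((Y ω - g (X ω) θ) ^ 2 • hess g Θ (X ω) θ)) ∂P < ∞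
  mem_Theta : θs ∈ Θ
  unique_min : ∀ θ ∈ Θ, θ ≠ θs →
    ∫ ω, (Y ω - g (X ω) θs) ^ 2 ∂P < ∫ ω, (Y ω - g (X ω) θ) ^ 2 ∂P
  interior_of_null : NullHypothesis P X Y g Θ → θs ∈ interior Θ
  nonsingular : IsUnit (gramMatrix P X g Θ θs)
  kernel_symm : ∀ u, K (-u) = K u
  kernel_nonneg : ∀ u, 0 ≤ K u
  kernel_continuous : Continuous K
  kernel_bounded : ∃ C, ∀ u, K u ≤ C
  kernel_integral : ∫ u, K u = 1
  bandwidth_pos : ∀ᶠ n in atTop, 0 < h n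
  bandwidth_zero : Tendsto h atTop (𝓝 0)
  bandwidth_rate : Tendsto (fun n : ℕ => (n : ℝ) * h n ^ p) atTop atTop

/-- The chi-square distribution with one degree of freedom: the law of the square of a standard
normal random variable. -/
def chiSquareOne : Measure ℝ := (gaussianReal 0 1).map fun z => z ^ 2

instance : IsProbabilityMeasure chiSquareOne :=
  Measure.isProbabilityMeasure_map (by fun_prop)

end HybridTest

end

/-!
Under the null hypothesis the least squares parameter `θs` is the true one, and the errors
`e = Y - g(X,θs)` are centred and independent of `X`; this situation is recorded in `ErrorModel`.
Two facts then give the limit of `T_n = n V_n / σ̂²`.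

*The estimated dimension vanishes with probability tending to one.* Every eigenvalue of `M̂_n` is at
most its trace. With the true errors in place of the residuals, the trace has a mean of order `1/n`:
the averages of `x_j exp(i ε_k ε_j)` are centred because the covariates are centred and independent
of the errors (`integral_sq_sum_le`). The estimator is `√n`-consistent, so the residuals may be
substituted for the errors (`bddInProb_traceHat`). Hence `s*_j` is nonnegative and of order
`n⁻² / c₁`, which is negligible compared with `c₂` as `n² c₁ c₂ → ∞`. All ratios tend to one, none of
them is below the threshold, and `T_n = (√n V₀)² / σ̂²` (`eventually_qHat_eq_zero`).

*The moment part is asymptotically normal.* The estimator is consistent by Wald's compactness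
argument (`tendsto_leastSquares`). Since `θs` is interior, the first-order condition holds with
probability tending to one; expanding it gives a linearization of `θ̂ - θs`
(`exists_linearization`), which by invertibility of the Gram matrix yields `√n`-consistency
(`bddInProb_sqrt_mul_norm`), and also shows that `√n V₀` is, up to a negligible term, the normalized
sum of the `ε_j w̃(x_j)`, where `w̃` is the residual of the projection of `w` on the components of
the gradient (`tendsto_sqrt_mul_avg_residual_sub`). By independence, `ε w̃(X)` is centred with
variance `σ₀²`, so the central limit theorem applies (`tendstoInDistribution_effWeight`). The variance
estimator is consistent (`tendsto_sigmaHatSq`), and Slutsky's theorem gives the square of a standard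
normal variable.

The expansion of the score needs an integrable envelope of the Hessian of `g`, while the assumptions
bound only the Hessian times the squared residual. Independence and a positive error variance
remove this factor, since a squared residual has conditionally on `X` a mean of at least `E ε²`
(`ofReal_mul_lintegral_biSup_le`).

Convergence in distribution includes the measurability of `T_n`, which depends on the ordered
eigenvalues of a random Hermitian matrix; these are measurable by `measurable_eigenvalues₀`.

Convergence in probability is expressed as convergence along a filter, `inProb`, on pairs of
a sample size and an outcome. No measurability is needed for its calculus, and continuous mappings,
sums and products are handled by the general theory of limits.
-/

noncomputable section

namespace HybridTest

set_option linter.unusedSectionVars false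

/-! ### Convergence in probability as convergence along a filter -/

section InProb

variable {Ω : Type*} [MeasurableSpace Ω]

/-- The filter of events that hold with probability tending to one: a set of pairs `(n, ω)` belongs
to it if the probability that `(n, ω)` is outside the set tends to zero. Convergence of a sequence
of random elements along this filter to a constant is convergence in probability, so that the whole
algebra of limits, including continuous mappings, is available for the latter. -/
def inProb (P : Measure Ω) : Filter (ℕ × Ω) where
  sets := {S | Tendsto (fun n => P {ω | (n, ω) ∉ S}) atTop (𝓝 0)}
  univ_sets := by simp
  sets_of_superset := by
    intro S T hS hST
    refine tendsto_of_tendsto_of_tendsto_of_le_of_le tendsto_const_nhds hS (fun _ => zero_le) ?_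
    exact fun n => measure_mono fun ω hω h => hω (hST h)
  inter_sets := by
    intro S T hS hT
    have h := Tendsto.add hS hT
    rw [add_zero] at h
    refine tendsto_of_tendsto_of_tendsto_of_le_of_le tendsto_const_nhds h (fun _ => zero_le) ?_
    refine fun n => (measure_mono ?_).trans (measure_union_le _ _)
    intro ω hω
    simp only [Set.mem_ofPred_eq, Set.mem_inter_iff, not_and_or] at hω
    exact hω

variable {P : Measure Ω}

theorem eventually_inProb {p : ℕ × Ω → Prop} :
    (∀ᶠ a in inProb P, p a) ↔ Tendsto (fun n => P {ω | ¬ p (n, ω)}) atTop (𝓝 0) :=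
  Iff.rfl

theorem tendsto_fst_inProb : Tendsto Prod.fst (inProb P) (atTop : Filter ℕ) := by
  intro S hS
  change Tendsto (fun n => P {ω | (n, ω) ∉ Prod.fst ⁻¹' S}) atTop (𝓝 0)
  refine tendsto_const_nhds.congr' ?_
  filter_upwards [hS] with n hn
  simp [hn]

theorem tendsto_inProb_iff {E : Type*} [PseudoMetricSpace E] {A : ℕ × Ω → E} {c : E} :
    Tendsto A (inProb P) (𝓝 c) ↔
      TendstoInMeasure P (fun n ω => A (n, ω)) atTop (fun _ => c) := by
  rw [Metric.tendsto_nhds, tendstoInMeasure_iff_dist]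
  refine forall₂_congr fun e _ => ?_
  rw [eventually_inProb]
  simp only [not_lt]

/-- Boundedness in probability. The usual definition, that the probability of `|A| > M` is
eventually as small as desired for a large `M`, is equivalent to this one, in which the product
with every sequence tending to zero in probability tends to zero in probability. -/
def BddInProb (P : Measure Ω) (A : ℕ × Ω → ℝ) : Prop :=
  ∀ b : ℕ × Ω → ℝ, Tendsto b (inProb P) (𝓝 0) → Tendsto (fun a => b a * A a) (inProb P) (𝓝 0)

theorem BddInProb.mul {A B : ℕ × Ω → ℝ} (hA : BddInProb P A) (hB : BddInProb P B) :
    BddInProb P (fun a => A a * B a) := fun b hb => by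
  simpa only [mul_assoc] using hB _ (hA b hb)

theorem BddInProb.add {A B : ℕ × Ω → ℝ} (hA : BddInProb P A) (hB : BddInProb P B) :
    BddInProb P (fun a => A a + B a) := fun b hb => by
  simpa [mul_add] using (hA b hb).add (hB b hb)

theorem BddInProb.sum {ι : Type*} (s : Finset ι) {A : ι → ℕ × Ω → ℝ}
    (hA : ∀ i ∈ s, BddInProb P (A i)) : BddInProb P (fun a => ∑ i ∈ s, A i a) := fun b hb => by
  simpa [Finset.mul_sum] using tendsto_finsetSum s fun i hi => hA i hi b hb

theorem bddInProb_of_tendsto {A : ℕ × Ω → ℝ} {c : ℝ} (hA : Tendsto A (inProb P) (𝓝 c)) :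
    BddInProb P A := fun b hb => by
  simpa using hb.mul hA

theorem bddInProb_const (c : ℝ) : BddInProb P (fun _ => c) :=
  bddInProb_of_tendsto tendsto_const_nhds

theorem BddInProb.mono {A B : ℕ × Ω → ℝ} (hB : BddInProb P B)
    (h : ∀ᶠ a in inProb P, |A a| ≤ |B a|) : BddInProb P A := fun b hb => by
  refine squeeze_zero_norm' ?_ (tendsto_zero_iff_norm_tendsto_zero.1 (hB b hb))
  filter_upwards [h] with a ha
  rw [norm_mul, norm_mul]
  exact mul_le_mul_of_nonneg_left ha (norm_nonneg _)

/-- A sequence with bounded first moments is bounded in probability, by Markov's inequality. -/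
theorem bddInProb_of_integral_le [IsProbabilityMeasure P] {A : ℕ × Ω → ℝ} {C : ℝ}
    (hint : ∀ᶠ n in atTop, Integrable (fun ω => A (n, ω)) P)
    (h : ∀ᶠ n in atTop, ∫ ω, |A (n, ω)| ∂P ≤ C) : BddInProb P A := by
  intro b hb
  rw [Metric.tendsto_nhds]
  intro κ hκ
  rw [eventually_inProb]
  have hC : 0 ≤ C := by
    obtain ⟨n, hn⟩ := h.exists
    exact (integral_nonneg fun _ => abs_nonneg _).trans hn
  rw [ENNReal.tendsto_nhds_zero]
  intro e he
  obtain ⟨e', he'0, he'⟩ : ∃ e' : ℝ, 0 < e' ∧ ENNReal.ofReal e' ≤ e := by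
    obtain ⟨r, hr0, hr⟩ := ENNReal.lt_iff_exists_real_btwn.1 he
    exact ⟨r, by simpa using hr.1, hr.2.le⟩
  set M : ℝ := 2 * (C + 1) / e' with hM
  have hM0 : 0 < M := by positivity
  have hb' := Metric.tendsto_nhds.1 hb (κ / M) (by positivity)
  rw [eventually_inProb, ENNReal.tendsto_nhds_zero] at hb'
  filter_upwards [hb' (ENNReal.ofReal (e' / 2)) (by simpa using he'0), hint, h]
    with n hn hi hle
  have hA : P {ω | M ≤ |A (n, ω)|} ≤ ENNReal.ofReal (e' / 2) := by
    have h1 := mul_meas_ge_le_integral_of_nonneg (μ := P) (f := fun ω => |A (n, ω)|)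
      (Eventually.of_forall fun _ => abs_nonneg _) hi.abs M
    rw [← ofReal_measureReal]
    apply ENNReal.ofReal_le_ofReal
    have h2 : M * P.real {ω | M ≤ |A (n, ω)|} ≤ M * (e' / 2) := by
      refine h1.trans (hle.trans ?_)
      rw [hM]; field_simp; linarith
    exact le_of_mul_le_mul_left h2 hM0
  have hsub : {ω | ¬ dist (b (n, ω) * A (n, ω)) 0 < κ} ⊆
      {ω | ¬ dist (b (n, ω)) 0 < κ / M} ∪ {ω | M ≤ |A (n, ω)|} := by
    intro ω hω
    by_contra hcon
    simp only [Set.mem_union, Set.mem_ofPred_eq, not_or, not_not, not_le] at hcon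
    apply hω
    have h3 : |b (n, ω)| < κ / M := by simpa using hcon.1
    have : |b (n, ω)| * |A (n, ω)| < κ / M * M :=
      mul_lt_mul'' h3 hcon.2 (abs_nonneg _) (abs_nonneg _)
    rw [div_mul_cancel₀ _ hM0.ne'] at this
    simpa [abs_mul] using this
  calc _ ≤ _ := measure_mono hsub
    _ ≤ _ := measure_union_le _ _
    _ ≤ ENNReal.ofReal (e' / 2) + ENNReal.ofReal (e' / 2) := add_le_add hn hA
    _ = ENNReal.ofReal e' := by
      rw [← ENNReal.ofReal_add (by positivity) (by positivity)]; congr 1; ring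
    _ ≤ e := he'

end InProb

/-! ### Sample averages -/

/-- The sample average `n⁻¹ ∑_{j < n} f j`. -/
def avg (n : ℕ) (f : ℕ → ℝ) : ℝ := (n : ℝ)⁻¹ * ∑ j ∈ Finset.range n, f j

theorem avg_add (n : ℕ) (f f' : ℕ → ℝ) : avg n (fun j => f j + f' j) = avg n f + avg n f' := by
  simp [avg, Finset.sum_add_distrib, mul_add]

theorem avg_sub (n : ℕ) (f f' : ℕ → ℝ) : avg n (fun j => f j - f' j) = avg n f - avg n f' := by
  simp [avg, Finset.sum_sub_distrib, mul_sub]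

theorem avg_const_mul (n : ℕ) (c : ℝ) (f : ℕ → ℝ) : avg n (fun j => c * f j) = c * avg n f := by
  simp only [avg, ← Finset.mul_sum]; ring

theorem avg_mul_const (n : ℕ) (c : ℝ) (f : ℕ → ℝ) : avg n (fun j => f j * c) = avg n f * c := by
  simp only [avg, ← Finset.sum_mul]; ring

theorem avg_sum (n : ℕ) {ι : Type*} (s : Finset ι) (f : ι → ℕ → ℝ) :
    avg n (fun j => ∑ i ∈ s, f i j) = ∑ i ∈ s, avg n (f i) := by
  simp only [avg]; rw [Finset.sum_comm, Finset.mul_sum]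

theorem avg_mono (n : ℕ) {f f' : ℕ → ℝ} (h : ∀ j, f j ≤ f' j) : avg n f ≤ avg n f' := by
  unfold avg; gcongr with j; exact h j

theorem avg_nonneg (n : ℕ) {f : ℕ → ℝ} (h : ∀ j, 0 ≤ f j) : 0 ≤ avg n f :=
  mul_nonneg (by positivity) (Finset.sum_nonneg fun j _ => h j)

theorem abs_avg_le (n : ℕ) (f : ℕ → ℝ) : |avg n f| ≤ avg n fun j => |f j| := by
  unfold avg
  rw [abs_mul, abs_of_nonneg (by positivity : (0 : ℝ) ≤ (n : ℝ)⁻¹)]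
  gcongr
  exact Finset.abs_sum_le_sum_abs _ _

section LLN

variable {Ω 𝒵 : Type*} [MeasurableSpace Ω] [MeasurableSpace 𝒵] {P : Measure Ω}
  [IsProbabilityMeasure P]

/-- The law of large numbers for functions of an i.i.d. sequence. -/
theorem tendsto_avg {Z : Ω → 𝒵} {z : ℕ → Ω → 𝒵}
    (hind : iIndepFun z P) (hid : ∀ j, IdentDistrib (z j) Z P P) {f : 𝒵 → ℝ} (hf : Measurable f)
    (hint : Integrable (fun ω => f (Z ω)) P) :
    Tendsto (fun a : ℕ × Ω => avg a.1 fun j => f (z j a.2)) (inProb P)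
      (𝓝 (∫ ω, f (Z ω) ∂P)) := by
  have hid' : ∀ j, IdentDistrib (fun ω => f (z j ω)) (fun ω => f (Z ω)) P P :=
    fun j => (hid j).comp hf
  have h := strong_law_ae (μ := P) (fun j ω => f (z j ω)) ((hid' 0).integrable_iff.2 hint)
    (fun i j hij => (hind.comp (fun _ => f) fun _ => hf).indepFun hij)
    (fun j => (hid' j).trans (hid' 0).symm)
  rw [(hid' 0).integral_eq] at h
  rw [tendsto_inProb_iff]
  refine tendstoInMeasure_of_tendsto_ae (fun n => ?_) h
  have hm : AEMeasurable (fun ω => (n : ℝ)⁻¹ * ∑ j ∈ Finset.range n, f (z j ω)) P :=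
    (Finset.aemeasurable_fun_sum _ fun j _ => (hid' j).aemeasurable_fst).const_mul _
  exact hm.aestronglyMeasurable

/-- Averages of nonnegative functions with a small mean are small with high probability. This
needs neither independence nor a law of large numbers. -/
theorem measure_avg_ge_le {Z : Ω → 𝒵} {z : ℕ → Ω → 𝒵}
    (hid : ∀ j, IdentDistrib (z j) Z P P) {f : 𝒵 → ℝ} (hf : Measurable f) (hf0 : ∀ v, 0 ≤ f v)
    (hint : Integrable (fun ω => f (Z ω)) P) {κ : ℝ} (hκ : 0 < κ) (n : ℕ) :
    P {ω | κ ≤ avg n fun j => f (z j ω)} ≤ ENNReal.ofReal ((∫ ω, f (Z ω) ∂P) / κ) := by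
  have hid' : ∀ j, IdentDistrib (fun ω => f (z j ω)) (fun ω => f (Z ω)) P P :=
    fun j => (hid j).comp hf
  have hi : ∀ j, Integrable (fun ω => f (z j ω)) P := fun j => (hid' j).integrable_iff.2 hint
  have h1 := mul_meas_ge_le_integral_of_nonneg (μ := P) (f := fun ω => avg n fun j => f (z j ω))
    (Eventually.of_forall fun ω => avg_nonneg n fun j => hf0 _)
    ((integrable_finsetSum _ fun j _ => hi j).const_mul _) κ
  have h2 : ∫ ω, avg n (fun j => f (z j ω)) ∂P ≤ ∫ ω, f (Z ω) ∂P := by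
    simp only [avg]
    rw [integral_const_mul, integral_finsetSum _ fun j _ => hi j]
    simp only [fun j => (hid' j).integral_eq, Finset.sum_const, Finset.card_range, nsmul_eq_mul]
    rw [← mul_assoc]
    refine mul_le_of_le_one_left (integral_nonneg fun _ => hf0 _) ?_
    exact inv_mul_le_one
  rw [← ofReal_measureReal]
  apply ENNReal.ofReal_le_ofReal
  rw [le_div_iff₀' hκ]
  exact h1.trans h2

/-! ### Suprema over the parameter set -/

/-- A dominated random function of the parameter that vanishes and is continuous at `θ₁` has
a measurable upper bound with small mean over a small neighbourhood of `θ₁`. -/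
theorem exists_modulus {E : Type*} [PseudoMetricSpace E] [SecondCountableTopology E]
    {Θ : Set E} {θ₁ : E} (hθ₁ : θ₁ ∈ Θ) {Z : Ω → 𝒵} (hZ : Measurable Z)
    {q : 𝒵 → E → ℝ} (hqm : ∀ θ ∈ Θ, Measurable fun v => q v θ) (hqc : ∀ v, ContinuousOn (q v) Θ)
    (hq0 : ∀ v, ∀ θ ∈ Θ, 0 ≤ q v θ) (hq1 : ∀ v, q v θ₁ = 0) {env : 𝒵 → ℝ}
    (henv : ∀ v, ∀ θ ∈ Θ, q v θ ≤ env v) (hint : Integrable (fun ω => env (Z ω)) P)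
    {κ : ℝ} (hκ : 0 < κ) :
    ∃ δ > 0, ∃ f : 𝒵 → ℝ, Measurable f ∧ (∀ v, 0 ≤ f v) ∧ Integrable (fun ω => f (Z ω)) P ∧
      ∫ ω, f (Z ω) ∂P < κ ∧ ∀ v, ∀ θ ∈ Θ, dist θ θ₁ < δ → q v θ ≤ f v := by
  have hD : ∀ m : ℕ, ∃ D ⊆ Θ ∩ Metric.ball θ₁ (1 / ((m : ℝ) + 1)), D.Countable ∧
      Θ ∩ Metric.ball θ₁ (1 / ((m : ℝ) + 1)) ⊆ closure D := fun m =>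
    (TopologicalSpace.IsSeparable.of_separableSpace _).exists_countable_dense_subset
  choose D hDs hDc hDd using hD
  have henv0 : ∀ v, 0 ≤ env v := fun v => (hq0 v θ₁ hθ₁).trans (henv v θ₁ hθ₁)
  let f : ℕ → 𝒵 → ℝ := fun m v => ⨆ t : D m, q v t
  have hbdd : ∀ m v, BddAbove (Set.range fun t : D m => q v t) := fun m v =>
    ⟨env v, by rintro _ ⟨t, rfl⟩; exact henv v t (hDs m t.2).1⟩
  have hf0 : ∀ m v, 0 ≤ f m v := fun m v =>
    Real.iSup_nonneg fun t => hq0 v t (hDs m t.2).1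
  have hfenv : ∀ m v, f m v ≤ env v := fun m v =>
    Real.iSup_le (fun t => henv v t (hDs m t.2).1) (henv0 v)
  have hfm : ∀ m, Measurable (f m) := fun m => by
    have := (hDc m).to_subtype
    exact Measurable.iSup fun t : D m => hqm t (hDs m t.2).1
  have hfq : ∀ (m : ℕ) v, ∀ θ ∈ Θ, dist θ θ₁ < 1 / ((m : ℝ) + 1) → q v θ ≤ f m v := by
    intro m v θ hθ hd
    have hcl : θ ∈ closure (D m) := hDd m ⟨hθ, hd⟩
    have := mem_closure_iff_nhdsWithin_neBot.1 hcl
    have ht : Tendsto (q v) (𝓝[D m] θ) (𝓝 (q v θ)) :=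
      (hqc v θ hθ).mono_left (nhdsWithin_mono _ fun t ht => (hDs m ht).1)
    refine le_of_tendsto ht ?_
    filter_upwards [self_mem_nhdsWithin] with t ht
    exact le_ciSup (hbdd m v) ⟨t, ht⟩
  have hfi : ∀ m, Integrable (fun ω => f m (Z ω)) P := fun m =>
    hint.mono' ((hfm m).comp hZ).aestronglyMeasurable
      (Eventually.of_forall fun ω => by
        rw [Real.norm_of_nonneg (hf0 m _)]; exact hfenv m _)
  have hlim : Tendsto (fun m => ∫ ω, f m (Z ω) ∂P) atTop (𝓝 (∫ _, (0 : ℝ) ∂P)) := by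
    refine tendsto_integral_of_dominated_convergence (fun ω => env (Z ω))
      (fun m => (hfi m).aestronglyMeasurable) hint
      (fun m => Eventually.of_forall fun ω => by
        rw [Real.norm_of_nonneg (hf0 m _)]; exact hfenv m _)
      (Eventually.of_forall fun ω => ?_)
    rw [Metric.tendsto_atTop]
    intro e he
    obtain ⟨δ, hδ, hδq⟩ := Metric.continuousOn_iff.1 (hqc (Z ω)) θ₁ hθ₁ (e / 2) (by positivity)
    obtain ⟨N, hN⟩ := exists_nat_one_div_lt hδ
    refine ⟨N, fun m hm => ?_⟩
    rw [Real.dist_eq, sub_zero, abs_of_nonneg (hf0 m _)]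
    refine lt_of_le_of_lt (Real.iSup_le (fun t => ?_) (by positivity : 0 ≤ e / 2)) (by linarith)
    have h1 := (hDs m t.2)
    have h2 : dist (t : E) θ₁ < δ := by
      refine lt_trans (lt_of_lt_of_le (Metric.mem_ball.1 h1.2) ?_) hN
      gcongr
    have h3 := hδq t h1.1 h2
    rw [hq1, Real.dist_eq, sub_zero] at h3
    exact (le_abs_self _).trans h3.le
  rw [integral_zero] at hlim
  obtain ⟨m, hm⟩ := (hlim.eventually (gt_mem_nhds hκ)).exists
  exact ⟨1 / ((m : ℝ) + 1), by positivity, f m, hfm m, hf0 m, hfi m, hm, hfq m⟩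

/-- Sample averages of a dominated random function of the parameter that vanishes and is continuous
at `θ₁` tend to zero in probability when evaluated at a consistent estimator of `θ₁`. -/
theorem tendsto_avg_of_consistent {E : Type*} [PseudoMetricSpace E] [SecondCountableTopology E]
    {Θ : Set E} {θ₁ : E} (hθ₁ : θ₁ ∈ Θ) {Z : Ω → 𝒵} (hZ : Measurable Z) {z : ℕ → Ω → 𝒵}
    (hid : ∀ j, IdentDistrib (z j) Z P P) {T : ℕ → Ω → E} (hT : ∀ n ω, T n ω ∈ Θ)
    (hcons : Tendsto (fun a : ℕ × Ω => T a.1 a.2) (inProb P) (𝓝 θ₁))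
    {q : 𝒵 → E → ℝ} (hqm : ∀ θ ∈ Θ, Measurable fun v => q v θ) (hqc : ∀ v, ContinuousOn (q v) Θ)
    (hq0 : ∀ v, ∀ θ ∈ Θ, 0 ≤ q v θ) (hq1 : ∀ v, q v θ₁ = 0) {env : 𝒵 → ℝ}
    (henv : ∀ v, ∀ θ ∈ Θ, q v θ ≤ env v) (hint : Integrable (fun ω => env (Z ω)) P) :
    Tendsto (fun a : ℕ × Ω => avg a.1 fun j => q (z j a.2) (T a.1 a.2)) (inProb P) (𝓝 0) := by
  rw [Metric.tendsto_nhds]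
  intro κ hκ
  rw [eventually_inProb, ENNReal.tendsto_nhds_zero]
  intro e he
  obtain ⟨e', he'0, he'⟩ : ∃ e' : ℝ, 0 < e' ∧ ENNReal.ofReal e' ≤ e := by
    obtain ⟨r, hr0, hr⟩ := ENNReal.lt_iff_exists_real_btwn.1 he
    exact ⟨r, by simpa using hr.1, hr.2.le⟩
  obtain ⟨δ, hδ, f, hfm, hf0, hfi, hfκ, hfq⟩ := exists_modulus hθ₁ hZ hqm hqc hq0 hq1 henv hint
    (κ := κ * (e' / 2)) (by positivity)
  have hc := Metric.tendsto_nhds.1 hcons δ hδ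
  rw [eventually_inProb, ENNReal.tendsto_nhds_zero] at hc
  filter_upwards [hc (ENNReal.ofReal (e' / 2)) (by simpa using he'0)] with n hn
  have hsub : {ω | ¬ dist (avg n fun j => q (z j ω) (T n ω)) 0 < κ} ⊆
      {ω | ¬ dist (T n ω) θ₁ < δ} ∪ {ω | κ ≤ avg n fun j => f (z j ω)} := by
    intro ω hω
    by_contra hcon
    simp only [Set.mem_union, Set.mem_ofPred_eq, not_or, not_not, not_le] at hcon
    apply hω
    rw [Real.dist_eq, sub_zero, abs_of_nonneg (avg_nonneg n fun j => hq0 _ _ (hT n ω))]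
    exact (avg_mono n fun j => hfq _ _ (hT n ω) hcon.1).trans_lt hcon.2
  calc _ ≤ _ := measure_mono hsub
    _ ≤ _ := measure_union_le _ _
    _ ≤ ENNReal.ofReal (e' / 2) + ENNReal.ofReal (e' / 2) := by
      refine add_le_add hn ((measure_avg_ge_le hid hfm hf0 hfi hκ n).trans ?_)
      apply ENNReal.ofReal_le_ofReal
      rw [div_le_iff₀' hκ]
      exact hfκ.le
    _ = ENNReal.ofReal e' := by
      rw [← ENNReal.ofReal_add (by positivity) (by positivity)]; congr 1; ring
    _ ≤ e := he'

/-- A random function of a compact parameter has a measurable envelope, which is integrable if the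
supremum has a finite expectation. The supremum is taken over a countable dense set `D`, so that it
is measurable and a condition on the whole of `Θ` implies the one stated here. -/
theorem exists_envelope {E : Type*} [PseudoMetricSpace E] [SecondCountableTopology E]
    {Θ : Set E} (hΘ : IsCompact Θ) {Z : Ω → 𝒵} (hZ : Measurable Z)
    {q : 𝒵 → E → ℝ} (hqm : ∀ θ ∈ Θ, Measurable fun v => q v θ) (hqc : ∀ v, ContinuousOn (q v) Θ)
    (hq0 : ∀ v, ∀ θ ∈ Θ, 0 ≤ q v θ) :
    ∃ D ⊆ Θ, D.Countable ∧ ∃ env : 𝒵 → ℝ, Measurable env ∧ (∀ v, 0 ≤ env v) ∧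
      (∀ v, ∀ θ ∈ Θ, q v θ ≤ env v) ∧
      (∫⁻ ω, ⨆ θ ∈ D, ENNReal.ofReal (q (Z ω) θ) ∂P < ∞ →
        Integrable (fun ω => env (Z ω)) P) := by
  obtain ⟨D, hDs, hDc, hDd⟩ : ∃ D ⊆ Θ, D.Countable ∧ Θ ⊆ closure D :=
    (TopologicalSpace.IsSeparable.of_separableSpace _).exists_countable_dense_subset
  have := hDc.to_subtype
  have hbdd : ∀ v, BddAbove (Set.range fun t : D => q v t) := fun v => by
    refine (hΘ.bddAbove_image (hqc v)).mono ?_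
    rintro _ ⟨t, rfl⟩
    exact ⟨t, hDs t.2, rfl⟩
  have hem : Measurable fun v => ⨆ t : D, q v t := Measurable.iSup fun t : D => hqm t (hDs t.2)
  have he0 : ∀ v, 0 ≤ ⨆ t : D, q v t := fun v => Real.iSup_nonneg fun t => hq0 v t (hDs t.2)
  have hle : ∀ v, ENNReal.ofReal (⨆ t : D, q v t) ≤ ⨆ θ ∈ D, ENNReal.ofReal (q v θ) := by
    intro v
    refine le_of_forall_lt fun c hc => ?_
    have hc' : c.toReal < ⨆ t : D, q v t := by
      rwa [← ENNReal.lt_ofReal_iff_toReal_lt (ne_top_of_lt hc)]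
    have hne : Nonempty D := by
      by_contra hcon
      rw [not_nonempty_iff] at hcon
      rw [Real.iSup_of_isEmpty] at hc'
      exact absurd hc' (not_lt.2 ENNReal.toReal_nonneg)
    obtain ⟨t, ht⟩ := exists_lt_of_lt_ciSup hc'
    rw [← ENNReal.lt_ofReal_iff_toReal_lt (ne_top_of_lt hc)] at ht
    exact ht.trans_le (le_iSup₂_of_le (t : E) t.2 le_rfl)
  refine ⟨D, hDs, hDc, fun v => ⨆ t : D, q v t, hem, he0, ?_, ?_⟩
  · intro v θ hθ
    have := mem_closure_iff_nhdsWithin_neBot.1 (hDd hθ)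
    refine le_of_tendsto ((hqc v θ hθ).mono_left (nhdsWithin_mono _ hDs)) ?_
    filter_upwards [self_mem_nhdsWithin] with t ht
    exact le_ciSup (hbdd v) ⟨t, ht⟩
  · intro hfin
    refine ⟨(hem.comp hZ).aestronglyMeasurable, ?_⟩
    rw [hasFiniteIntegral_iff_ofReal (Eventually.of_forall fun ω => he0 _)]
    exact (lintegral_mono fun ω => hle (Z ω)).trans_lt hfin

end LLN

/-! ### Derivatives in the parameter -/

section Derivatives

variable {d : ℕ} {Θ : Set (EuclideanSpace ℝ (Fin d))}

theorem clm_apply_eq_sum (L : EuclideanSpace ℝ (Fin d) →L[ℝ] ℝ) (v : EuclideanSpace ℝ (Fin d)) :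
    L v = ∑ i, v i * L (EuclideanSpace.single i 1) := by
  have h := (EuclideanSpace.basisFun (Fin d) ℝ).sum_repr v
  conv_lhs => rw [← h]
  simp [map_sum, EuclideanSpace.basisFun_apply]

theorem clm_norm_le_sqrt (L : EuclideanSpace ℝ (Fin d) →L[ℝ] ℝ) :
    ‖L‖ ≤ √(∑ i, L (EuclideanSpace.single i 1) ^ 2) := by
  refine L.opNorm_le_bound (Real.sqrt_nonneg _) fun v => ?_
  rw [clm_apply_eq_sum L v, EuclideanSpace.norm_eq, ← Real.sqrt_mul (by positivity),
    Real.norm_eq_abs]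
  refine Real.abs_le_sqrt ?_
  have := Finset.sum_mul_sq_le_sq_mul_sq Finset.univ (fun i => v i)
    (fun i => L (EuclideanSpace.single i 1))
  simpa [mul_comm] using this

theorem abs_clm_single_le (L : EuclideanSpace ℝ (Fin d) →L[ℝ] ℝ) (i : Fin d) :
    |L (EuclideanSpace.single i 1)| ≤ ‖L‖ := by
  simpa using L.le_opNorm (EuclideanSpace.single i 1)

/-- The derivative within a convex body of a Carathéodory function is measurable in the other
variable: in the interior it is a limit of difference quotients, and a boundary point is
a limit of interior points. -/
theorem measurable_fderivWithin_apply {𝒳 : Type*} [MeasurableSpace 𝒳] (hconv : Convex ℝ Θ)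
    (hne : (interior Θ).Nonempty) {φ : 𝒳 → EuclideanSpace ℝ (Fin d) → ℝ}
    (hm : ∀ θ ∈ Θ, Measurable fun u => φ u θ) (hc : ∀ u, ContDiffOn ℝ 1 (φ u) Θ)
    {θ : EuclideanSpace ℝ (Fin d)} (hθ : θ ∈ Θ) (v : EuclideanSpace ℝ (Fin d)) :
    Measurable fun u => fderivWithin ℝ (φ u) Θ θ v := by
  have hud := uniqueDiffOn_convex hconv hne
  have hint : ∀ θ ∈ interior Θ, Measurable fun u => fderivWithin ℝ (φ u) Θ θ v := by
    intro θ hθ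
    have hseq : Tendsto (fun m : ℕ => θ + ((m : ℝ) + 1)⁻¹ • v) atTop (𝓝 θ) := by
      have h0 : Tendsto (fun m : ℕ => ((m : ℝ) + 1)⁻¹) atTop (𝓝 0) := by
        simpa using tendsto_one_div_add_atTop_nhds_zero_nat (𝕜 := ℝ)
      simpa using (h0.smul_const v).const_add θ
    have hev : ∀ᶠ m : ℕ in atTop, θ + ((m : ℝ) + 1)⁻¹ • v ∈ Θ :=
      hseq.eventually (mem_interior_iff_mem_nhds.1 hθ)
    obtain ⟨N, hN⟩ := eventually_atTop.1 hev
    refine measurable_of_tendsto_metrizable (f := fun (m : ℕ) u =>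
      (((m + N : ℕ) : ℝ) + 1) * (φ u (θ + (((m + N : ℕ) : ℝ) + 1)⁻¹ • v) - φ u θ)) ?_ ?_
    · intro m
      exact ((hm _ (hN _ (by omega))).sub (hm θ (interior_subset hθ))).const_mul _
    · rw [tendsto_pi_nhds]
      intro u
      have hd : HasFDerivAt (φ u) (fderivWithin ℝ (φ u) Θ θ) θ :=
        (((hc u).differentiableOn one_ne_zero θ (interior_subset hθ)).hasFDerivWithinAt).hasFDerivAt
          (mem_interior_iff_mem_nhds.1 hθ)
      have hl := hd.lim v (c := fun m : ℕ => ((m : ℝ) + 1)) (l := atTop) ?_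
      · exact hl.comp (tendsto_add_atTop_nat N)
      · simp only [Real.norm_eq_abs]
        refine tendsto_atTop_mono (fun m => le_abs_self _) ?_
        exact tendsto_atTop_add_const_right _ _ tendsto_natCast_atTop_atTop
  obtain ⟨θ₀, hθ₀⟩ := hne
  have hmem : ∀ m : ℕ, θ + ((m : ℝ) + 1)⁻¹ • (θ₀ - θ) ∈ interior Θ := fun m =>
    hconv.add_smul_sub_mem_interior hθ hθ₀ ⟨by positivity, inv_le_one_of_one_le₀ (by simp)⟩
  have hseq : Tendsto (fun m : ℕ => θ + ((m : ℝ) + 1)⁻¹ • (θ₀ - θ)) atTop (𝓝 θ) := by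
    have h0 : Tendsto (fun m : ℕ => ((m : ℝ) + 1)⁻¹) atTop (𝓝 0) := by
      simpa using tendsto_one_div_add_atTop_nhds_zero_nat (𝕜 := ℝ)
    simpa using (h0.smul_const (θ₀ - θ)).const_add θ
  refine measurable_of_tendsto_metrizable
    (f := fun (m : ℕ) u => fderivWithin ℝ (φ u) Θ (θ + ((m : ℝ) + 1)⁻¹ • (θ₀ - θ)) v)
    (fun m => hint _ (hmem m)) ?_
  rw [tendsto_pi_nhds]
  intro u
  have hcd : ContinuousOn (fun θ => fderivWithin ℝ (φ u) Θ θ v) Θ :=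
    ((hc u).continuousOn_fderivWithin hud le_rfl).clm_apply continuousOn_const
  exact (hcd θ hθ).tendsto.comp (tendsto_nhdsWithin_iff.2
    ⟨hseq, Eventually.of_forall fun m => interior_subset (hmem m)⟩)

/-- The remainder of the first-order expansion of `φ` at `θ₁`, relative to `‖θ - θ₁‖` (and zero at
`θ = θ₁`). -/
def remQuot (φ : EuclideanSpace ℝ (Fin d) → ℝ) (Θ : Set (EuclideanSpace ℝ (Fin d)))
    (θ₁ θ : EuclideanSpace ℝ (Fin d)) : ℝ :=
  ‖θ - θ₁‖⁻¹ * |φ θ - φ θ₁ - fderivWithin ℝ φ Θ θ₁ (θ - θ₁)|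

theorem remQuot_nonneg (φ : EuclideanSpace ℝ (Fin d) → ℝ) (θ₁ θ : EuclideanSpace ℝ (Fin d)) :
    0 ≤ remQuot φ Θ θ₁ θ := by unfold remQuot; positivity

theorem remQuot_self (φ : EuclideanSpace ℝ (Fin d) → ℝ) (θ₁ : EuclideanSpace ℝ (Fin d)) :
    remQuot φ Θ θ₁ θ₁ = 0 := by simp [remQuot]

theorem abs_remainder_eq (φ : EuclideanSpace ℝ (Fin d) → ℝ) (θ₁ θ : EuclideanSpace ℝ (Fin d)) :
    |φ θ - φ θ₁ - fderivWithin ℝ φ Θ θ₁ (θ - θ₁)| = remQuot φ Θ θ₁ θ * ‖θ - θ₁‖ := by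
  rcases eq_or_ne θ θ₁ with rfl | h
  · simp
  · have : ‖θ - θ₁‖ ≠ 0 := by simpa [sub_eq_zero] using h
    unfold remQuot; field_simp

theorem continuousOn_remQuot {φ : EuclideanSpace ℝ (Fin d) → ℝ} (hc : ContDiffOn ℝ 1 φ Θ)
    {θ₁ : EuclideanSpace ℝ (Fin d)} (hθ₁ : θ₁ ∈ Θ) : ContinuousOn (remQuot φ Θ θ₁) Θ := by
  intro θ hθ
  rcases eq_or_ne θ θ₁ with rfl | h
  · have hd := (hc.differentiableOn one_ne_zero θ hθ).hasFDerivWithinAt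
    rw [hasFDerivWithinAt_iff_tendsto] at hd
    rw [ContinuousWithinAt, remQuot_self]
    exact hd
  · have h' : ‖θ - θ₁‖ ≠ 0 := by simpa [sub_eq_zero] using h
    unfold remQuot
    have hφ := hc.continuousOn θ hθ
    refine ContinuousWithinAt.mul (ContinuousWithinAt.inv₀ (by fun_prop) h') ?_
    refine ContinuousWithinAt.abs ?_
    refine (hφ.sub continuousWithinAt_const).sub ?_
    exact ((fderivWithin ℝ φ Θ θ₁).continuous.comp
      (continuous_id.sub continuous_const)).continuousWithinAt

theorem remQuot_le {φ : EuclideanSpace ℝ (Fin d) → ℝ} (hconv : Convex ℝ Θ)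
    (hc : ContDiffOn ℝ 1 φ Θ) {M : ℝ} (hM : ∀ θ ∈ Θ, ‖fderivWithin ℝ φ Θ θ‖ ≤ M)
    {θ₁ θ : EuclideanSpace ℝ (Fin d)} (hθ₁ : θ₁ ∈ Θ) (hθ : θ ∈ Θ) :
    remQuot φ Θ θ₁ θ ≤ 2 * M := by
  have hM0 : 0 ≤ M := (norm_nonneg _).trans (hM θ hθ)
  have h1 := hconv.norm_image_sub_le_of_norm_fderivWithin_le
    (hc.differentiableOn one_ne_zero) hM hθ₁ hθ
  have h2 := (fderivWithin ℝ φ Θ θ₁).le_of_opNorm_le (hM θ₁ hθ₁) (θ - θ₁)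
  rw [Real.norm_eq_abs] at h1 h2
  unfold remQuot
  rcases eq_or_ne θ θ₁ with rfl | h
  · simpa using hM0
  · have h' : 0 < ‖θ - θ₁‖ := by simpa [sub_eq_zero] using h
    rw [inv_mul_le_iff₀ h']
    refine (abs_sub _ _).trans ?_
    linarith

theorem measurable_remQuot {𝒳 : Type*} [MeasurableSpace 𝒳] (hconv : Convex ℝ Θ)
    (hne : (interior Θ).Nonempty) {φ : 𝒳 → EuclideanSpace ℝ (Fin d) → ℝ}
    (hm : ∀ θ ∈ Θ, Measurable fun u => φ u θ) (hc : ∀ u, ContDiffOn ℝ 1 (φ u) Θ)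
    {θ₁ θ : EuclideanSpace ℝ (Fin d)} (hθ₁ : θ₁ ∈ Θ) (hθ : θ ∈ Θ) :
    Measurable fun u => remQuot (φ u) Θ θ₁ θ := by
  unfold remQuot
  exact (((((hm θ hθ).sub (hm θ₁ hθ₁)).sub
    (measurable_fderivWithin_apply hconv hne hm hc hθ₁ _)).abs)).const_mul _

variable {p : ℕ} {g : EuclideanSpace ℝ (Fin p) → EuclideanSpace ℝ (Fin d) → ℝ}

theorem measurable_grad (hconv : Convex ℝ Θ) (hne : (interior Θ).Nonempty)
    (hm : ∀ θ ∈ Θ, Measurable fun u => g u θ) (hc : ∀ u, ContDiffOn ℝ 2 (g u) Θ)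
    {θ : EuclideanSpace ℝ (Fin d)} (hθ : θ ∈ Θ) (i : Fin d) :
    Measurable fun u => grad g Θ u θ i :=
  measurable_fderivWithin_apply hconv hne hm (fun u => (hc u).of_le one_le_two) hθ _

theorem contDiffOn_grad (hconv : Convex ℝ Θ) (hne : (interior Θ).Nonempty)
    (hc : ∀ u, ContDiffOn ℝ 2 (g u) Θ) (u : EuclideanSpace ℝ (Fin p)) (i : Fin d) :
    ContDiffOn ℝ 1 (fun θ => grad g Θ u θ i) Θ :=
  ((hc u).fderivWithin (uniqueDiffOn_convex hconv hne) (by norm_num [one_add_one_eq_two])).clm_apply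
    contDiffOn_const

theorem measurable_hess (hconv : Convex ℝ Θ) (hne : (interior Θ).Nonempty)
    (hm : ∀ θ ∈ Θ, Measurable fun u => g u θ) (hc : ∀ u, ContDiffOn ℝ 2 (g u) Θ)
    {θ : EuclideanSpace ℝ (Fin d)} (hθ : θ ∈ Θ) (i j : Fin d) :
    Measurable fun u => hess g Θ u θ i j :=
  measurable_fderivWithin_apply hconv hne (fun _ h => measurable_grad hconv hne hm hc h i)
    (fun u => contDiffOn_grad hconv hne hc u i) hθ _

theorem continuousOn_hess (hconv : Convex ℝ Θ) (hne : (interior Θ).Nonempty)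
    (hc : ∀ u, ContDiffOn ℝ 2 (g u) Θ) (u : EuclideanSpace ℝ (Fin p)) (i j : Fin d) :
    ContinuousOn (fun θ => hess g Θ u θ i j) Θ :=
  ((contDiffOn_grad hconv hne hc u i).continuousOn_fderivWithin (uniqueDiffOn_convex hconv hne)
    le_rfl).clm_apply continuousOn_const

theorem norm_fderivWithin_le_sqrt_grad (u : EuclideanSpace ℝ (Fin p))
    (θ : EuclideanSpace ℝ (Fin d)) :
    ‖fderivWithin ℝ (g u) Θ θ‖ ≤ √(∑ i, grad g Θ u θ i ^ 2) :=
  clm_norm_le_sqrt _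

theorem norm_fderivWithin_grad_le (u : EuclideanSpace ℝ (Fin p))
    (θ : EuclideanSpace ℝ (Fin d)) (i : Fin d) :
    ‖fderivWithin ℝ (fun θ' => grad g Θ u θ' i) Θ θ‖ ≤ frobNorm (hess g Θ u θ) := by
  refine (clm_norm_le_sqrt _).trans (Real.sqrt_le_sqrt ?_)
  exact Finset.single_le_sum (f := fun i => ∑ j, hess g Θ u θ i j ^ 2)
    (fun i _ => Finset.sum_nonneg fun j _ => sq_nonneg _) (Finset.mem_univ i)

theorem frobNorm_vecMulVec_self (v : Fin d → ℝ) :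
    frobNorm (Matrix.vecMulVec v v) = ∑ i, v i ^ 2 := by
  unfold frobNorm
  rw [Real.sqrt_eq_iff_mul_self_eq (by positivity) (by positivity)]
  simp only [Matrix.vecMulVec_apply, mul_pow]
  rw [Finset.sum_mul_sum]

theorem frobNorm_smul (c : ℝ) (A : Matrix (Fin d) (Fin d) ℝ) :
    frobNorm (c • A) = |c| * frobNorm A := by
  unfold frobNorm
  rw [← Real.sqrt_sq_eq_abs, ← Real.sqrt_mul (sq_nonneg c)]
  simp [mul_pow, Finset.mul_sum]

end Derivatives

/-! ### The regression model in terms of its errors -/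

/-- The regression model written in terms of the errors `e = Y - g(X,θs)` and
`es j = y_j - g(x_j,θs)`, which under the null hypothesis are centred and independent of the
covariates, with envelopes `B` and `C` for the first and second derivatives of the regression
function in the parameter. -/
structure ErrorModel {Ω : Type*} [MeasurableSpace Ω] (P : Measure Ω) {p d : ℕ}
    (X : Ω → EuclideanSpace ℝ (Fin p)) (e : Ω → ℝ)
    (x : ℕ → Ω → EuclideanSpace ℝ (Fin p)) (es : ℕ → Ω → ℝ)
    (g : EuclideanSpace ℝ (Fin p) → EuclideanSpace ℝ (Fin d) → ℝ)
    (Θ : Set (EuclideanSpace ℝ (Fin d))) (θs : EuclideanSpace ℝ (Fin d))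
    (B C : EuclideanSpace ℝ (Fin p) → ℝ) : Prop where
  measurable_X : Measurable X
  measurable_e : Measurable e
  measurable_x : ∀ j, Measurable (x j)
  measurable_es : ∀ j, Measurable (es j)
  indep : iIndepFun (fun j ω => (x j ω, es j ω)) P
  ident : ∀ j, IdentDistrib (fun ω => (x j ω, es j ω)) (fun ω => (X ω, e ω)) P P
  indep_Xe : IndepFun X e P
  integral_e : ∫ ω, e ω ∂P = 0
  memLp_e : MemLp e 2 P
  compact : IsCompact Θ
  convex : Convex ℝ Θ
  mem_interior : θs ∈ interior Θ
  measurable_g : ∀ θ ∈ Θ, Measurable fun u => g u θ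
  contDiffOn_g : ∀ u, ContDiffOn ℝ 2 (g u) Θ
  unique_min : ∀ θ ∈ Θ, θ ≠ θs →
    ∫ ω, e ω ^ 2 ∂P < ∫ ω, (e ω - (g (X ω) θ - g (X ω) θs)) ^ 2 ∂P
  measurable_B : Measurable B
  B_nonneg : ∀ u, 0 ≤ B u
  norm_grad_le : ∀ u, ∀ θ ∈ Θ, ‖fderivWithin ℝ (g u) Θ θ‖ ≤ B u
  memLp_B : MemLp (fun ω => B (X ω)) 2 P
  measurable_C : Measurable C
  C_nonneg : ∀ u, 0 ≤ C u
  norm_hess_le : ∀ u, ∀ θ ∈ Θ, ∀ i, ‖fderivWithin ℝ (fun θ' => grad g Θ u θ' i) Θ θ‖ ≤ C u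
  integrable_C : Integrable (fun ω => C (X ω)) P

/-- If `e` is centred and independent of `X`, a supremum over `θ` of `h(X,θ)` is controlled by the
supremum of `(e - δ(X,θ))² h(X,θ)`: conditionally on `X`, every `(e - δ)²` has a mean of at least
`E e²`. -/
theorem ofReal_mul_lintegral_biSup_le {Ω 𝒳 E : Type*} [MeasurableSpace Ω] [MeasurableSpace 𝒳]
    {P : Measure Ω} [IsProbabilityMeasure P] {X : Ω → 𝒳} {e : Ω → ℝ} (hX : Measurable X)
    (he : Measurable e) (hind : IndepFun X e P) (he0 : ∫ ω, e ω ∂P = 0) (he2 : MemLp e 2 P)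
    {D : Set E} (hD : D.Countable) {δ h : 𝒳 → E → ℝ} (hδ : ∀ θ ∈ D, Measurable fun u => δ u θ)
    (hh : ∀ θ ∈ D, Measurable fun u => h u θ) :
    ENNReal.ofReal (∫ ω, e ω ^ 2 ∂P) * ∫⁻ ω, ⨆ θ ∈ D, ENNReal.ofReal (h (X ω) θ) ∂P ≤
      ∫⁻ ω, ⨆ θ ∈ D, ENNReal.ofReal ((e ω - δ (X ω) θ) ^ 2 * h (X ω) θ) ∂P := by
  have hlaw := (indepFun_iff_map_prod_eq_prod_map_map hX.aemeasurable he.aemeasurable).1 hind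
  have : IsProbabilityMeasure (P.map X) := Measure.isProbabilityMeasure_map hX.aemeasurable
  have : IsProbabilityMeasure (P.map e) := Measure.isProbabilityMeasure_map he.aemeasurable
  have hF : Measurable fun z : 𝒳 × ℝ =>
      ⨆ θ ∈ D, ENNReal.ofReal ((z.2 - δ z.1 θ) ^ 2 * h z.1 θ) := by
    refine Measurable.biSup _ hD fun θ hθ => ENNReal.measurable_ofReal.comp ?_
    exact ((measurable_snd.sub ((hδ θ hθ).comp measurable_fst)).pow_const 2).mul
      ((hh θ hθ).comp measurable_fst)
  have hG : Measurable fun u : 𝒳 => ⨆ θ ∈ D, ENNReal.ofReal (h u θ) :=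
    Measurable.biSup _ hD fun θ hθ => ENNReal.measurable_ofReal.comp (hh θ hθ)
  have hR : ∫⁻ ω, ⨆ θ ∈ D, ENNReal.ofReal ((e ω - δ (X ω) θ) ^ 2 * h (X ω) θ) ∂P =
      ∫⁻ u, ∫⁻ v, ⨆ θ ∈ D, ENNReal.ofReal ((v - δ u θ) ^ 2 * h u θ) ∂(P.map e) ∂(P.map X) := by
    rw [← lintegral_prod _ hF.aemeasurable, ← hlaw, lintegral_map hF (hX.prodMk he)]
  have hL : ∫⁻ ω, ⨆ θ ∈ D, ENNReal.ofReal (h (X ω) θ) ∂P =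
      ∫⁻ u, ⨆ θ ∈ D, ENNReal.ofReal (h u θ) ∂(P.map X) := by
    rw [lintegral_map hG hX]
  rw [hR, hL, ← lintegral_const_mul _ hG]
  refine lintegral_mono fun u => ?_
  simp only [ENNReal.mul_iSup]
  refine iSup₂_le fun θ hθ => ?_
  have hshift : ∀ c : ℝ, ∫ ω, e ω ^ 2 ∂P ≤ ∫ ω, (e ω - c) ^ 2 ∂P := by
    intro c
    have h1 : Integrable (fun ω => e ω ^ 2) P := he2.integrable_sq
    have h2 : Integrable e P := he2.integrable one_le_two
    have : ∫ ω, (e ω - c) ^ 2 ∂P = ∫ ω, e ω ^ 2 ∂P + c ^ 2 := by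
      have h3 : ∀ ω, (e ω - c) ^ 2 = e ω ^ 2 - 2 * c * e ω + c ^ 2 := fun ω => by ring
      simp only [h3]
      rw [integral_add (h1.sub' (h2.const_mul _)) (integrable_const _),
        integral_sub h1 (h2.const_mul _), integral_const_mul, he0]
      simp
    rw [this]; nlinarith [sq_nonneg c]
  have hsq : ENNReal.ofReal (∫ ω, e ω ^ 2 ∂P) ≤
      ∫⁻ v, ENNReal.ofReal ((v - δ u θ) ^ 2) ∂(P.map e) := by
    rw [lintegral_map (by fun_prop) he, ← ofReal_integral_eq_lintegral_ofReal]
    · exact ENNReal.ofReal_le_ofReal (hshift _)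
    · exact (he2.sub (memLp_const (δ u θ))).integrable_sq
    · exact Eventually.of_forall fun _ => sq_nonneg _
  calc _ ≤ (∫⁻ v, ENNReal.ofReal ((v - δ u θ) ^ 2) ∂(P.map e)) * ENNReal.ofReal (h u θ) := by
        gcongr
    _ = ∫⁻ v, ENNReal.ofReal ((v - δ u θ) ^ 2 * h u θ) ∂(P.map e) := by
        rw [← lintegral_mul_const _ (by fun_prop)]
        exact lintegral_congr fun v => (ENNReal.ofReal_mul (sq_nonneg _)).symm
    _ ≤ _ := lintegral_mono fun v =>
        le_iSup₂ (f := fun θ (_ : θ ∈ D) => ENNReal.ofReal ((v - δ u θ) ^ 2 * h u θ)) θ hθ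

/-- Under the null hypothesis the least squares parameter is the true one. -/
theorem exists_error_of_null {Ω : Type*} [MeasurableSpace Ω] {P : Measure Ω}
    [IsProbabilityMeasure P] {p d : ℕ} {X : Ω → EuclideanSpace ℝ (Fin p)} {Y : Ω → ℝ}
    {x : ℕ → Ω → EuclideanSpace ℝ (Fin p)} {y : ℕ → Ω → ℝ}
    {g : EuclideanSpace ℝ (Fin p) → EuclideanSpace ℝ (Fin d) → ℝ}
    {Θ : Set (EuclideanSpace ℝ (Fin d))} {θs : EuclideanSpace ℝ (Fin d)}
    {K : EuclideanSpace ℝ (Fin p) → ℝ} {h : ℕ → ℝ}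
    (hreg : Regularity P X Y x y g Θ θs K h) (hnull : NullHypothesis P X Y g Θ) :
    IndepFun X (fun ω => Y ω - g (X ω) θs) P ∧ ∫ ω, (Y ω - g (X ω) θs) ∂P = 0 ∧
      MemLp (fun ω => Y ω - g (X ω) θs) 2 P := by
  have hgL : ∀ θ ∈ Θ, MemLp (fun ω => g (X ω) θ) 2 P := by
    intro θ hθ
    have hm : Measurable fun ω => g (X ω) θ := (hreg.measurable_g θ hθ).comp hreg.measurable_X
    rw [memLp_two_iff_integrable_sq hm.aestronglyMeasurable]
    refine ⟨(hm.pow_const 2).aestronglyMeasurable, ?_⟩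
    rw [hasFiniteIntegral_iff_ofReal (Eventually.of_forall fun _ => sq_nonneg _)]
    exact (lintegral_mono fun ω => le_iSup₂
      (f := fun θ (_ : θ ∈ Θ) => ENNReal.ofReal (g (X ω) θ ^ 2)) θ hθ).trans_lt hreg.sup_g
  obtain ⟨θ₀, hθ₀, ε, hεi, hε0, hind, hY⟩ := hnull
  have hεY : (fun ω => Y ω - g (X ω) θ₀) =ᵐ[P] ε := by
    filter_upwards [hY] with ω hω; rw [hω]; ring
  have hL : MemLp (fun ω => Y ω - g (X ω) θ₀) 2 P := hreg.memLp_Y.sub (hgL θ₀ hθ₀)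
  have hind' : IndepFun X (fun ω => Y ω - g (X ω) θ₀) P :=
    hind.congr (ae_eq_refl _) hεY.symm
  have h0 : ∫ ω, (Y ω - g (X ω) θ₀) ∂P = 0 := by rw [integral_congr_ae hεY, hε0]
  have hθ : θ₀ = θs := by
    by_contra hne
    refine absurd (hreg.unique_min θ₀ hθ₀ hne) (not_lt.2 ?_)
    have hΔ : MemLp (fun ω => g (X ω) θs - g (X ω) θ₀) 2 P :=
      (hgL θs hreg.mem_Theta).sub (hgL θ₀ hθ₀)
    have hi : IndepFun (fun ω => Y ω - g (X ω) θ₀) (fun ω => g (X ω) θs - g (X ω) θ₀) P :=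
      hind'.symm.comp (φ := id) (ψ := fun u => g u θs - g u θ₀) measurable_id
        ((hreg.measurable_g θs hreg.mem_Theta).sub (hreg.measurable_g θ₀ hθ₀))
    have hprod := hi.integral_fun_mul_eq_mul_integral hL.1 hΔ.1
    rw [h0, zero_mul] at hprod
    have hpi : Integrable (fun ω => (Y ω - g (X ω) θ₀) * (g (X ω) θs - g (X ω) θ₀)) P :=
      hL.integrable_mul hΔ
    have heq : ∀ ω, (Y ω - g (X ω) θs) ^ 2 = (Y ω - g (X ω) θ₀) ^ 2 -
        2 * ((Y ω - g (X ω) θ₀) * (g (X ω) θs - g (X ω) θ₀)) +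
        (g (X ω) θs - g (X ω) θ₀) ^ 2 := fun ω => by ring
    simp only [heq]
    rw [integral_add (hL.integrable_sq.sub' (hpi.const_mul _)) hΔ.integrable_sq,
      integral_sub hL.integrable_sq (hpi.const_mul _), integral_const_mul, hprod]
    have : 0 ≤ ∫ ω, (g (X ω) θs - g (X ω) θ₀) ^ 2 ∂P := integral_nonneg fun _ => sq_nonneg _
    linarith
  subst hθ
  exact ⟨hind', h0, hL⟩

/-- The regularity conditions and the null hypothesis give an `ErrorModel`: the envelope `B` of the
gradient comes from the moment condition on `ġ ġᵀ`, the envelope `C` of the Hessian from the one on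
the Hessian times the squared residual. -/
theorem exists_errorModel {Ω : Type*} [MeasurableSpace Ω] {P : Measure Ω}
    [IsProbabilityMeasure P] {p d : ℕ} {X : Ω → EuclideanSpace ℝ (Fin p)} {Y : Ω → ℝ}
    {x : ℕ → Ω → EuclideanSpace ℝ (Fin p)} {y : ℕ → Ω → ℝ}
    {g : EuclideanSpace ℝ (Fin p) → EuclideanSpace ℝ (Fin d) → ℝ}
    {Θ : Set (EuclideanSpace ℝ (Fin d))} {θs : EuclideanSpace ℝ (Fin d)}
    {K : EuclideanSpace ℝ (Fin p) → ℝ} {h : ℕ → ℝ}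
    (hreg : Regularity P X Y x y g Θ θs K h) (hnull : NullHypothesis P X Y g Θ)
    (hvar : 0 < ∫ ω, (Y ω - g (X ω) θs) ^ 2 ∂P) :
    ∃ B C, ErrorModel P X (fun ω => Y ω - g (X ω) θs) x (fun j ω => y j ω - g (x j ω) θs)
      g Θ θs B C := by
  obtain ⟨hind, h0, hL⟩ := exists_error_of_null hreg hnull
  have hint := hreg.interior_of_null hnull
  have hne : (interior Θ).Nonempty := ⟨_, hint⟩
  have hgs := hreg.measurable_g θs hreg.mem_Theta
  have hem : Measurable fun ω => Y ω - g (X ω) θs :=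
    hreg.measurable_Y.sub (hgs.comp hreg.measurable_X)
  have hφ : Measurable fun z : EuclideanSpace ℝ (Fin p) × ℝ => (z.1, z.2 - g z.1 θs) :=
    measurable_fst.prodMk (measurable_snd.sub (hgs.comp measurable_fst))
  have hgm := fun θ (hθ : θ ∈ Θ) i => measurable_grad hreg.convex_Theta hne hreg.measurable_g
    hreg.contDiffOn_g hθ i
  have hhm := fun θ (hθ : θ ∈ Θ) i j => measurable_hess hreg.convex_Theta hne hreg.measurable_g
    hreg.contDiffOn_g hθ i j
  obtain ⟨D, hDs, hDc, B2, hB2m, hB20, hB2, hB2i⟩ := exists_envelope (P := P)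
    hreg.compact_Theta
    hreg.measurable_X (q := fun u θ => ∑ i, grad g Θ u θ i ^ 2)
    (fun θ hθ => Finset.measurable_fun_sum _ fun i _ => (hgm θ hθ i).pow_const 2)
    (fun u => continuousOn_finsetSum _ fun i _ =>
      (contDiffOn_grad hreg.convex_Theta hne hreg.contDiffOn_g u i).continuousOn.pow 2)
    (fun u θ _ => Finset.sum_nonneg fun i _ => sq_nonneg _)
  have hB2int : Integrable (fun ω => B2 (X ω)) P := by
    refine hB2i (lt_of_le_of_lt (lintegral_mono fun ω => ?_) hreg.sup_grad)
    simp only [frobNorm_vecMulVec_self]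
    exact biSup_mono hDs
  obtain ⟨D', hDs', hDc', C, hCm, hC0, hC, hCi⟩ := exists_envelope (P := P)
    hreg.compact_Theta
    hreg.measurable_X (q := fun u θ => frobNorm (hess g Θ u θ))
    (fun θ hθ => (Finset.measurable_fun_sum _ fun i _ => Finset.measurable_fun_sum _ fun j _ =>
      (hhm θ hθ i j).pow_const 2).sqrt)
    (fun u => (continuousOn_finsetSum _ fun i _ => continuousOn_finsetSum _ fun j _ =>
      (continuousOn_hess hreg.convex_Theta hne hreg.contDiffOn_g u i j).pow 2).sqrt)
    (fun u θ _ => Real.sqrt_nonneg _)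
  have hCint : Integrable (fun ω => C (X ω)) P := by
    refine hCi ?_
    have hle := ofReal_mul_lintegral_biSup_le hreg.measurable_X hem hind h0 hL hDc'
      (δ := fun u θ => g u θ - g u θs) (h := fun u θ => frobNorm (hess g Θ u θ))
      (fun θ hθ => (hreg.measurable_g θ (hDs' hθ)).sub hgs)
      (fun θ hθ => (Finset.measurable_fun_sum _ fun i _ => Finset.measurable_fun_sum _ fun j _ =>
        (hhm θ (hDs' hθ) i j).pow_const 2).sqrt)
    have hlt := hle.trans_lt (lt_of_le_of_lt (lintegral_mono fun ω => ?_) hreg.sup_res_hess)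
    -- the positive error variance can be cancelled from a finite product
    · by_contra hcon
      rw [not_lt, top_le_iff] at hcon
      rw [hcon, ENNReal.mul_top (by simpa using hvar)] at hlt
      exact lt_irrefl _ hlt
    · simp only [frobNorm_smul, abs_pow, sq_abs, sub_sub, add_sub_cancel]
      exact biSup_mono hDs'
  refine ⟨fun u => √(B2 u), C, ?_⟩
  exact
  { measurable_X := hreg.measurable_X
    measurable_e := hem
    measurable_x := hreg.measurable_x
    measurable_es := fun j => (hreg.measurable_y j).sub (hgs.comp (hreg.measurable_x j))
    indep := hreg.indep.comp (fun _ => fun z => (z.1, z.2 - g z.1 θs)) fun _ => hφ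
    ident := fun j => (hreg.identDistrib j).comp hφ
    indep_Xe := hind
    integral_e := h0
    memLp_e := hL
    compact := hreg.compact_Theta
    convex := hreg.convex_Theta
    mem_interior := hint
    measurable_g := hreg.measurable_g
    contDiffOn_g := hreg.contDiffOn_g
    unique_min := fun θ hθ hne => by
      simpa only [sub_sub, add_sub_cancel] using hreg.unique_min θ hθ hne
    measurable_B := hB2m.sqrt
    B_nonneg := fun u => Real.sqrt_nonneg _
    norm_grad_le := fun u θ hθ =>
      (norm_fderivWithin_le_sqrt_grad u θ).trans (Real.sqrt_le_sqrt (hB2 u θ hθ))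
    memLp_B := by
      refine (memLp_two_iff_integrable_sq
        (hB2m.sqrt.comp hreg.measurable_X).aestronglyMeasurable).2 ?_
      simpa only [Function.comp_def, Real.sq_sqrt (hB20 _)] using hB2int
    measurable_C := hCm
    C_nonneg := hC0
    norm_hess_le := fun u θ hθ i => (norm_fderivWithin_grad_le u θ i).trans (hC u θ hθ)
    integrable_C := hCint }

/-! ### Consistency of the least squares estimator -/

namespace ErrorModel

variable {Ω : Type*} [MeasurableSpace Ω] {P : Measure Ω} [IsProbabilityMeasure P] {p d : ℕ}
  {X : Ω → EuclideanSpace ℝ (Fin p)} {e : Ω → ℝ}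
  {x : ℕ → Ω → EuclideanSpace ℝ (Fin p)} {es : ℕ → Ω → ℝ}
  {g : EuclideanSpace ℝ (Fin p) → EuclideanSpace ℝ (Fin d) → ℝ}
  {Θ : Set (EuclideanSpace ℝ (Fin d))} {θs : EuclideanSpace ℝ (Fin d)}
  {B C : EuclideanSpace ℝ (Fin p) → ℝ} {T : ℕ → Ω → EuclideanSpace ℝ (Fin d)}

theorem mem (M : ErrorModel P X e x es g Θ θs B C) : θs ∈ Θ := interior_subset M.mem_interior

theorem nonempty_interior (M : ErrorModel P X e x es g Θ θs B C) : (interior Θ).Nonempty :=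
  ⟨_, M.mem_interior⟩

theorem contDiffOn_one (M : ErrorModel P X e x es g Θ θs B C) (u : EuclideanSpace ℝ (Fin p)) :
    ContDiffOn ℝ 1 (g u) Θ := (M.contDiffOn_g u).of_le one_le_two

theorem abs_sub_le (M : ErrorModel P X e x es g Θ θs B C) (u : EuclideanSpace ℝ (Fin p))
    {θ : EuclideanSpace ℝ (Fin d)} (hθ : θ ∈ Θ) :
    |g u θ - g u θs| ≤ B u * ‖θ - θs‖ :=
  M.convex.norm_image_sub_le_of_norm_fderivWithin_le
    ((M.contDiffOn_one u).differentiableOn one_ne_zero) (M.norm_grad_le u) M.mem hθ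

theorem exists_radius (M : ErrorModel P X e x es g Θ θs B C) :
    ∃ R, 0 ≤ R ∧ ∀ θ ∈ Θ, ‖θ - θs‖ ≤ R := by
  obtain ⟨R, hR⟩ := M.compact.isBounded.subset_closedBall θs
  refine ⟨R, ?_, fun θ hθ => by simpa [dist_eq_norm] using hR hθ⟩
  simpa using (dist_nonneg.trans (Metric.mem_closedBall.1 (hR M.mem)))

/-- The squared residual as a function of the covariate, the error and the parameter. -/
def sqResidual (g : EuclideanSpace ℝ (Fin p) → EuclideanSpace ℝ (Fin d) → ℝ)
    (θs : EuclideanSpace ℝ (Fin d)) (z : EuclideanSpace ℝ (Fin p) × ℝ)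
    (θ : EuclideanSpace ℝ (Fin d)) : ℝ :=
  (z.2 - (g z.1 θ - g z.1 θs)) ^ 2

theorem measurable_sqResidual (M : ErrorModel P X e x es g Θ θs B C)
    {θ : EuclideanSpace ℝ (Fin d)} (hθ : θ ∈ Θ) : Measurable fun z => sqResidual g θs z θ :=
  (measurable_snd.sub (((M.measurable_g θ hθ).comp measurable_fst).sub
    ((M.measurable_g θs M.mem).comp measurable_fst))).pow_const 2

theorem continuousOn_sqResidual (M : ErrorModel P X e x es g Θ θs B C)
    (z : EuclideanSpace ℝ (Fin p) × ℝ) : ContinuousOn (sqResidual g θs z) Θ :=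
  (continuousOn_const.sub ((M.contDiffOn_g z.1).continuousOn.sub continuousOn_const)).pow 2

/-- An integrable envelope for the squared residuals, since `Θ` is bounded and the gradient has
a square integrable envelope. -/
theorem exists_sqResidual_le (M : ErrorModel P X e x es g Θ θs B C) :
    ∃ env : EuclideanSpace ℝ (Fin p) × ℝ → ℝ, Measurable env ∧
      Integrable (fun ω => env (X ω, e ω)) P ∧
      ∀ z, ∀ θ ∈ Θ, sqResidual g θs z θ ≤ env z := by
  obtain ⟨R, hR0, hR⟩ := M.exists_radius
  refine ⟨fun z => 2 * z.2 ^ 2 + 2 * R ^ 2 * B z.1 ^ 2, ?_, ?_, ?_⟩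
  · exact ((measurable_snd.pow_const 2).const_mul 2).add
      (((M.measurable_B.comp measurable_fst).pow_const 2).const_mul _)
  · exact (M.memLp_e.integrable_sq.const_mul 2).add (M.memLp_B.integrable_sq.const_mul _)
  · intro z θ hθ
    have h1 := M.abs_sub_le z.1 hθ
    have h2 : |g z.1 θ - g z.1 θs| ≤ B z.1 * R :=
      h1.trans (mul_le_mul_of_nonneg_left (hR θ hθ) (M.B_nonneg _))
    have h3 := sq_le_sq' (abs_le.1 h2).1 (abs_le.1 h2).2
    unfold sqResidual
    nlinarith [sq_nonneg (z.2 + (g z.1 θ - g z.1 θs))]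

theorem integrable_sqResidual (M : ErrorModel P X e x es g Θ θs B C)
    {θ : EuclideanSpace ℝ (Fin d)} (hθ : θ ∈ Θ) :
    Integrable (fun ω => sqResidual g θs (X ω, e ω) θ) P := by
  obtain ⟨env, -, hi, hle⟩ := M.exists_sqResidual_le
  refine hi.mono' ((M.measurable_sqResidual hθ).comp
    (M.measurable_X.prodMk M.measurable_e)).aestronglyMeasurable (Eventually.of_forall fun ω => ?_)
  exact (Real.norm_of_nonneg (sq_nonneg _)).trans_le (hle _ θ hθ)

/-- Consistency: near every other parameter `θ₁` the sum of squares exceeds its value at `θs` with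
probability tending to one, and finitely many such neighbourhoods cover the complement of
a neighbourhood of `θs`. -/
theorem tendsto_leastSquares (M : ErrorModel P X e x es g Θ θs B C) (hT : ∀ n ω, T n ω ∈ Θ)
    (hmin : ∀ n ω, avg n (fun j => sqResidual g θs (x j ω, es j ω) (T n ω)) ≤
      avg n (fun j => es j ω ^ 2)) :
    Tendsto (fun a : ℕ × Ω => T a.1 a.2) (inProb P) (𝓝 θs) := by
  rw [Metric.tendsto_nhds]
  intro κ hκ
  have hK : IsCompact (Θ \ Metric.ball θs κ) := M.compact.diff Metric.isOpen_ball
  have key : ∀ᶠ a : ℕ × Ω in inProb P, T a.1 a.2 ∉ Θ \ Metric.ball θs κ := by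
    refine hK.induction_on (p := fun s => ∀ᶠ a : ℕ × Ω in inProb P, T a.1 a.2 ∉ s) (by simp)
      (fun s t hst ht => ht.mono fun a ha h => ha (hst h))
      (fun s t hs ht => (hs.and ht).mono fun a ha h => h.elim ha.1 ha.2) ?_
    intro θ₁ hθ₁
    have hne : θ₁ ≠ θs := by
      rintro rfl; exact hθ₁.2 (Metric.mem_ball_self hκ)
    have hγ := M.unique_min θ₁ hθ₁.1 hne
    obtain ⟨env, hem, hei, hele⟩ := M.exists_sqResidual_le
    have hi1 := M.integrable_sqResidual hθ₁.1
    have henv0 : ∀ z, ∀ θ ∈ Θ, |sqResidual g θs z θ - sqResidual g θs z θ₁| ≤ env z := by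
      intro z θ hθ
      have h1 := hele z θ hθ
      have h2 := hele z θ₁ hθ₁.1
      have h3 : 0 ≤ sqResidual g θs z θ := sq_nonneg _
      have h4 : 0 ≤ sqResidual g θs z θ₁ := sq_nonneg _
      rw [abs_le]; constructor <;> linarith
    obtain ⟨δ, hδ, f, hfm, hf0, hfi, hfγ, hfq⟩ := exists_modulus (P := P) hθ₁.1
      (M.measurable_X.prodMk M.measurable_e)
      (q := fun z θ => |sqResidual g θs z θ - sqResidual g θs z θ₁|)
      (fun θ hθ => ((M.measurable_sqResidual hθ).sub (M.measurable_sqResidual hθ₁.1)).abs)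
      (fun z => ((M.continuousOn_sqResidual z).sub continuousOn_const).abs)
      (fun z θ _ => abs_nonneg _) (fun z => by simp) henv0 hei (sub_pos.2 hγ)
    refine ⟨Metric.ball θ₁ δ, mem_nhdsWithin_of_mem_nhds (Metric.ball_mem_nhds _ hδ), ?_⟩
    have hlln := tendsto_avg (P := P) (Z := fun ω => (X ω, e ω)) M.indep M.ident
      (f := fun z => sqResidual g θs z θ₁ - z.2 ^ 2 - f z)
      (((M.measurable_sqResidual hθ₁.1).sub (measurable_snd.pow_const 2)).sub hfm)
      ((hi1.sub M.memLp_e.integrable_sq).sub hfi)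
    have hpos : 0 < ∫ ω, (sqResidual g θs (X ω, e ω) θ₁ - e ω ^ 2 - f (X ω, e ω)) ∂P := by
      rw [integral_sub (hi1.sub' M.memLp_e.integrable_sq) hfi,
        integral_sub hi1 M.memLp_e.integrable_sq]
      unfold sqResidual
      linarith
    filter_upwards [hlln.eventually (lt_mem_nhds hpos)] with a ha hmem
    have h1 := hmin a.1 a.2
    have h2 := avg_mono a.1 (f := fun j => sqResidual g θs (x j a.2, es j a.2) θ₁ - es j a.2 ^ 2 -
      f (x j a.2, es j a.2)) (f' := fun j => sqResidual g θs (x j a.2, es j a.2) (T a.1 a.2) -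
        es j a.2 ^ 2) (fun j => by
          have := (abs_le.1 (hfq (x j a.2, es j a.2) _ (hT a.1 a.2) hmem)).1
          linarith)
    rw [avg_sub a.1 (fun j => sqResidual g θs (x j a.2, es j a.2) (T a.1 a.2))] at h2
    linarith
  filter_upwards [key] with a ha
  by_contra hcon
  exact ha ⟨hT _ _, hcon⟩

end ErrorModel

/-! ### Averages evaluated at a consistent estimator, and the order of centred averages -/

section Plugin

variable {Ω 𝒵 : Type*} [MeasurableSpace Ω] [MeasurableSpace 𝒵] {P : Measure Ω}
  [IsProbabilityMeasure P]

/-- A law of large numbers for averages of `f(z_j, T)` with a consistent estimator `T`. -/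
theorem tendsto_avg_plugin {E : Type*} [PseudoMetricSpace E] [SecondCountableTopology E]
    {Θ : Set E} {θ₁ : E} (hθ₁ : θ₁ ∈ Θ) {Z : Ω → 𝒵} (hZ : Measurable Z) {z : ℕ → Ω → 𝒵}
    (hind : iIndepFun z P)
    (hid : ∀ j, IdentDistrib (z j) Z P P) {T : ℕ → Ω → E} (hT : ∀ n ω, T n ω ∈ Θ)
    (hcons : Tendsto (fun a : ℕ × Ω => T a.1 a.2) (inProb P) (𝓝 θ₁))
    {f : 𝒵 → E → ℝ} (hfm : ∀ θ ∈ Θ, Measurable fun v => f v θ) (hfc : ∀ v, ContinuousOn (f v) Θ)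
    {env : 𝒵 → ℝ} (henv : ∀ v, ∀ θ ∈ Θ, |f v θ| ≤ env v)
    (hint : Integrable (fun ω => env (Z ω)) P) :
    Tendsto (fun a : ℕ × Ω => avg a.1 fun j => f (z j a.2) (T a.1 a.2)) (inProb P)
      (𝓝 (∫ ω, f (Z ω) θ₁ ∂P)) := by
  have h1 := tendsto_avg_of_consistent (P := P) hθ₁ hZ hid hT hcons
    (q := fun v θ => |f v θ - f v θ₁|)
    (fun θ hθ => ((hfm θ hθ).sub (hfm θ₁ hθ₁)).abs)
    (fun v => ((hfc v).sub continuousOn_const).abs) (fun v θ _ => abs_nonneg _)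
    (fun v => by simp) (env := fun v => 2 * env v)
    (fun v θ hθ => (abs_sub _ _).trans (by linarith [henv v θ hθ, henv v θ₁ hθ₁]))
    (hint.const_mul 2)
  have hi : Integrable (fun ω => f (Z ω) θ₁) P :=
    hint.mono' ((hfm θ₁ hθ₁).comp hZ).aestronglyMeasurable
      (Eventually.of_forall fun ω => henv _ _ hθ₁)
  have h2 := tendsto_avg hind hid (hfm θ₁ hθ₁) hi
  have h3 : Tendsto (fun a : ℕ × Ω => avg a.1 (fun j => f (z j a.2) (T a.1 a.2)) -
      avg a.1 fun j => f (z j a.2) θ₁) (inProb P) (𝓝 0) := by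
    refine squeeze_zero_norm (fun a => ?_) h1
    rw [← avg_sub]
    exact abs_avg_le _ _
  simpa using h3.add h2

theorem sqrt_mul_avg (n : ℕ) (f : ℕ → ℝ) :
    √(n : ℝ) * avg n f = (√(n : ℝ))⁻¹ * ∑ j ∈ Finset.range n, f j := by
  unfold avg
  rcases Nat.eq_zero_or_pos n with rfl | hn
  · simp
  · have : (0 : ℝ) < n := by exact_mod_cast hn
    have h : √(n : ℝ) ≠ 0 := (Real.sqrt_pos.2 this).ne'
    rw [← mul_assoc]
    congr 1
    field_simp
    rw [Real.sq_sqrt this.le]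

/-- Normalized averages of centred square integrable functions of an i.i.d. sequence are bounded in
probability: their variances do not depend on `n`. -/
theorem bddInProb_sqrt_mul_avg {Z : Ω → 𝒵} {z : ℕ → Ω → 𝒵}
    (hind : iIndepFun z P) (hid : ∀ j, IdentDistrib (z j) Z P P) {f : 𝒵 → ℝ} (hf : Measurable f)
    (h0 : ∫ ω, f (Z ω) ∂P = 0) (h2 : MemLp (fun ω => f (Z ω)) 2 P) :
    BddInProb P fun a => √(a.1 : ℝ) * avg a.1 fun j => f (z j a.2) := by
  have hid' : ∀ j, IdentDistrib (fun ω => f (z j ω)) (fun ω => f (Z ω)) P P :=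
    fun j => (hid j).comp hf
  have hL : ∀ j, MemLp (fun ω => f (z j ω)) 2 P := fun j => (hid' j).memLp_iff.2 h2
  have hsL : ∀ n : ℕ, MemLp (fun ω => (√(n : ℝ))⁻¹ * ∑ j ∈ Finset.range n, f (z j ω)) 2 P :=
    fun n => (memLp_finsetSum _ fun j _ => hL j).const_mul _
  simp only [sqrt_mul_avg]
  refine bddInProb_of_integral_le (C := 1 + ∫ ω, f (Z ω) ^ 2 ∂P)
    (Eventually.of_forall fun n => (hsL n).integrable one_le_two)
    (Eventually.of_forall fun n => ?_)
  have hle : ∀ t : ℝ, |t| ≤ 1 + t ^ 2 := fun t => by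
    rw [← sq_abs t]; nlinarith [sq_nonneg (|t| - 1), abs_nonneg t]
  refine (integral_mono ((hsL n).integrable one_le_two).abs
    ((integrable_const (1 : ℝ)).add (hsL n).integrable_sq) fun ω => hle _).trans ?_
  simp only [Pi.add_apply]
  rw [integral_add (integrable_const _) (hsL n).integrable_sq]
  simp only [integral_const, probReal_univ, smul_eq_mul, mul_one, mul_pow]
  rw [integral_const_mul]
  have hvar := IndepFun.variance_sum (μ := P) (X := fun j ω => f (z j ω)) (s := Finset.range n)
    (fun j _ => hL j) (fun i _ j _ hij => (hind.comp (fun _ => f) fun _ => hf).indepFun hij)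
  have hmean : ∫ ω, (∑ j ∈ Finset.range n, fun ω => f (z j ω)) ω ∂P = 0 := by
    simp only [Finset.sum_apply]
    rw [integral_finsetSum _ fun j _ => (hL j).integrable one_le_two]
    exact Finset.sum_eq_zero fun j _ => by rw [(hid' j).integral_eq, h0]
  rw [variance_of_integral_eq_zero (memLp_finsetSum' _ fun j _ => hL j).1.aemeasurable hmean]
    at hvar
  simp only [Finset.sum_apply] at hvar
  rw [hvar]
  simp only [fun j => (hid' j).variance_eq, Finset.sum_const, Finset.card_range, nsmul_eq_mul]
  rw [variance_of_integral_eq_zero h2.1.aemeasurable h0]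
  gcongr
  rw [← mul_assoc]
  refine mul_le_of_le_one_left (integral_nonneg fun _ => sq_nonneg _) ?_
  rw [inv_pow, Real.sq_sqrt (Nat.cast_nonneg n)]
  exact inv_mul_le_one

end Plugin

/-! ### Linearization of the score equation -/

namespace ErrorModel

variable {Ω : Type*} [MeasurableSpace Ω] {P : Measure Ω} [IsProbabilityMeasure P] {p d : ℕ}
  {X : Ω → EuclideanSpace ℝ (Fin p)} {e : Ω → ℝ}
  {x : ℕ → Ω → EuclideanSpace ℝ (Fin p)} {es : ℕ → Ω → ℝ}
  {g : EuclideanSpace ℝ (Fin p) → EuclideanSpace ℝ (Fin d) → ℝ}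
  {Θ : Set (EuclideanSpace ℝ (Fin d))} {θs : EuclideanSpace ℝ (Fin d)}
  {B C : EuclideanSpace ℝ (Fin p) → ℝ} {T : ℕ → Ω → EuclideanSpace ℝ (Fin d)}

theorem abs_grad_le (M : ErrorModel P X e x es g Θ θs B C) (u : EuclideanSpace ℝ (Fin p))
    {θ : EuclideanSpace ℝ (Fin d)} (hθ : θ ∈ Θ) (i : Fin d) : |grad g Θ u θ i| ≤ B u :=
  (abs_clm_single_le _ i).trans (M.norm_grad_le u θ hθ)

theorem abs_hess_le (M : ErrorModel P X e x es g Θ θs B C) (u : EuclideanSpace ℝ (Fin p))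
    {θ : EuclideanSpace ℝ (Fin d)} (hθ : θ ∈ Θ) (i k : Fin d) : |hess g Θ u θ i k| ≤ C u :=
  (abs_clm_single_le _ k).trans (M.norm_hess_le u θ hθ i)

theorem measurable_grad (M : ErrorModel P X e x es g Θ θs B C)
    {θ : EuclideanSpace ℝ (Fin d)} (hθ : θ ∈ Θ) (i : Fin d) :
    Measurable fun u => grad g Θ u θ i :=
  HybridTest.measurable_grad M.convex M.nonempty_interior M.measurable_g M.contDiffOn_g hθ i

theorem continuousOn_grad (M : ErrorModel P X e x es g Θ θs B C) (u : EuclideanSpace ℝ (Fin p))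
    (i : Fin d) : ContinuousOn (fun θ => grad g Θ u θ i) Θ :=
  (contDiffOn_grad M.convex M.nonempty_interior M.contDiffOn_g u i).continuousOn

/-- Products of a square integrable function of the covariate with the error are square integrable,
by independence. -/
theorem memLp_error_mul (M : ErrorModel P X e x es g Θ θs B C)
    {f : EuclideanSpace ℝ (Fin p) → ℝ} (hf : Measurable f)
    (hf2 : MemLp (fun ω => f (X ω)) 2 P) : MemLp (fun ω => e ω * f (X ω)) 2 P := by
  refine (memLp_two_iff_integrable_sq
    (M.measurable_e.mul (hf.comp M.measurable_X)).aestronglyMeasurable).2 ?_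
  have hi : IndepFun (fun ω => e ω ^ 2) (fun ω => f (X ω) ^ 2) P :=
    M.indep_Xe.symm.comp (φ := fun t => t ^ 2) (ψ := fun u => f u ^ 2)
      (measurable_id.pow_const 2) (hf.pow_const 2)
  exact (hi.integrable_mul M.memLp_e.integrable_sq hf2.integrable_sq).congr
    (Eventually.of_forall fun ω => (mul_pow _ _ 2).symm)

theorem integral_error_mul (M : ErrorModel P X e x es g Θ θs B C)
    {f : EuclideanSpace ℝ (Fin p) → ℝ} (hf : Measurable f) :
    ∫ ω, e ω * f (X ω) ∂P = 0 := by
  have hi : IndepFun e (fun ω => f (X ω)) P :=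
    M.indep_Xe.symm.comp (φ := id) (ψ := f) measurable_id hf
  rw [hi.integral_fun_mul_eq_mul_integral M.measurable_e.aestronglyMeasurable
    (hf.comp M.measurable_X).aestronglyMeasurable, M.integral_e, zero_mul]

theorem integrable_error_mul (M : ErrorModel P X e x es g Θ θs B C)
    {f : EuclideanSpace ℝ (Fin p) → ℝ} (hf : Measurable f)
    (hfi : Integrable (fun ω => f (X ω)) P) : Integrable (fun ω => e ω * f (X ω)) P := by
  have hi : IndepFun e (fun ω => f (X ω)) P :=
    M.indep_Xe.symm.comp (φ := id) (ψ := f) measurable_id hf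
  exact hi.integrable_mul (M.memLp_e.integrable one_le_two) hfi

theorem measurable_XE (M : ErrorModel P X e x es g Θ θs B C) :
    Measurable fun ω => (X ω, e ω) := M.measurable_X.prodMk M.measurable_e

/-- The law of large numbers with a consistent estimator plugged in, for the data of the model. -/
theorem tendsto_avg_plugin (M : ErrorModel P X e x es g Θ θs B C) (hT : ∀ n ω, T n ω ∈ Θ)
    (hcons : Tendsto (fun a : ℕ × Ω => T a.1 a.2) (inProb P) (𝓝 θs))
    {f : EuclideanSpace ℝ (Fin p) × ℝ → EuclideanSpace ℝ (Fin d) → ℝ}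
    (hfm : ∀ θ ∈ Θ, Measurable fun v => f v θ) (hfc : ∀ v, ContinuousOn (f v) Θ)
    {env : EuclideanSpace ℝ (Fin p) × ℝ → ℝ} (henv : ∀ v, ∀ θ ∈ Θ, |f v θ| ≤ env v)
    (hint : Integrable (fun ω => env (X ω, e ω)) P) :
    Tendsto (fun a : ℕ × Ω => avg a.1 fun j => f (x j a.2, es j a.2) (T a.1 a.2)) (inProb P)
      (𝓝 (∫ ω, f (X ω, e ω) θs ∂P)) :=
  HybridTest.tendsto_avg_plugin M.mem M.measurable_XE M.indep M.ident hT hcons hfm hfc henv hint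

theorem tendsto_avg (M : ErrorModel P X e x es g Θ θs B C)
    {f : EuclideanSpace ℝ (Fin p) × ℝ → ℝ} (hf : Measurable f)
    (hint : Integrable (fun ω => f (X ω, e ω)) P) :
    Tendsto (fun a : ℕ × Ω => avg a.1 fun j => f (x j a.2, es j a.2)) (inProb P)
      (𝓝 (∫ ω, f (X ω, e ω) ∂P)) :=
  HybridTest.tendsto_avg M.indep M.ident hf hint

/-- The first-order condition at a minimizer in the interior of the parameter set. -/
theorem score_eq_zero (M : ErrorModel P X e x es g Θ θs B C) {n : ℕ} {ω : Ω}
    {θ : EuclideanSpace ℝ (Fin d)} (hθ : θ ∈ interior Θ)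
    (hmin : IsMinOn (fun θ => ∑ j ∈ Finset.range n, sqResidual g θs (x j ω, es j ω) θ) Θ θ)
    (i : Fin d) :
    avg n (fun j => (es j ω - (g (x j ω) θ - g (x j ω) θs)) * grad g Θ (x j ω) θ i) = 0 := by
  have hnhds : Θ ∈ 𝓝 θ := mem_interior_iff_mem_nhds.1 hθ
  have hd : ∀ j, HasFDerivAt (fun θ => sqResidual g θs (x j ω, es j ω) θ)
      ((-(2 * (es j ω - (g (x j ω) θ - g (x j ω) θs)))) • fderivWithin ℝ (g (x j ω)) Θ θ) θ := by
    intro j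
    have h1 : HasFDerivAt (g (x j ω)) (fderivWithin ℝ (g (x j ω)) Θ θ) θ :=
      (((M.contDiffOn_one (x j ω)).differentiableOn one_ne_zero θ
        (interior_subset hθ)).hasFDerivWithinAt).hasFDerivAt hnhds
    have h2 := ((h1.sub_const (g (x j ω) θs)).const_sub (es j ω)).pow 2
    refine h2.congr_fderiv ?_
    ext v
    simp
  have hsum := HasFDerivAt.fun_sum (u := Finset.range n) fun j _ => hd j
  have h0 := (hmin.isLocalMin hnhds).hasFDerivAt_eq_zero hsum
  have h1 := DFunLike.congr_fun h0 (EuclideanSpace.single i 1)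
  simp only [FunLike.coe_sum, Finset.sum_apply, FunLike.coe_smul,
    Pi.smul_apply, smul_eq_mul, zero_apply] at h1
  have h2 : ∑ j ∈ Finset.range n,
      (es j ω - (g (x j ω) θ - g (x j ω) θs)) * grad g Θ (x j ω) θ i = 0 := by
    have : ∑ j ∈ Finset.range n, -(2 * (es j ω - (g (x j ω) θ - g (x j ω) θs))) *
        fderivWithin ℝ (g (x j ω)) Θ θ (EuclideanSpace.single i 1) =
        -2 * ∑ j ∈ Finset.range n,
          (es j ω - (g (x j ω) θ - g (x j ω) θs)) * grad g Θ (x j ω) θ i := by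
      rw [Finset.mul_sum]
      exact Finset.sum_congr rfl fun j _ => by unfold grad; ring
    rw [this] at h1
    linarith
  simp [avg, h2]

/-- Expanding the score around `θs`, with `u = θ̂ - θs`, the first-order condition says that `G u` is
the average of the `es j • ġ_j` up to an error that is small compared with `‖u‖`. -/
theorem exists_linearization (M : ErrorModel P X e x es g Θ θs B C) (hT : ∀ n ω, T n ω ∈ Θ)
    (hcons : Tendsto (fun a : ℕ × Ω => T a.1 a.2) (inProb P) (𝓝 θs))
    (hmin : ∀ n ω, IsMinOn
      (fun θ => ∑ j ∈ Finset.range n, sqResidual g θs (x j ω, es j ω) θ) Θ (T n ω)) :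
    ∃ κ : Fin d → ℕ × Ω → ℝ, (∀ i, Tendsto (κ i) (inProb P) (𝓝 0)) ∧
      ∀ᶠ a : ℕ × Ω in inProb P, ∀ i,
        |∑ k, gramMatrix P X g Θ θs i k * (T a.1 a.2 - θs) k -
          avg a.1 (fun j => es j a.2 * grad g Θ (x j a.2) θs i)| ≤
            κ i a * ‖T a.1 a.2 - θs‖ := by
  set G := gramMatrix P X g Θ θs with hG
  have hgr := fun i => contDiffOn_grad M.convex M.nonempty_interior M.contDiffOn_g (i := i)
  have hmX : ∀ {f : EuclideanSpace ℝ (Fin p) → ℝ}, Measurable f →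
      Measurable fun z : EuclideanSpace ℝ (Fin p) × ℝ => f z.1 := fun hf => hf.comp measurable_fst
  have hBB : Integrable (fun ω => B (X ω) * B (X ω)) P := M.memLp_B.integrable_mul M.memLp_B
  have t1 : ∀ i, Tendsto (fun a : ℕ × Ω => avg a.1 fun j => |es j a.2| *
      remQuot (fun θ => grad g Θ (x j a.2) θ i) Θ θs (T a.1 a.2)) (inProb P) (𝓝 0) := by
    intro i
    have h := M.tendsto_avg_plugin hT hcons
      (f := fun z θ => |z.2| * remQuot (fun θ => grad g Θ z.1 θ i) Θ θs θ)
      (fun θ hθ => measurable_snd.abs.mul (hmX (measurable_remQuot M.convex M.nonempty_interior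
        (φ := fun u θ => grad g Θ u θ i)
        (fun θ hθ => M.measurable_grad hθ i) (hgr i) M.mem hθ)))
      (fun z => continuousOn_const.mul (continuousOn_remQuot (hgr i z.1) M.mem))
      (env := fun z => 2 * |z.2 * C z.1|)
      (fun z θ hθ => by
        rw [abs_mul, abs_abs, abs_of_nonneg (remQuot_nonneg _ _ _), abs_mul,
          abs_of_nonneg (M.C_nonneg _)]
        have := remQuot_le M.convex (hgr i z.1) (fun θ hθ => M.norm_hess_le z.1 θ hθ i) M.mem hθ
        nlinarith [abs_nonneg z.2])
      ((M.integrable_error_mul M.measurable_C M.integrable_C).abs.const_mul 2)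
    simpa only [remQuot_self, mul_zero, integral_zero] using h
  have t2 : ∀ i, Tendsto (fun a : ℕ × Ω => avg a.1 fun j =>
      remQuot (g (x j a.2)) Θ θs (T a.1 a.2) * |grad g Θ (x j a.2) (T a.1 a.2) i|)
      (inProb P) (𝓝 0) := by
    intro i
    have h := M.tendsto_avg_plugin hT hcons
      (f := fun z θ => remQuot (g z.1) Θ θs θ * |grad g Θ z.1 θ i|)
      (fun θ hθ => (hmX (measurable_remQuot M.convex M.nonempty_interior
        M.measurable_g M.contDiffOn_one M.mem hθ)).mul (hmX (M.measurable_grad hθ i)).abs)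
      (fun z => (continuousOn_remQuot (M.contDiffOn_one z.1) M.mem).mul
        (M.continuousOn_grad z.1 i).abs)
      (env := fun z => 2 * (B z.1 * B z.1))
      (fun z θ hθ => by
        rw [abs_mul, abs_abs, abs_of_nonneg (remQuot_nonneg _ _ _), ← mul_assoc]
        exact mul_le_mul (remQuot_le M.convex (M.contDiffOn_one z.1) (M.norm_grad_le z.1) M.mem hθ)
          (M.abs_grad_le z.1 hθ i) (abs_nonneg _) (by linarith [M.B_nonneg z.1]))
      (hBB.const_mul 2)
    simpa only [remQuot_self, zero_mul, integral_zero] using h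
  have t3 : ∀ i k, Tendsto (fun a : ℕ × Ω => avg a.1 fun j =>
      grad g Θ (x j a.2) (T a.1 a.2) i * grad g Θ (x j a.2) θs k) (inProb P) (𝓝 (G i k)) := by
    intro i k
    exact M.tendsto_avg_plugin hT hcons
      (f := fun z θ => grad g Θ z.1 θ i * grad g Θ z.1 θs k)
      (fun θ hθ => (hmX (M.measurable_grad hθ i)).mul (hmX (M.measurable_grad M.mem k)))
      (fun z => (M.continuousOn_grad z.1 i).mul continuousOn_const)
      (env := fun z => B z.1 * B z.1)
      (fun z θ hθ => by
        rw [abs_mul]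
        exact mul_le_mul (M.abs_grad_le z.1 hθ i) (M.abs_grad_le z.1 M.mem k) (abs_nonneg _)
          (M.B_nonneg _))
      hBB
  have t4 : ∀ i k, Tendsto (fun a : ℕ × Ω => avg a.1 fun j =>
      es j a.2 * hess g Θ (x j a.2) θs i k) (inProb P) (𝓝 0) := by
    intro i k
    have hm : Measurable fun u => hess g Θ u θs i k :=
      measurable_hess M.convex M.nonempty_interior M.measurable_g M.contDiffOn_g M.mem i k
    have h := M.tendsto_avg (f := fun z => z.2 * hess g Θ z.1 θs i k)
      (measurable_snd.mul (hmX hm))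
      (M.integrable_error_mul hm (M.integrable_C.mono' (hm.comp M.measurable_X).aestronglyMeasurable
        (Eventually.of_forall fun ω => M.abs_hess_le _ M.mem i k)))
    rwa [M.integral_error_mul hm] at h
  refine ⟨fun i a =>
    (∑ k, |G i k - avg a.1 (fun j => grad g Θ (x j a.2) (T a.1 a.2) i * grad g Θ (x j a.2) θs k) +
      avg a.1 (fun j => es j a.2 * hess g Θ (x j a.2) θs i k)|) +
    avg a.1 (fun j => |es j a.2| *
      remQuot (fun θ => grad g Θ (x j a.2) θ i) Θ θs (T a.1 a.2)) +
    avg a.1 (fun j =>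
      remQuot (g (x j a.2)) Θ θs (T a.1 a.2) * |grad g Θ (x j a.2) (T a.1 a.2) i|),
    fun i => ?_, ?_⟩
  · have hs : Tendsto (fun a : ℕ × Ω => ∑ k, |G i k -
        avg a.1 (fun j => grad g Θ (x j a.2) (T a.1 a.2) i * grad g Θ (x j a.2) θs k) +
        avg a.1 (fun j => es j a.2 * hess g Θ (x j a.2) θs i k)|) (inProb P)
        (𝓝 (∑ k, |G i k - G i k + 0|)) :=
      tendsto_finsetSum _ fun k _ => ((tendsto_const_nhds.sub (t3 i k)).add (t4 i k)).abs
    simpa using (hs.add (t1 i)).add (t2 i)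
  · filter_upwards [hcons.eventually (isOpen_interior.mem_nhds M.mem_interior)] with a ha i
    set θ := T a.1 a.2 with hθ
    set N := ‖θ - θs‖
    have hscore := M.score_eq_zero ha (hmin a.1 a.2) i
    -- the remainders of the expansions of `g` and of its gradient
    set r : ℕ → ℝ := fun j => g (x j a.2) θ - g (x j a.2) θs -
      fderivWithin ℝ (g (x j a.2)) Θ θs (θ - θs) with hr
    set r' : ℕ → ℝ := fun j => grad g Θ (x j a.2) θ i - grad g Θ (x j a.2) θs i -
      fderivWithin ℝ (fun θ => grad g Θ (x j a.2) θ i) Θ θs (θ - θs) with hr'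
    -- the gradient is expanded in the product with the error only: in the other product it stays
    -- at `θ`, where its envelope is square integrable
    have hterm : ∀ j, (es j a.2 - (g (x j a.2) θ - g (x j a.2) θs)) * grad g Θ (x j a.2) θ i =
        es j a.2 * grad g Θ (x j a.2) θs i +
        ∑ k, (θ - θs) k * (es j a.2 * hess g Θ (x j a.2) θs i k) + es j a.2 * r' j -
        ∑ k, (θ - θs) k * (grad g Θ (x j a.2) θ i * grad g Θ (x j a.2) θs k) -
        r j * grad g Θ (x j a.2) θ i := by
      intro j
      have e1 : ∑ k, (θ - θs) k * (es j a.2 * hess g Θ (x j a.2) θs i k) = es j a.2 *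
          fderivWithin ℝ (fun θ => grad g Θ (x j a.2) θ i) Θ θs (θ - θs) := by
        rw [clm_apply_eq_sum _ (θ - θs), Finset.mul_sum]
        exact Finset.sum_congr rfl fun k _ => by simp only [hess, Matrix.of_apply]; ring
      have e2 : ∑ k, (θ - θs) k * (grad g Θ (x j a.2) θ i * grad g Θ (x j a.2) θs k) =
          grad g Θ (x j a.2) θ i * fderivWithin ℝ (g (x j a.2)) Θ θs (θ - θs) := by
        rw [clm_apply_eq_sum _ (θ - θs), Finset.mul_sum]
        exact Finset.sum_congr rfl fun k _ => by simp only [grad]; ring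
      rw [e1, e2, hr, hr']
      ring
    simp only [hterm] at hscore
    rw [avg_sub, avg_sub, avg_add, avg_add, avg_sum, avg_sum] at hscore
    simp only [avg_const_mul] at hscore
    have hkey : ∑ k, G i k * (θ - θs) k - avg a.1 (fun j => es j a.2 * grad g Θ (x j a.2) θs i) =
        ∑ k, (θ - θs) k * (G i k -
          avg a.1 (fun j => grad g Θ (x j a.2) θ i * grad g Θ (x j a.2) θs k) +
          avg a.1 (fun j => es j a.2 * hess g Θ (x j a.2) θs i k)) +
        avg a.1 (fun j => es j a.2 * r' j) -
        avg a.1 (fun j => r j * grad g Θ (x j a.2) θ i) := by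
      simp only [mul_add, mul_sub, Finset.sum_add_distrib, Finset.sum_sub_distrib]
      have : ∑ k, G i k * (θ - θs) k = ∑ k, (θ - θs) k * G i k :=
        Finset.sum_congr rfl fun k _ => mul_comm _ _
      linarith
    rw [hkey, add_mul, add_mul]
    refine (abs_sub _ _).trans (add_le_add ((abs_add_le _ _).trans (add_le_add ?_ ?_)) ?_)
    · rw [Finset.sum_mul]
      refine (Finset.abs_sum_le_sum_abs _ _).trans (Finset.sum_le_sum fun k _ => ?_)
      rw [abs_mul, mul_comm]
      exact mul_le_mul_of_nonneg_left (PiLp.norm_apply_le (θ - θs) k) (abs_nonneg _)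
    · rw [← avg_mul_const]
      refine (abs_avg_le _ _).trans (avg_mono _ fun j => ?_)
      rw [abs_mul, hr', abs_remainder_eq (fun θ => grad g Θ (x j a.2) θ i), mul_assoc]
    · rw [← avg_mul_const]
      refine (abs_avg_le _ _).trans (avg_mono _ fun j => ?_)
      rw [abs_mul, hr, abs_remainder_eq, mul_right_comm]

theorem bddInProb_sqrt_mul_score (M : ErrorModel P X e x es g Θ θs B C) (i : Fin d) :
    BddInProb P fun a => √(a.1 : ℝ) *
      avg a.1 fun j => es j a.2 * grad g Θ (x j a.2) θs i := by
  have hm := M.measurable_grad M.mem i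
  refine bddInProb_sqrt_mul_avg (Z := fun ω => (X ω, e ω)) M.indep M.ident
    (f := fun z => z.2 * grad g Θ z.1 θs i) (measurable_snd.mul (hm.comp measurable_fst))
    (M.integral_error_mul hm) (M.memLp_error_mul hm ?_)
  exact M.memLp_B.mono (hm.comp M.measurable_X).aestronglyMeasurable
    (Eventually.of_forall fun ω => (M.abs_grad_le _ M.mem i).trans (le_abs_self _))

/-- The least squares estimator is `√n`-consistent. -/
theorem bddInProb_sqrt_mul_norm (M : ErrorModel P X e x es g Θ θs B C)
    (hns : IsUnit (gramMatrix P X g Θ θs)) (hT : ∀ n ω, T n ω ∈ Θ)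
    (hcons : Tendsto (fun a : ℕ × Ω => T a.1 a.2) (inProb P) (𝓝 θs))
    (hmin : ∀ n ω, IsMinOn
      (fun θ => ∑ j ∈ Finset.range n, sqResidual g θs (x j ω, es j ω) θ) Θ (T n ω)) :
    BddInProb P fun a => √(a.1 : ℝ) * ‖T a.1 a.2 - θs‖ := by
  obtain ⟨κ, hκ, hlin⟩ := M.exists_linearization hT hcons hmin
  set G := gramMatrix P X g Θ θs with hG
  set S : Fin d → ℕ × Ω → ℝ := fun i a => avg a.1 fun j => es j a.2 * grad g Θ (x j a.2) θs i
    with hS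
  set c : ℝ := ∑ i, ∑ k, |G⁻¹ i k| with hc
  have hc0 : 0 ≤ c := Finset.sum_nonneg fun i _ => Finset.sum_nonneg fun k _ => abs_nonneg _
  have hsmall : Tendsto (fun a => c * ∑ i, κ i a) (inProb P) (𝓝 (c * ∑ _i : Fin d, 0)) :=
    (tendsto_finsetSum _ fun i _ => hκ i).const_mul c
  have hsmall' := hsmall.eventually (gt_mem_nhds (show c * ∑ _i : Fin d, (0 : ℝ) < 1 / 2 by simp))
  have hbdd : BddInProb P fun a => (2 * c) * ∑ i, |√(a.1 : ℝ) * S i a| :=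
    (bddInProb_const (2 * c)).mul
      (BddInProb.sum Finset.univ fun i _ => (M.bddInProb_sqrt_mul_score i).mono
        (Eventually.of_forall fun a => (abs_abs _).le))
  refine hbdd.mono ?_
  filter_upwards [hlin, hsmall'] with a ha hsm
  set u := T a.1 a.2 - θs with hu
  have hGinv : G⁻¹ * G = 1 := Matrix.nonsing_inv_mul _ ((Matrix.isUnit_iff_isUnit_det _).1 hns)
  have hu_eq : ∀ i, u i = ∑ k, G⁻¹ i k * ∑ l, G k l * u l := by
    intro i
    have h1 : (G⁻¹ * G).mulVec (fun l => u l) i = u i := by rw [hGinv, Matrix.one_mulVec]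
    rw [← h1, ← Matrix.mulVec_mulVec]
    simp [Matrix.mulVec, dotProduct]
  have hbound : ∀ k, |∑ l, G k l * u l| ≤ |S k a| + κ k a * ‖u‖ := by
    intro k
    have h1 := ha k
    have h2 := abs_sub_abs_le_abs_sub (∑ l, G k l * u l) (S k a)
    linarith
  have hnorm : ‖u‖ ≤ ∑ i, |u i| := by
    have h1 := (EuclideanSpace.basisFun (Fin d) ℝ).sum_repr u
    conv_lhs => rw [← h1]
    refine (norm_sum_le _ _).trans (Finset.sum_le_sum fun i _ => ?_)
    simp [norm_smul, EuclideanSpace.basisFun_apply]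
  have h0 : ∀ k, 0 ≤ |S k a| + κ k a * ‖u‖ := fun k => (abs_nonneg _).trans (hbound k)
  have h2 : ‖u‖ ≤ c * ∑ k, (|S k a| + κ k a * ‖u‖) := by
    refine hnorm.trans ?_
    rw [hc, Finset.sum_mul]
    refine Finset.sum_le_sum fun i _ => ?_
    rw [hu_eq i, Finset.sum_mul]
    refine (Finset.abs_sum_le_sum_abs _ _).trans (Finset.sum_le_sum fun k _ => ?_)
    rw [abs_mul]
    refine mul_le_mul_of_nonneg_left ((hbound k).trans ?_) (abs_nonneg _)
    exact Finset.single_le_sum (f := fun k => |S k a| + κ k a * ‖u‖) (fun k _ => h0 k)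
      (Finset.mem_univ k)
  rw [Finset.sum_add_distrib, ← Finset.sum_mul, mul_add, ← mul_assoc] at h2
  have h3 : ‖u‖ ≤ 2 * c * ∑ k, |S k a| := by nlinarith [norm_nonneg u]
  rw [abs_of_nonneg (mul_nonneg (Real.sqrt_nonneg _) (norm_nonneg _)), abs_of_nonneg
    (mul_nonneg (by positivity) (Finset.sum_nonneg fun i _ => abs_nonneg _))]
  simp only [abs_mul, abs_of_nonneg (Real.sqrt_nonneg _), ← Finset.mul_sum]
  calc √(a.1 : ℝ) * ‖u‖ ≤ √(a.1 : ℝ) * (2 * c * ∑ k, |S k a|) :=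
        mul_le_mul_of_nonneg_left h3 (Real.sqrt_nonneg _)
    _ = _ := by ring

end ErrorModel

namespace ErrorModel

variable {Ω : Type*} [MeasurableSpace Ω] {P : Measure Ω} [IsProbabilityMeasure P] {p d : ℕ}
  {X : Ω → EuclideanSpace ℝ (Fin p)} {e : Ω → ℝ}
  {x : ℕ → Ω → EuclideanSpace ℝ (Fin p)} {es : ℕ → Ω → ℝ}
  {g : EuclideanSpace ℝ (Fin p) → EuclideanSpace ℝ (Fin d) → ℝ}
  {Θ : Set (EuclideanSpace ℝ (Fin d))} {θs : EuclideanSpace ℝ (Fin d)}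
  {B C : EuclideanSpace ℝ (Fin p) → ℝ} {T : ℕ → Ω → EuclideanSpace ℝ (Fin d)}

/-! ### The weighted residual average -/

theorem memLp_grad (M : ErrorModel P X e x es g Θ θs B C) {θ : EuclideanSpace ℝ (Fin d)}
    (hθ : θ ∈ Θ) (i : Fin d) : MemLp (fun ω => grad g Θ (X ω) θ i) 2 P :=
  M.memLp_B.mono ((M.measurable_grad hθ i).comp M.measurable_X).aestronglyMeasurable
    (Eventually.of_forall fun _ => (M.abs_grad_le _ hθ i).trans (le_abs_self _))

theorem gramMatrix_symm_apply (P : Measure Ω) (X : Ω → EuclideanSpace ℝ (Fin p))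
    (g : EuclideanSpace ℝ (Fin p) → EuclideanSpace ℝ (Fin d) → ℝ)
    (Θ : Set (EuclideanSpace ℝ (Fin d))) (θ : EuclideanSpace ℝ (Fin d)) (i k : Fin d) :
    gramMatrix P X g Θ θ i k = gramMatrix P X g Θ θ k i := by
  simp only [gramMatrix, Matrix.of_apply, mul_comm]

/-- The weight corrected for the estimation of the parameter, `w - E(w ġ)ᵀ G⁻¹ ġ`: the residual of
the projection of `w` on the components of the gradient. -/
def effWeight (P : Measure Ω) (X : Ω → EuclideanSpace ℝ (Fin p))
    (g : EuclideanSpace ℝ (Fin p) → EuclideanSpace ℝ (Fin d) → ℝ)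
    (Θ : Set (EuclideanSpace ℝ (Fin d))) (θs : EuclideanSpace ℝ (Fin d))
    (w : EuclideanSpace ℝ (Fin p) → ℝ) (u : EuclideanSpace ℝ (Fin p)) : ℝ :=
  w u - ∑ i, (gramMatrix P X g Θ θs)⁻¹.mulVec (gradWeight P X g Θ w θs) i * grad g Θ u θs i

theorem gram_mulVec_inv_gradWeight (hns : IsUnit (gramMatrix P X g Θ θs))
    (w : EuclideanSpace ℝ (Fin p) → ℝ) (k : Fin d) :
    ∑ i, gramMatrix P X g Θ θs k i *
      (gramMatrix P X g Θ θs)⁻¹.mulVec (gradWeight P X g Θ w θs) i = gradWeight P X g Θ w θs k := by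
  have h : (gramMatrix P X g Θ θs).mulVec
      ((gramMatrix P X g Θ θs)⁻¹.mulVec (gradWeight P X g Θ w θs)) k =
      gradWeight P X g Θ w θs k := by
    rw [Matrix.mulVec_mulVec,
      Matrix.mul_nonsing_inv _ ((Matrix.isUnit_iff_isUnit_det _).1 hns), Matrix.one_mulVec]
  exact h

/-- The weighted average of the residuals is asymptotically the average of the errors with the
corrected weight. -/
theorem tendsto_sqrt_mul_avg_residual_sub (M : ErrorModel P X e x es g Θ θs B C)
    (hns : IsUnit (gramMatrix P X g Θ θs)) (hT : ∀ n ω, T n ω ∈ Θ)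
    (hcons : Tendsto (fun a : ℕ × Ω => T a.1 a.2) (inProb P) (𝓝 θs))
    (hmin : ∀ n ω, IsMinOn
      (fun θ => ∑ j ∈ Finset.range n, sqResidual g θs (x j ω, es j ω) θ) Θ (T n ω))
    {w : EuclideanSpace ℝ (Fin p) → ℝ} (hw : Measurable w)
    (hw2 : MemLp (fun ω => w (X ω)) 2 P) :
    Tendsto (fun a : ℕ × Ω =>
      √(a.1 : ℝ) * avg a.1 (fun j =>
        (es j a.2 - (g (x j a.2) (T a.1 a.2) - g (x j a.2) θs)) * w (x j a.2)) -
      √(a.1 : ℝ) * avg a.1 (fun j => es j a.2 * effWeight P X g Θ θs w (x j a.2)))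
      (inProb P) (𝓝 0) := by
  have hmX : ∀ {f : EuclideanSpace ℝ (Fin p) → ℝ}, Measurable f →
      Measurable fun z : EuclideanSpace ℝ (Fin p) × ℝ => f z.1 := fun hf => hf.comp measurable_fst
  obtain ⟨κ, hκ, hlin⟩ := M.exists_linearization hT hcons hmin
  have hrate := M.bddInProb_sqrt_mul_norm hns hT hcons hmin
  set G := gramMatrix P X g Θ θs with hG
  set α := gradWeight P X g Θ w θs with hα
  set b := G⁻¹.mulVec α with hb
  have t1 : ∀ k, Tendsto (fun a : ℕ × Ω => avg a.1 fun j =>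
      grad g Θ (x j a.2) θs k * w (x j a.2)) (inProb P) (𝓝 (α k)) := fun k =>
    M.tendsto_avg (f := fun z => grad g Θ z.1 θs k * w z.1)
      ((hmX (M.measurable_grad M.mem k)).mul (hmX hw)) ((M.memLp_grad M.mem k).integrable_mul hw2)
  have t2 : Tendsto (fun a : ℕ × Ω => avg a.1 fun j =>
      remQuot (g (x j a.2)) Θ θs (T a.1 a.2) * |w (x j a.2)|) (inProb P) (𝓝 0) := by
    have h := M.tendsto_avg_plugin hT hcons
      (f := fun z θ => remQuot (g z.1) Θ θs θ * |w z.1|)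
      (fun θ hθ => (hmX (measurable_remQuot M.convex M.nonempty_interior
        M.measurable_g M.contDiffOn_one M.mem hθ)).mul (hmX hw).abs)
      (fun z => (continuousOn_remQuot (M.contDiffOn_one z.1) M.mem).mul continuousOn_const)
      (env := fun z => 2 * |B z.1 * w z.1|)
      (fun z θ hθ => by
        rw [abs_mul, abs_abs, abs_of_nonneg (remQuot_nonneg _ _ _), abs_mul,
          abs_of_nonneg (M.B_nonneg _), ← mul_assoc]
        exact mul_le_mul_of_nonneg_right
          (remQuot_le M.convex (M.contDiffOn_one z.1) (M.norm_grad_le z.1) M.mem hθ) (abs_nonneg _))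
      ((M.memLp_B.integrable_mul hw2).abs.const_mul 2)
    simpa only [remQuot_self, zero_mul, integral_zero] using h
  have hκ' : Tendsto (fun a : ℕ × Ω => ∑ i, |b i| * κ i a +
      ∑ k, |α k - avg a.1 fun j => grad g Θ (x j a.2) θs k * w (x j a.2)| +
      avg a.1 fun j => remQuot (g (x j a.2)) Θ θs (T a.1 a.2) * |w (x j a.2)|)
      (inProb P) (𝓝 0) := by
    have h1 : Tendsto (fun a => ∑ i, |b i| * κ i a) (inProb P) (𝓝 (∑ i, |b i| * 0)) :=
      tendsto_finsetSum _ fun i _ => (hκ i).const_mul _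
    have h2 : Tendsto (fun a : ℕ × Ω => ∑ k, |α k - avg a.1 fun j =>
        grad g Θ (x j a.2) θs k * w (x j a.2)|) (inProb P) (𝓝 (∑ k, |α k - α k|)) :=
      tendsto_finsetSum _ fun k _ => (tendsto_const_nhds.sub (t1 k)).abs
    simpa using (h1.add h2).add t2
  refine squeeze_zero_norm' ?_ (hrate _ hκ')
  filter_upwards [hlin] with a ha
  set θ := T a.1 a.2 with hθ
  set u := θ - θs with hu
  set S : Fin d → ℝ := fun i => avg a.1 fun j => es j a.2 * grad g Θ (x j a.2) θs i with hS
  set r : ℕ → ℝ := fun j => g (x j a.2) θ - g (x j a.2) θs -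
    fderivWithin ℝ (g (x j a.2)) Θ θs u with hr
  have hterm : ∀ j, (es j a.2 - (g (x j a.2) θ - g (x j a.2) θs)) * w (x j a.2) =
      es j a.2 * w (x j a.2) - ∑ k, u k * (grad g Θ (x j a.2) θs k * w (x j a.2)) -
      r j * w (x j a.2) := by
    intro j
    have e2 : ∑ k, u k * (grad g Θ (x j a.2) θs k * w (x j a.2)) =
        fderivWithin ℝ (g (x j a.2)) Θ θs u * w (x j a.2) := by
      rw [clm_apply_eq_sum _ u, Finset.sum_mul]
      exact Finset.sum_congr rfl fun k _ => by simp only [grad]; ring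
    rw [e2, hr]; ring
  have hterm' : ∀ j, es j a.2 * effWeight P X g Θ θs w (x j a.2) =
      es j a.2 * w (x j a.2) - ∑ i, b i * (es j a.2 * grad g Θ (x j a.2) θs i) := by
    intro j
    rw [effWeight, mul_sub, Finset.mul_sum]
    congr 1
    exact Finset.sum_congr rfl fun i _ => by ring
  simp only [hterm, hterm']
  rw [avg_sub, avg_sub, avg_sub, avg_sum, avg_sum]
  simp only [avg_const_mul]
  -- `bᵀ G u = aᵀ u`, since `G` is symmetric and `G b = a`
  have hbG : ∑ i, b i * ∑ k, G i k * u k = ∑ k, u k * α k := by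
    simp only [Finset.mul_sum]
    rw [Finset.sum_comm]
    refine Finset.sum_congr rfl fun k _ => ?_
    rw [hα, ← gram_mulVec_inv_gradWeight hns w k, Finset.mul_sum]
    refine Finset.sum_congr rfl fun i _ => ?_
    rw [gramMatrix_symm_apply P X g Θ θs k i]
    ring
  have hkey : (avg a.1 (fun j => es j a.2 * w (x j a.2)) -
      ∑ k, u k * avg a.1 (fun j => grad g Θ (x j a.2) θs k * w (x j a.2)) -
      avg a.1 (fun j => r j * w (x j a.2))) -
      (avg a.1 (fun j => es j a.2 * w (x j a.2)) -
      ∑ i, b i * avg a.1 (fun j => es j a.2 * grad g Θ (x j a.2) θs i)) =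
      -(∑ i, b i * (∑ k, G i k * u k - S i)) +
      ∑ k, u k * (α k - avg a.1 fun j => grad g Θ (x j a.2) θs k * w (x j a.2)) -
      avg a.1 (fun j => r j * w (x j a.2)) := by
    simp only [mul_sub, Finset.sum_sub_distrib, hbG, hS]
    ring
  rw [← mul_sub, hkey, norm_mul, Real.norm_of_nonneg (Real.sqrt_nonneg _), mul_left_comm]
  refine mul_le_mul_of_nonneg_left ?_ (Real.sqrt_nonneg _)
  rw [add_mul, add_mul, Real.norm_eq_abs]
  refine (abs_sub _ _).trans (add_le_add ((abs_add_le _ _).trans (add_le_add ?_ ?_)) ?_)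
  · rw [abs_neg, Finset.sum_mul]
    refine (Finset.abs_sum_le_sum_abs _ _).trans (Finset.sum_le_sum fun i _ => ?_)
    rw [abs_mul, mul_assoc]
    exact mul_le_mul_of_nonneg_left (ha i) (abs_nonneg _)
  · rw [Finset.sum_mul]
    refine (Finset.abs_sum_le_sum_abs _ _).trans (Finset.sum_le_sum fun k _ => ?_)
    rw [abs_mul, mul_comm]
    exact mul_le_mul_of_nonneg_left (PiLp.norm_apply_le u k) (abs_nonneg _)
  · rw [← avg_mul_const]
    refine (abs_avg_le _ _).trans (avg_mono _ fun j => ?_)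
    rw [abs_mul, hr, abs_remainder_eq, mul_right_comm]

theorem measurable_effWeight (M : ErrorModel P X e x es g Θ θs B C)
    {w : EuclideanSpace ℝ (Fin p) → ℝ} (hw : Measurable w) :
    Measurable (effWeight P X g Θ θs w) :=
  hw.sub (Finset.measurable_fun_sum _ fun i _ => (M.measurable_grad M.mem i).const_mul _)

theorem memLp_effWeight (M : ErrorModel P X e x es g Θ θs B C)
    {w : EuclideanSpace ℝ (Fin p) → ℝ} (hw2 : MemLp (fun ω => w (X ω)) 2 P) :
    MemLp (fun ω => effWeight P X g Θ θs w (X ω)) 2 P :=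
  hw2.sub (memLp_finsetSum _ fun i _ => (M.memLp_grad M.mem i).const_mul _)

theorem integral_effWeight_sq (M : ErrorModel P X e x es g Θ θs B C)
    (hns : IsUnit (gramMatrix P X g Θ θs))
    {w : EuclideanSpace ℝ (Fin p) → ℝ} (hw2 : MemLp (fun ω => w (X ω)) 2 P) :
    ∫ ω, effWeight P X g Θ θs w (X ω) ^ 2 ∂P = (∫ ω, w (X ω) ^ 2 ∂P) -
      gradWeight P X g Θ w θs ⬝ᵥ
        Matrix.mulVec (gramMatrix P X g Θ θs)⁻¹ (gradWeight P X g Θ w θs) := by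
  set b := (gramMatrix P X g Θ θs)⁻¹.mulVec (gradWeight P X g Θ w θs) with hb
  have hexp : ∀ ω, effWeight P X g Θ θs w (X ω) ^ 2 = w (X ω) ^ 2 -
      2 * ∑ i, b i * (grad g Θ (X ω) θs i * w (X ω)) +
      ∑ i, b i * ∑ k, b k * (grad g Θ (X ω) θs i * grad g Θ (X ω) θs k) := by
    intro ω
    have h1 : ∑ i, b i * (grad g Θ (X ω) θs i * w (X ω)) =
        (∑ i, b i * grad g Θ (X ω) θs i) * w (X ω) := by
      rw [Finset.sum_mul]; exact Finset.sum_congr rfl fun i _ => by ring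
    have h2 : ∑ i, b i * ∑ k, b k * (grad g Θ (X ω) θs i * grad g Θ (X ω) θs k) =
        (∑ i, b i * grad g Θ (X ω) θs i) * ∑ k, b k * grad g Θ (X ω) θs k := by
      rw [Finset.sum_mul]
      refine Finset.sum_congr rfl fun i _ => ?_
      rw [Finset.mul_sum, Finset.mul_sum]
      exact Finset.sum_congr rfl fun k _ => by ring
    rw [h1, h2, effWeight]
    ring
  have hi1 : ∀ i, Integrable (fun ω => grad g Θ (X ω) θs i * w (X ω)) P := fun i =>
    (M.memLp_grad M.mem i).integrable_mul hw2
  have hi2 : ∀ i k, Integrable (fun ω => grad g Θ (X ω) θs i * grad g Θ (X ω) θs k) P :=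
    fun i k => (M.memLp_grad M.mem i).integrable_mul (M.memLp_grad M.mem k)
  have hi1' : Integrable (fun ω => 2 * ∑ i, b i * (grad g Θ (X ω) θs i * w (X ω))) P :=
    (integrable_finsetSum _ fun i _ => (hi1 i).const_mul _).const_mul _
  have hi2' : ∀ i, Integrable (fun ω => ∑ k, b k *
      (grad g Θ (X ω) θs i * grad g Θ (X ω) θs k)) P := fun i =>
    integrable_finsetSum _ fun k _ => (hi2 i k).const_mul _
  simp only [hexp]
  rw [integral_add (hw2.integrable_sq.sub' hi1')
      (integrable_finsetSum _ fun i _ => (hi2' i).const_mul _),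
    integral_sub hw2.integrable_sq hi1', integral_const_mul,
    integral_finsetSum _ fun i _ => (hi1 i).const_mul _,
    integral_finsetSum _ fun i _ => (hi2' i).const_mul _]
  simp only [integral_const_mul, integral_finsetSum _ fun k _ => (hi2 _ k).const_mul _]
  have h3 : ∀ i, ∑ k, b k * ∫ ω, grad g Θ (X ω) θs i * grad g Θ (X ω) θs k ∂P =
      gradWeight P X g Θ w θs i := by
    intro i
    rw [← gram_mulVec_inv_gradWeight hns w i]
    exact Finset.sum_congr rfl fun k _ => mul_comm _ _
  simp only [h3, dotProduct]
  have h4 : ∑ i, b i * ∫ ω, grad g Θ (X ω) θs i * w (X ω) ∂P =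
      ∑ i, gradWeight P X g Θ w θs i * b i := Finset.sum_congr rfl fun k _ => mul_comm _ _
  have h5 : ∑ i, b i * gradWeight P X g Θ w θs i =
      ∑ i, gradWeight P X g Θ w θs i * b i := Finset.sum_congr rfl fun k _ => mul_comm _ _
  rw [h4, h5]
  ring

/-- The limiting normal distribution of the weighted average of the errors. -/
theorem tendstoInDistribution_effWeight (M : ErrorModel P X e x es g Θ θs B C)
    (hns : IsUnit (gramMatrix P X g Θ θs))
    {w : EuclideanSpace ℝ (Fin p) → ℝ} (hw : Measurable w)
    (hw2 : MemLp (fun ω => w (X ω)) 2 P) :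
    TendstoInDistribution (fun (n : ℕ) ω =>
      √(n : ℝ) * avg n fun j => es j ω * effWeight P X g Θ θs w (x j ω)) atTop
      (fun z : ℝ => √((∫ ω, e ω ^ 2 ∂P) * ((∫ ω, w (X ω) ^ 2 ∂P) - gradWeight P X g Θ w θs ⬝ᵥ
        Matrix.mulVec (gramMatrix P X g Θ θs)⁻¹ (gradWeight P X g Θ w θs))) * z)
      (fun _ => P) (gaussianReal 0 1) := by
  rw [← M.integral_effWeight_sq hns hw2]
  set f : EuclideanSpace ℝ (Fin p) × ℝ → ℝ := fun z => z.2 * effWeight P X g Θ θs w z.1 with hf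
  have hwm := M.measurable_effWeight hw
  have hfm : Measurable f := measurable_snd.mul (hwm.comp measurable_fst)
  have hid : ∀ j, IdentDistrib (fun ω => f (x j ω, es j ω)) (fun ω => f (X ω, e ω)) P P :=
    fun j => (M.ident j).comp hfm
  have hL : MemLp (fun ω => f (X ω, e ω)) 2 P := M.memLp_error_mul hwm (M.memLp_effWeight hw2)
  have h0 : ∫ ω, f (X ω, e ω) ∂P = 0 := M.integral_error_mul hwm
  have hvar : variance (fun ω => f (x 0 ω, es 0 ω)) P =
      (∫ ω, e ω ^ 2 ∂P) * ∫ ω, effWeight P X g Θ θs w (X ω) ^ 2 ∂P := by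
    rw [(hid 0).variance_eq, variance_of_integral_eq_zero hL.1.aemeasurable h0]
    have hi : IndepFun (fun ω => e ω ^ 2) (fun ω => effWeight P X g Θ θs w (X ω) ^ 2) P :=
      M.indep_Xe.symm.comp (φ := fun t => t ^ 2) (ψ := fun u => effWeight P X g Θ θs w u ^ 2)
        (measurable_id.pow_const 2) (hwm.pow_const 2)
    rw [← hi.integral_fun_mul_eq_mul_integral M.memLp_e.integrable_sq.1
      (M.memLp_effWeight hw2).integrable_sq.1]
    simp only [hf, mul_pow]
  have hlaw : HasLaw (fun z : ℝ => √((∫ ω, e ω ^ 2 ∂P) *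
      ∫ ω, effWeight P X g Θ θs w (X ω) ^ 2 ∂P) * z)
      (gaussianReal 0 (variance (fun ω => f (x 0 ω, es 0 ω)) P).toNNReal) (gaussianReal 0 1) := by
    refine ⟨by fun_prop, ?_⟩
    rw [gaussianReal_map_const_mul, hvar]
    congr 1
    · simp
    · ext
      have : 0 ≤ (∫ ω, e ω ^ 2 ∂P) * ∫ ω, effWeight P X g Θ θs w (X ω) ^ 2 ∂P :=
        hvar ▸ variance_nonneg _ _
      simp [Real.sq_sqrt this, this]
  have hclt := tendstoInDistribution_inv_sqrt_mul_sum_sub (P := P) (P' := gaussianReal 0 1)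
    (X := fun j ω => f (x j ω, es j ω)) hlaw ((hid 0).memLp_iff.2 hL)
    (M.indep.comp (fun _ => f) fun _ => hfm) (fun i => (hid i).trans (hid 0).symm)
  simp only [(hid 0).integral_eq, h0, mul_zero, sub_zero, ← sqrt_mul_avg] at hclt
  exact hclt

end ErrorModel

/-! ### The variance estimator -/

theorem tendsto_matrix_inv {ι : Type*} {l : Filter ι} {d : ℕ} {A : ι → Matrix (Fin d) (Fin d) ℝ}
    {G : Matrix (Fin d) (Fin d) ℝ} (hG : IsUnit G) (hA : Tendsto A l (𝓝 G)) :
    Tendsto (fun a => (A a)⁻¹) l (𝓝 G⁻¹) := by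
  have hdet : G.det ≠ 0 := ((Matrix.isUnit_iff_isUnit_det _).1 hG).ne_zero
  simp only [Matrix.inv_def, Ring.inverse_eq_inv']
  have h1 : Tendsto (fun a => (A a).det) l (𝓝 G.det) :=
    ((continuous_id.matrix_det).tendsto G).comp hA
  have h2 : Tendsto (fun a => (A a).adjugate) l (𝓝 G.adjugate) :=
    ((continuous_id.matrix_adjugate).tendsto G).comp hA
  exact (h1.inv₀ hdet).smul h2

theorem tendsto_sigmaHatSq {Ω : Type*} [MeasurableSpace Ω] {P : Measure Ω}
    [IsProbabilityMeasure P] {p d : ℕ}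
    {X : Ω → EuclideanSpace ℝ (Fin p)} {Y : Ω → ℝ}
    {x : ℕ → Ω → EuclideanSpace ℝ (Fin p)} {y : ℕ → Ω → ℝ}
    {g : EuclideanSpace ℝ (Fin p) → EuclideanSpace ℝ (Fin d) → ℝ}
    {Θ : Set (EuclideanSpace ℝ (Fin d))} {θs : EuclideanSpace ℝ (Fin d)}
    {B C : EuclideanSpace ℝ (Fin p) → ℝ} {T : ℕ → Ω → EuclideanSpace ℝ (Fin d)}
    (M : ErrorModel P X (fun ω => Y ω - g (X ω) θs) x (fun j ω => y j ω - g (x j ω) θs)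
      g Θ θs B C)
    (hns : IsUnit (gramMatrix P X g Θ θs)) (hT : ∀ n ω, T n ω ∈ Θ)
    (hcons : Tendsto (fun a : ℕ × Ω => T a.1 a.2) (inProb P) (𝓝 θs))
    {w : EuclideanSpace ℝ (Fin p) → ℝ} (hw : Measurable w)
    (hw2 : MemLp (fun ω => w (X ω)) 2 P) :
    Tendsto (fun a : ℕ × Ω => sigmaHatSq g Θ w a.1 (fun j => x j a.2) (fun j => y j a.2)
      (T a.1 a.2)) (inProb P) (𝓝 (sigmaSq P X Y g Θ w θs)) := by
  have hmX : ∀ {f : EuclideanSpace ℝ (Fin p) → ℝ}, Measurable f →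
      Measurable fun z : EuclideanSpace ℝ (Fin p) × ℝ => f z.1 := fun hf => hf.comp measurable_fst
  have h1 : Tendsto (fun a : ℕ × Ω => (a.1 : ℝ)⁻¹ * ∑ j ∈ Finset.range a.1,
      residual g (fun j => x j a.2) (fun j => y j a.2) (T a.1 a.2) j ^ 2) (inProb P)
      (𝓝 (variance (fun ω => Y ω - g (X ω) θs) P)) := by
    obtain ⟨env, -, hi, hle⟩ := M.exists_sqResidual_le
    have h := M.tendsto_avg_plugin hT hcons (f := ErrorModel.sqResidual g θs)
      (fun θ hθ => M.measurable_sqResidual hθ) M.continuousOn_sqResidual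
      (fun z θ hθ => (abs_of_nonneg (sq_nonneg _)).trans_le (hle z θ hθ)) hi
    rw [variance_of_integral_eq_zero M.measurable_e.aemeasurable M.integral_e]
    simpa only [ErrorModel.sqResidual, residual, avg, sub_self, sub_zero,
      sub_sub_sub_cancel_right] using h
  have h2 : Tendsto (fun a : ℕ × Ω => (a.1 : ℝ)⁻¹ * ∑ j ∈ Finset.range a.1, w (x j a.2) ^ 2)
      (inProb P) (𝓝 (∫ ω, w (X ω) ^ 2 ∂P)) :=
    M.tendsto_avg (f := fun z => w z.1 ^ 2) (hmX (hw.pow_const 2)) hw2.integrable_sq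
  have h3 : Tendsto (fun a : ℕ × Ω => (a.1 : ℝ)⁻¹ • ∑ j ∈ Finset.range a.1,
      w (x j a.2) • grad g Θ (x j a.2) (T a.1 a.2)) (inProb P)
      (𝓝 (gradWeight P X g Θ w θs)) := by
    rw [tendsto_pi_nhds]
    intro i
    have h := M.tendsto_avg_plugin hT hcons
      (f := fun z θ => grad g Θ z.1 θ i * w z.1)
      (fun θ hθ => (hmX (M.measurable_grad hθ i)).mul (hmX hw))
      (fun z => (M.continuousOn_grad z.1 i).mul continuousOn_const)
      (env := fun z => |B z.1 * w z.1|)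
      (fun z θ hθ => by
        rw [abs_mul, abs_mul, abs_of_nonneg (M.B_nonneg _)]
        exact mul_le_mul_of_nonneg_right (M.abs_grad_le z.1 hθ i) (abs_nonneg _))
      (M.memLp_B.integrable_mul hw2).abs
    refine h.congr fun a => ?_
    simp [avg, mul_comm]
  have h4 : Tendsto (fun a : ℕ × Ω => (a.1 : ℝ)⁻¹ • ∑ j ∈ Finset.range a.1,
      Matrix.vecMulVec (grad g Θ (x j a.2) (T a.1 a.2)) (grad g Θ (x j a.2) (T a.1 a.2)))
      (inProb P) (𝓝 (gramMatrix P X g Θ θs)) := by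
    refine tendsto_pi_nhds.2 fun i => tendsto_pi_nhds.2 fun k => ?_
    have h := M.tendsto_avg_plugin hT hcons
      (f := fun z θ => grad g Θ z.1 θ i * grad g Θ z.1 θ k)
      (fun θ hθ => (hmX (M.measurable_grad hθ i)).mul (hmX (M.measurable_grad hθ k)))
      (fun z => (M.continuousOn_grad z.1 i).mul (M.continuousOn_grad z.1 k))
      (env := fun z => B z.1 * B z.1)
      (fun z θ hθ => by
        rw [abs_mul]
        exact mul_le_mul (M.abs_grad_le z.1 hθ i) (M.abs_grad_le z.1 hθ k) (abs_nonneg _)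
          (M.B_nonneg _))
      (M.memLp_B.integrable_mul M.memLp_B)
    refine h.congr fun a => ?_
    simp [avg, Matrix.sum_apply, Matrix.vecMulVec_apply]
  have h5 := tendsto_matrix_inv hns h4
  refine h1.mul (h2.sub ?_)
  have hcont : Continuous fun q : (Fin d → ℝ) × Matrix (Fin d) (Fin d) ℝ =>
      q.1 ⬝ᵥ Matrix.mulVec q.2 q.1 := by fun_prop
  exact (hcont.tendsto (_, _)).comp (h3.prodMk_nhds h5)

/-! ### The estimated dimension vanishes when the eigenvalues are small -/

section Dimension

variable {p : ℕ} (n : ℕ) (xs : ℕ → EuclideanSpace ℝ (Fin p)) (η : ℕ → ℝ)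

open scoped ComplexOrder in
theorem MHat_posSemidef : (MHat n xs η).PosSemidef := by
  unfold MHat
  refine Matrix.PosSemidef.smul (Matrix.posSemidef_sum _ fun k _ => ?_) (by positivity)
  exact Matrix.posSemidef_vecMulVec_self_star _

open scoped ComplexOrder in
theorem eigenvalues₀_MHat_nonneg (i : Fin (Fintype.card (Fin p))) :
    0 ≤ (MHat_isHermitian n xs η).eigenvalues₀ i := by
  have h := (MHat_posSemidef n xs η).eigenvalues_nonneg
    (Fintype.equivOfCardEq (Fintype.card_fin _) i)
  simpa [Matrix.IsHermitian.eigenvalues] using h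

theorem lambdaHat_nonneg (j : ℕ) : 0 ≤ lambdaHat n xs η j := by
  unfold lambdaHat
  split_ifs
  · exact eigenvalues₀_MHat_nonneg n xs η _
  · exact le_rfl

theorem lambdaHat_succ_le {j : ℕ} (hj : 1 ≤ j) : lambdaHat n xs η (j + 1) ≤ lambdaHat n xs η j := by
  unfold lambdaHat
  by_cases h : 1 ≤ j + 1 ∧ j + 1 ≤ p
  · have h' : 1 ≤ j ∧ j ≤ p := ⟨hj, by omega⟩
    rw [dif_pos h, dif_pos h']
    refine (MHat_isHermitian n xs η).eigenvalues₀_antitone ?_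
    rw [Fin.mk_le_mk]
    omega
  · rw [dif_neg h]
    exact lambdaHat_nonneg n xs η j

/-- The trace of `M̂_n`. -/
def traceHat : ℝ := ∑ i, avg n fun k => ‖mHat n xs η (η k) i‖ ^ 2

theorem trace_MHat : (MHat n xs η).trace = (traceHat n xs η : ℂ) := by
  unfold MHat traceHat avg
  simp only [Matrix.trace_smul, Matrix.trace_sum, Matrix.trace_vecMulVec, dotProduct,
    Pi.star_apply, RCLike.star_def, Complex.mul_conj']
  rw [Finset.sum_comm]
  push_cast
  simp [Finset.mul_sum]

open scoped ComplexOrder in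
theorem lambdaHat_le_traceHat (j : ℕ) : lambdaHat n xs η j ≤ traceHat n xs η := by
  have h1 : traceHat n xs η = ∑ i, (MHat_isHermitian n xs η).eigenvalues i := by
    have h := (MHat_isHermitian n xs η).trace_eq_sum_eigenvalues
    rw [trace_MHat] at h
    refine Complex.ofReal_injective (h.trans ?_)
    rw [Complex.ofReal_sum]
    rfl
  have h0 : ∀ i, 0 ≤ (MHat_isHermitian n xs η).eigenvalues i :=
    (MHat_posSemidef n xs η).eigenvalues_nonneg
  unfold lambdaHat
  split_ifs with h
  · rw [h1]
    have h2 := Finset.single_le_sum (fun i _ => h0 i) (Finset.mem_univ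
      (Fintype.equivOfCardEq (Fintype.card_fin _)
        (⟨j - 1, by rw [Fintype.card_fin]; omega⟩ : Fin (Fintype.card (Fin p)))))
    simpa [Matrix.IsHermitian.eigenvalues] using h2
  · rw [h1]
    exact Finset.sum_nonneg fun i _ => h0 i

theorem sHat_nonneg (j : ℕ) : 0 ≤ sHat n xs η j :=
  div_nonneg (lambdaHat_nonneg n xs η j) (by linarith [lambdaHat_nonneg n xs η j])

theorem sHat_le_lambdaHat (j : ℕ) : sHat n xs η j ≤ lambdaHat n xs η j :=
  div_le_self (lambdaHat_nonneg n xs η j) (by linarith [lambdaHat_nonneg n xs η j])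

theorem sHat_succ_le {j : ℕ} (hj : 1 ≤ j) : sHat n xs η (j + 1) ≤ sHat n xs η j := by
  have h1 := lambdaHat_succ_le n xs η hj
  have h2 := lambdaHat_nonneg n xs η (j + 1)
  have h3 := lambdaHat_nonneg n xs η j
  unfold sHat
  rw [div_le_div_iff₀ (by linarith) (by linarith)]
  nlinarith

theorem sStar_nonneg {c₁ : ℝ} (hc₁ : 0 < c₁) {j : ℕ} (hj : 1 ≤ j) : 0 ≤ sStar n xs η c₁ j := by
  have h1 := sHat_succ_le n xs η hj
  have h2 := pow_le_pow_left₀ (sHat_nonneg n xs η (j + 1)) h1 2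
  unfold sStar
  rw [sub_nonneg, one_le_div (by positivity)]
  linarith

theorem sStar_le {c₁ : ℝ} (hc₁ : 0 < c₁) (j : ℕ) :
    sStar n xs η c₁ j ≤ traceHat n xs η ^ 2 / c₁ := by
  have h1 : sHat n xs η j ^ 2 ≤ traceHat n xs η ^ 2 := pow_le_pow_left₀ (sHat_nonneg n xs η j)
    ((sHat_le_lambdaHat n xs η j).trans (lambdaHat_le_traceHat n xs η j)) 2
  have h2 : (sHat n xs η j ^ 2 + c₁) / (sHat n xs η (j + 1) ^ 2 + c₁) ≤
      (sHat n xs η j ^ 2 + c₁) / c₁ :=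
    div_le_div_of_nonneg_left (by positivity) hc₁ (by linarith [sq_nonneg (sHat n xs η (j + 1))])
  have h3 : (sHat n xs η j ^ 2 + c₁) / c₁ = sHat n xs η j ^ 2 / c₁ + 1 := by field_simp
  have h4 : sHat n xs η j ^ 2 / c₁ ≤ traceHat n xs η ^ 2 / c₁ := by gcongr
  unfold sStar
  linarith

/-- If the trace of `M̂_n`, and with it every eigenvalue, is small compared with the ridges, all
ratios exceed the threshold. -/
theorem qHat_eq_zero {c₁ c₂ τ : ℝ} (hc₁ : 0 < c₁) (hc₂ : 0 < c₂) (hτ : 0 < τ)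
    (h : τ * (traceHat n xs η ^ 2 / (c₁ * c₂)) < 1 - τ) : qHat n xs η c₁ c₂ τ = 0 := by
  unfold qHat
  rw [Finset.filter_eq_empty_iff.2, Finset.sup_empty, Nat.bot_eq_zero]
  intro j hj
  have hj1 := (Finset.mem_Icc.1 hj).1
  have h1 := sStar_nonneg n xs η hc₁ hj1
  have h2 := sStar_nonneg n xs η hc₁ (j := j + 1) (by omega)
  have h3 := sStar_le n xs η hc₁ j
  rw [not_le, rHat, lt_div_iff₀ (by linarith)]
  have h4 : τ * (traceHat n xs η ^ 2 / c₁) < (1 - τ) * c₂ := by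
    have := mul_lt_mul_of_pos_right h hc₂
    have e : τ * (traceHat n xs η ^ 2 / (c₁ * c₂)) * c₂ = τ * (traceHat n xs η ^ 2 / c₁) := by
      field_simp
    rwa [e] at this
  have h5 := mul_le_mul_of_nonneg_left h3 hτ.le
  nlinarith

theorem norm_mHat_sq (t : ℝ) (i : Fin p) : ‖mHat n xs η t i‖ ^ 2 =
    avg n (fun j => xs j i * Real.cos (t * η j)) ^ 2 +
    avg n (fun j => xs j i * Real.sin (t * η j)) ^ 2 := by
  have h : mHat n xs η t i = ((avg n (fun j => xs j i * Real.cos (t * η j)) : ℝ) : ℂ) +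
      ((avg n (fun j => xs j i * Real.sin (t * η j)) : ℝ) : ℂ) * Complex.I := by
    unfold mHat avg
    push_cast
    rw [mul_assoc, ← mul_add, Finset.sum_mul, ← Finset.sum_add_distrib]
    congr 1
    refine Finset.sum_congr rfl fun j _ => ?_
    rw [mul_assoc Complex.I, mul_comm Complex.I, Complex.exp_mul_I]
    ring
  rw [h, Complex.sq_norm, Complex.normSq_add_mul_I]

end Dimension

/-! ### The order of the trace -/

/-- Replacing the residuals `η` by the errors `ε` in an average of `ξ_j f(η_k η_j)`, for `f` the
cosine or the sine, when the residuals differ from the errors by at most `B_j N`. -/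
theorem avg_sq_trig_le {f : ℝ → ℝ} (hf : ∀ s t, |f s - f t| ≤ |s - t|) (n : ℕ)
    {ξ η ε B : ℕ → ℝ} {N : ℝ} (hB : ∀ j, 0 ≤ B j)
    (hη : ∀ j, |η j - ε j| ≤ B j * N) :
    avg n (fun k => avg n (fun j => ξ j * f (η k * η j)) ^ 2) ≤
      2 * avg n (fun k => avg n (fun j => ξ j * f (ε k * ε j)) ^ 2) +
      4 * N ^ 2 * (avg n (fun k => η k ^ 2) * avg n (fun j => |ξ j| * B j) ^ 2 +
        avg n (fun k => B k ^ 2) * avg n (fun j => |ξ j| * |ε j|) ^ 2) := by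
  set a := avg n fun j => |ξ j| * B j with ha
  set b := avg n fun j => |ξ j| * |ε j| with hb
  have ha0 : 0 ≤ a := avg_nonneg _ fun j => mul_nonneg (abs_nonneg _) (hB j)
  have hb0 : 0 ≤ b := avg_nonneg _ fun j => mul_nonneg (abs_nonneg _) (abs_nonneg _)
  have hterm : ∀ k, avg n (fun j => ξ j * f (η k * η j)) ^ 2 ≤
      2 * avg n (fun j => ξ j * f (ε k * ε j)) ^ 2 +
      (4 * N ^ 2 * a ^ 2 * η k ^ 2 + 4 * N ^ 2 * b ^ 2 * B k ^ 2) := by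
    intro k
    have hdiff : |avg n (fun j => ξ j * f (η k * η j)) - avg n (fun j => ξ j * f (ε k * ε j))| ≤
        |η k| * N * a + B k * N * b := by
      rw [← avg_sub, ha, hb, ← avg_const_mul, ← avg_const_mul, ← avg_add]
      refine (abs_avg_le _ _).trans (avg_mono _ fun j => ?_)
      rw [← mul_sub, abs_mul]
      have h1 : |η k * η j - ε k * ε j| ≤ |η k| * (B j * N) + B k * N * |ε j| := by
        have e : η k * η j - ε k * ε j = η k * (η j - ε j) + (η k - ε k) * ε j := by ring
        rw [e]
        refine (abs_add_le _ _).trans ?_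
        rw [abs_mul, abs_mul]
        exact add_le_add (mul_le_mul_of_nonneg_left (hη j) (abs_nonneg _))
          (mul_le_mul_of_nonneg_right (hη k) (abs_nonneg _))
      calc |ξ j| * |f (η k * η j) - f (ε k * ε j)|
          ≤ |ξ j| * (|η k| * (B j * N) + B k * N * |ε j|) :=
            mul_le_mul_of_nonneg_left ((hf _ _).trans h1) (abs_nonneg _)
        _ = _ := by ring
    set s := avg n (fun j => ξ j * f (η k * η j))
    set t := avg n (fun j => ξ j * f (ε k * ε j))
    have h2 : (s - t) ^ 2 ≤ (|η k| * N * a + B k * N * b) ^ 2 :=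
      sq_le_sq' (abs_le.1 hdiff).1 (abs_le.1 hdiff).2
    have h3 : s ^ 2 ≤ 2 * t ^ 2 + 2 * (s - t) ^ 2 := by nlinarith [sq_nonneg (s - 2 * t)]
    have h4 : (|η k| * N * a + B k * N * b) ^ 2 ≤
        2 * (|η k| * N * a) ^ 2 + 2 * (B k * N * b) ^ 2 := by
      nlinarith [sq_nonneg (|η k| * N * a - B k * N * b)]
    have h5 : (|η k| * N * a) ^ 2 = N ^ 2 * a ^ 2 * η k ^ 2 := by
      rw [mul_pow, mul_pow, sq_abs]; ring
    nlinarith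
  refine (avg_mono n hterm).trans (le_of_eq ?_)
  rw [avg_add, avg_add, avg_const_mul, avg_const_mul, avg_const_mul]
  ring

theorem iIndepFun_bool {Ω : Type*} [MeasurableSpace Ω] {P : Measure Ω} [IsProbabilityMeasure P]
    {f : Bool → Ω → ℝ} (h : IndepFun (f true) (f false) P) : iIndepFun f P := by
  rw [iIndepFun_iff_measure_inter_preimage_eq_mul]
  intro S sets hS
  have h' := indepFun_iff_measure_inter_preimage_eq_mul.1 h
  by_cases ht : true ∈ S <;> by_cases hf : false ∈ S
  · have hS' : S = {true, false} := by
      ext b; cases b <;> simp [ht, hf]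
    subst hS'
    rw [Finset.set_biInter_insert, Finset.set_biInter_singleton, Finset.prod_pair (by decide)]
    exact h' (sets true) (sets false) (hS true ht) (hS false hf)
  · have hS' : S = {true} := by
      ext b; cases b <;> simp [ht, hf]
    subst hS'
    simp
  · have hS' : S = {false} := by
      ext b; cases b <;> simp [ht, hf]
    subst hS'
    simp
  · have hS' : S = ∅ := by
      ext b; cases b <;> simp [ht, hf]
    subst hS'
    simp

/-- In an i.i.d. sequence of pairs `(ξ_j, ε_j)` with independent components, two of the `ξ` are
jointly independent of any three of the `ε`. -/
theorem indepFun_cross {Ω : Type*} [MeasurableSpace Ω] {P : Measure Ω} [IsProbabilityMeasure P]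
    {ξ ε : ℕ → Ω → ℝ} (hξ : ∀ j, Measurable (ξ j)) (hε : ∀ j, Measurable (ε j))
    (hind : iIndepFun (fun j ω => (ξ j ω, ε j ω)) P) (hpair : ∀ j, IndepFun (ξ j) (ε j) P)
    (j l k : ℕ) :
    IndepFun (fun ω => (ξ j ω, ξ l ω)) (fun ω => (ε j ω, ε l ω, ε k ω)) P := by
  have hm : ∀ (j : ℕ) (b : Bool), Measurable (bif b then ξ j else ε j) := fun j b => by
    cases b
    · exact hε j
    · exact hξ j
  have hrow : iIndepFun (fun (i : ℕ) ω (b : Bool) => (bif b then ξ i else ε i) ω) P := by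
    have h := hind.comp (fun _ => fun (z : ℝ × ℝ) (b : Bool) => bif b then z.1 else z.2)
      (fun _ => by
        rw [measurable_pi_iff]
        intro b
        cases b
        · exact measurable_snd
        · exact measurable_fst)
    convert h using 3 with i
    funext b
    cases b <;> rfl
  have hall := iIndepFun_uncurry' (P := P) (X := fun (i : ℕ) (b : Bool) => bif b then ξ i else ε i)
    hm hrow fun i => iIndepFun_bool (hpair i)
  have hst := hall.indepFun_finset {(j, true), (l, true)} {(j, false), (l, false), (k, false)}
    (by simp [Finset.disjoint_left]) fun q => hm q.1 q.2
  have hpi2 : ∀ {S : Finset (ℕ × Bool)} (q r : S), Measurable fun v : S → ℝ => (v q, v r) :=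
    fun q r => (measurable_pi_apply q).prodMk (measurable_pi_apply r)
  have hpi3 : ∀ {S : Finset (ℕ × Bool)} (q r s : S),
      Measurable fun v : S → ℝ => (v q, v r, v s) :=
    fun q r s => (measurable_pi_apply q).prodMk (hpi2 r s)
  exact hst.comp (hpi2 ⟨(j, true), by simp⟩ ⟨(l, true), by simp⟩)
    (hpi3 ⟨(j, false), by simp⟩ ⟨(l, false), by simp⟩ ⟨(k, false), by simp⟩)

/-- The cross terms vanish when the square is expanded, since the `ξ` are centred and independent of
the `ε`. -/
theorem integral_sq_sum_le {Ω : Type*} [MeasurableSpace Ω] {P : Measure Ω} [IsProbabilityMeasure P]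
    {ξ ε : ℕ → Ω → ℝ} (hξ : ∀ j, Measurable (ξ j)) (hε : ∀ j, Measurable (ε j))
    (hind : iIndepFun (fun j ω => (ξ j ω, ε j ω)) P) (hpair : ∀ j, IndepFun (ξ j) (ε j) P)
    (hL : ∀ j, MemLp (ξ j) 2 P) (h0 : ∀ j, ∫ ω, ξ j ω ∂P = 0) {v : ℝ}
    (hv : ∀ j, ∫ ω, ξ j ω ^ 2 ∂P = v) {f : ℝ → ℝ} (hf : Measurable f) (hf1 : ∀ t, |f t| ≤ 1)
    (n k : ℕ) :
    ∫ ω, (∑ j ∈ Finset.range n, ξ j ω * f (ε k ω * ε j ω)) ^ 2 ∂P ≤ n * v := by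
  have hfm : ∀ j, Measurable fun ω => f (ε k ω * ε j ω) := fun j =>
    hf.comp ((hε k).mul (hε j))
  have hLf : ∀ j, MemLp (fun ω => ξ j ω * f (ε k ω * ε j ω)) 2 P := fun j =>
    (hL j).mono ((hξ j).mul (hfm j)).aestronglyMeasurable (Eventually.of_forall fun ω => by
      rw [norm_mul]
      exact mul_le_of_le_one_right (norm_nonneg _) (hf1 _))
  have hint : ∀ j l, Integrable (fun ω => (ξ j ω * f (ε k ω * ε j ω)) *
      (ξ l ω * f (ε k ω * ε l ω))) P := fun j l => (hLf j).integrable_mul (hLf l)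
  simp only [sq, Finset.sum_mul_sum]
  rw [integral_finsetSum _ fun j _ => integrable_finsetSum _ fun l _ => hint j l]
  simp only [integral_finsetSum _ fun l _ => hint _ l]
  have hcross : ∀ j l, j ≠ l → ∫ ω, (ξ j ω * f (ε k ω * ε j ω)) *
      (ξ l ω * f (ε k ω * ε l ω)) ∂P = 0 := by
    intro j l hjl
    have hi := (indepFun_cross hξ hε hind hpair j l k).comp (φ := fun z : ℝ × ℝ => z.1 * z.2)
      (ψ := fun z : ℝ × ℝ × ℝ => f (z.2.2 * z.1) * f (z.2.2 * z.2.1))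
      (by fun_prop) ((hf.comp (by fun_prop)).mul (hf.comp (by fun_prop)))
    have hξi : IndepFun (ξ j) (ξ l) P :=
      (hind.comp (fun _ => Prod.fst) fun _ => measurable_fst).indepFun hjl
    have h1 := hi.integral_fun_mul_eq_mul_integral
      ((hξ j).mul (hξ l)).aestronglyMeasurable ((hfm j).mul (hfm l)).aestronglyMeasurable
    have h2 := hξi.integral_fun_mul_eq_mul_integral (hξ j).aestronglyMeasurable
      (hξ l).aestronglyMeasurable
    simp only [Function.comp_def] at h1
    rw [h2, h0, zero_mul, zero_mul] at h1
    rw [← h1]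
    refine integral_congr_ae (Eventually.of_forall fun ω => ?_)
    simp only
    ring
  have hdiag : ∀ j, ∫ ω, (ξ j ω * f (ε k ω * ε j ω)) * (ξ j ω * f (ε k ω * ε j ω)) ∂P ≤ v := by
    intro j
    rw [← hv j]
    refine integral_mono (hint j j) (hL j).integrable_sq fun ω => ?_
    have h1 : f (ε k ω * ε j ω) ^ 2 ≤ 1 := by
      rw [← sq_abs]; exact pow_le_one₀ (abs_nonneg _) (hf1 _)
    simp only
    nlinarith [sq_nonneg (ξ j ω)]
  calc _ ≤ ∑ j ∈ Finset.range n, v := by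
        refine Finset.sum_le_sum fun j hj => ?_
        rw [Finset.sum_eq_single_of_mem j hj fun l _ hl => hcross j l hl.symm]
        exact hdiag j
    _ = n * v := by simp

namespace ErrorModel

variable {Ω : Type*} [MeasurableSpace Ω] {P : Measure Ω} [IsProbabilityMeasure P] {p d : ℕ}
  {X : Ω → EuclideanSpace ℝ (Fin p)} {e : Ω → ℝ}
  {x : ℕ → Ω → EuclideanSpace ℝ (Fin p)} {es : ℕ → Ω → ℝ}
  {g : EuclideanSpace ℝ (Fin p) → EuclideanSpace ℝ (Fin d) → ℝ}
  {Θ : Set (EuclideanSpace ℝ (Fin d))} {θs : EuclideanSpace ℝ (Fin d)}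
  {B C : EuclideanSpace ℝ (Fin p) → ℝ} {T : ℕ → Ω → EuclideanSpace ℝ (Fin d)}

/-- The part of the trace that stems from one coordinate and the cosine or the sine, computed from
the errors, is of order `1/n`. -/
theorem bddInProb_avg_sq_error (M : ErrorModel P X e x es g Θ θs B C) (hX2 : MemLp X 2 P)
    (hX0 : ∫ ω, X ω ∂P = 0) {f : ℝ → ℝ} (hf : Measurable f) (hf1 : ∀ t, |f t| ≤ 1) (i : Fin p) :
    BddInProb P fun a => (a.1 : ℝ) * avg a.1 fun k =>
      avg a.1 (fun j => x j a.2 i * f (es k a.2 * es j a.2)) ^ 2 := by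
  have hci : Measurable fun u : EuclideanSpace ℝ (Fin p) => u i := by fun_prop
  have hξ : ∀ j, Measurable fun ω => x j ω i := fun j => hci.comp (M.measurable_x j)
  have hXi : MemLp (fun ω => X ω i) 2 P :=
    hX2.mono (hci.comp M.measurable_X).aestronglyMeasurable
      (Eventually.of_forall fun ω => PiLp.norm_apply_le (X ω) i)
  have hXi0 : ∫ ω, X ω i ∂P = 0 := by
    have h := (EuclideanSpace.proj (𝕜 := ℝ) i).integral_comp_comm (hX2.integrable one_le_two)
    simpa [hX0] using h
  have hid : ∀ j, IdentDistrib (fun ω => x j ω i) (fun ω => X ω i) P P :=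
    fun j => (M.ident j).comp (hci.comp measurable_fst)
  have hL : ∀ j, MemLp (fun ω => x j ω i) 2 P := fun j => (hid j).memLp_iff.2 hXi
  have hind : iIndepFun (fun j ω => (x j ω i, es j ω)) P :=
    M.indep.comp (fun _ => fun z => (z.1 i, z.2)) fun _ =>
      (hci.comp measurable_fst).prodMk measurable_snd
  have hpair : ∀ j, IndepFun (fun ω => x j ω i) (es j) P := by
    intro j
    have h1 : IndepFun (x j) (es j) P := by
      have hX := (M.ident j).comp measurable_fst
      have he := (M.ident j).comp measurable_snd
      rw [indepFun_iff_map_prod_eq_prod_map_map (M.measurable_x j).aemeasurable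
        (M.measurable_es j).aemeasurable, (M.ident j).map_eq,
        (indepFun_iff_map_prod_eq_prod_map_map M.measurable_X.aemeasurable
          M.measurable_e.aemeasurable).1 M.indep_Xe]
      exact congrArg₂ Measure.prod hX.map_eq.symm he.map_eq.symm
    exact h1.comp hci measurable_id
  set v := ∫ ω, X ω i ^ 2 ∂P with hv
  have hbound := integral_sq_sum_le hξ M.measurable_es hind hpair hL
    (fun j => by rw [(hid j).integral_eq, hXi0])
    (fun j => (((hid j).comp (u := fun t => t ^ 2) (by fun_prop)).integral_eq : _ = v)) hf hf1
  have hLk : ∀ n k : ℕ, MemLp (fun ω => ∑ j ∈ Finset.range n,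
      x j ω i * f (es k ω * es j ω)) 2 P := fun n k => memLp_finsetSum _ fun j _ =>
    (hL j).mono ((hξ j).mul (hf.comp ((M.measurable_es k).mul
      (M.measurable_es j)))).aestronglyMeasurable (Eventually.of_forall fun ω => by
        rw [norm_mul]
        exact mul_le_of_le_one_right (norm_nonneg _) (hf1 _))
  have hexp : ∀ (n : ℕ) ω, (n : ℝ) * avg n (fun k =>
      avg n (fun j => x j ω i * f (es k ω * es j ω)) ^ 2) = ∑ k ∈ Finset.range n, ((n : ℝ)⁻¹) ^ 2 *
        (∑ j ∈ Finset.range n, x j ω i * f (es k ω * es j ω)) ^ 2 := by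
    intro n ω
    rcases Nat.eq_zero_or_pos n with rfl | hn
    · simp
    · have hn' : (n : ℝ) ≠ 0 := by positivity
      unfold avg
      rw [← mul_assoc, mul_inv_cancel₀ hn', one_mul]
      exact Finset.sum_congr rfl fun k _ => mul_pow _ _ _
  simp only [hexp]
  refine bddInProb_of_integral_le (C := v) (Eventually.of_forall fun n => ?_)
    (Eventually.of_forall fun n => ?_)
  · have h := integrable_finsetSum (Finset.range n) fun k _ =>
      (hLk n k).integrable_sq.const_mul (((n : ℝ)⁻¹) ^ 2)
    exact h
  · have h0 : ∀ ω, 0 ≤ ∑ k ∈ Finset.range n, ((n : ℝ)⁻¹) ^ 2 *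
        (∑ j ∈ Finset.range n, x j ω i * f (es k ω * es j ω)) ^ 2 := fun ω =>
      Finset.sum_nonneg fun k _ => by positivity
    simp only [fun ω => abs_of_nonneg (h0 ω)]
    rw [integral_finsetSum _ fun k _ => (hLk n k).integrable_sq.const_mul _]
    simp only [integral_const_mul]
    have hv0 : 0 ≤ v := integral_nonneg fun _ => sq_nonneg _
    calc _ ≤ ∑ k ∈ Finset.range n, ((n : ℝ)⁻¹) ^ 2 * (n * v) :=
          Finset.sum_le_sum fun k _ => mul_le_mul_of_nonneg_left (hbound n k) (by positivity)
      _ ≤ v := by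
          rcases Nat.eq_zero_or_pos n with rfl | hn
          · simpa using hv0
          · have hn' : (n : ℝ) ≠ 0 := by positivity
            simp only [Finset.sum_const, Finset.card_range, nsmul_eq_mul]
            field_simp
            exact le_rfl

/-- The trace of `M̂_n`, computed from the residuals, is of order `1/n`: with the errors in place of
the residuals its mean is of this order, and the residuals are within `O(n^{-1/2})` of the errors. -/
theorem bddInProb_traceHat (M : ErrorModel P X e x es g Θ θs B C)
    (hns : IsUnit (gramMatrix P X g Θ θs)) (hT : ∀ n ω, T n ω ∈ Θ)
    (hcons : Tendsto (fun a : ℕ × Ω => T a.1 a.2) (inProb P) (𝓝 θs))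
    (hmin : ∀ n ω, IsMinOn
      (fun θ => ∑ j ∈ Finset.range n, sqResidual g θs (x j ω, es j ω) θ) Θ (T n ω))
    (hX2 : MemLp X 2 P) (hX0 : ∫ ω, X ω ∂P = 0) :
    BddInProb P fun a => (a.1 : ℝ) * traceHat a.1 (fun j => x j a.2)
      (fun j => es j a.2 - (g (x j a.2) (T a.1 a.2) - g (x j a.2) θs)) := by
  have hmX : ∀ {f : EuclideanSpace ℝ (Fin p) → ℝ}, Measurable f →
      Measurable fun z : EuclideanSpace ℝ (Fin p) × ℝ => f z.1 := fun hf => hf.comp measurable_fst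
  have hrate := M.bddInProb_sqrt_mul_norm hns hT hcons hmin
  have hη : BddInProb P fun a => avg a.1 fun k =>
      (es k a.2 - (g (x k a.2) (T a.1 a.2) - g (x k a.2) θs)) ^ 2 := by
    obtain ⟨env, -, hi, hle⟩ := M.exists_sqResidual_le
    exact bddInProb_of_tendsto (M.tendsto_avg_plugin hT hcons (f := sqResidual g θs)
      (fun θ hθ => M.measurable_sqResidual hθ) M.continuousOn_sqResidual
      (fun z θ hθ => (abs_of_nonneg (sq_nonneg _)).trans_le (hle z θ hθ)) hi)
  have hBB : BddInProb P fun a => avg a.1 fun k => B (x k a.2) ^ 2 :=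
    bddInProb_of_tendsto (M.tendsto_avg (f := fun z => B z.1 ^ 2)
      (hmX (M.measurable_B.pow_const 2)) M.memLp_B.integrable_sq)
  -- the same bound serves the cosine and the sine parts
  have key : ∀ (i : Fin p) (f : ℝ → ℝ), Measurable f → (∀ t, |f t| ≤ 1) →
      (∀ s t, |f s - f t| ≤ |s - t|) → BddInProb P fun a => (a.1 : ℝ) * avg a.1 fun k =>
        avg a.1 (fun j => x j a.2 i * f
          ((es k a.2 - (g (x k a.2) (T a.1 a.2) - g (x k a.2) θs)) *
            (es j a.2 - (g (x j a.2) (T a.1 a.2) - g (x j a.2) θs)))) ^ 2 := by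
    intro i f hf hf1 hfl
    have hci : Measurable fun u : EuclideanSpace ℝ (Fin p) => u i := by fun_prop
    have hXi : MemLp (fun ω => X ω i) 2 P :=
      hX2.mono (hci.comp M.measurable_X).aestronglyMeasurable
        (Eventually.of_forall fun ω => PiLp.norm_apply_le (X ω) i)
    have hA : BddInProb P fun a => avg a.1 fun j => |x j a.2 i| * B (x j a.2) :=
      bddInProb_of_tendsto (M.tendsto_avg (f := fun z => |z.1 i| * B z.1)
        (hmX (hci.abs.mul M.measurable_B)) (hXi.abs.integrable_mul M.memLp_B))
    have hE : BddInProb P fun a => avg a.1 fun j => |x j a.2 i| * |es j a.2| :=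
      bddInProb_of_tendsto (M.tendsto_avg (f := fun z => |z.1 i| * |z.2|)
        ((hmX hci.abs).mul measurable_snd.abs) (hXi.abs.integrable_mul M.memLp_e.abs))
    have hmain := M.bddInProb_avg_sq_error hX2 hX0 hf hf1 i
    have hbd := ((bddInProb_const (P := P) 2).mul hmain).add
      (((bddInProb_const (P := P) 4).mul (hrate.mul hrate)).mul
        ((hη.mul (hA.mul hA)).add (hBB.mul (hE.mul hE))))
    refine hbd.mono (Eventually.of_forall fun a => ?_)
    have hle := avg_sq_trig_le hfl a.1 (ξ := fun j => x j a.2 i)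
      (η := fun j => es j a.2 - (g (x j a.2) (T a.1 a.2) - g (x j a.2) θs))
      (ε := fun j => es j a.2) (B := fun j => B (x j a.2)) (N := ‖T a.1 a.2 - θs‖)
      (fun j => M.B_nonneg _)
      (fun j => by
        rw [sub_sub_cancel_left, abs_neg]
        exact M.abs_sub_le _ (hT a.1 a.2))
    have hn0 : (0 : ℝ) ≤ a.1 := Nat.cast_nonneg _
    have h1 := mul_le_mul_of_nonneg_left hle hn0
    rw [abs_of_nonneg (mul_nonneg hn0 (avg_nonneg _ fun k => sq_nonneg _))]
    refine (h1.trans (le_of_eq ?_)).trans (le_abs_self _)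
    have hs : (a.1 : ℝ) = √(a.1 : ℝ) * √(a.1 : ℝ) := (Real.mul_self_sqrt hn0).symm
    conv_lhs => rw [mul_add]
    congr 1
    · ring
    · conv_lhs => rw [hs]
      ring
  unfold traceHat
  simp only [Finset.mul_sum]
  refine BddInProb.sum _ fun i _ => ?_
  simp only [norm_mHat_sq, avg_add, mul_add]
  refine (key i Real.cos Real.measurable_cos Real.abs_cos_le_one fun s t => ?_).add
    (key i Real.sin Real.measurable_sin Real.abs_sin_le_one fun s t => ?_)
  · simpa [Real.dist_eq] using Real.lipschitzWith_cos.dist_le_mul s t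
  · simpa [Real.dist_eq] using Real.lipschitzWith_sin.dist_le_mul s t

/-- The estimated dimension is zero with probability tending to one: the squared trace is of order
`n⁻²`, which `n² c₁ c₂ → ∞` makes negligible compared with `c₁ c₂`. -/
theorem eventually_qHat_eq_zero (M : ErrorModel P X e x es g Θ θs B C)
    (hns : IsUnit (gramMatrix P X g Θ θs)) (hT : ∀ n ω, T n ω ∈ Θ)
    (hcons : Tendsto (fun a : ℕ × Ω => T a.1 a.2) (inProb P) (𝓝 θs))
    (hmin : ∀ n ω, IsMinOn
      (fun θ => ∑ j ∈ Finset.range n, sqResidual g θs (x j ω, es j ω) θ) Θ (T n ω))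
    (hX2 : MemLp X 2 P) (hX0 : ∫ ω, X ω ∂P = 0)
    {c₁ c₂ : ℕ → ℝ} (hc₁ : ∀ᶠ n in atTop, 0 < c₁ n) (hc₂ : ∀ᶠ n in atTop, 0 < c₂ n)
    (hc : Tendsto (fun n : ℕ => (n : ℝ) ^ 2 * c₁ n * c₂ n) atTop atTop)
    {τ : ℝ} (hτ0 : 0 < τ) (hτ1 : τ < 1) :
    ∀ᶠ a : ℕ × Ω in inProb P, qHat a.1 (fun j => x j a.2)
      (fun j => es j a.2 - (g (x j a.2) (T a.1 a.2) - g (x j a.2) θs)) (c₁ a.1) (c₂ a.1) τ = 0 := by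
  have htr := M.bddInProb_traceHat hns hT hcons hmin hX2 hX0
  have hb : Tendsto (fun a : ℕ × Ω => ((a.1 : ℝ) ^ 2 * c₁ a.1 * c₂ a.1)⁻¹) (inProb P) (𝓝 0) :=
    hc.inv_tendsto_atTop.comp tendsto_fst_inProb
  have hlim := ((htr.mul htr) _ hb).const_mul τ
  rw [mul_zero] at hlim
  filter_upwards [hlim.eventually (gt_mem_nhds (sub_pos.2 hτ1)), tendsto_fst_inProb.eventually hc₁,
    tendsto_fst_inProb.eventually hc₂, tendsto_fst_inProb.eventually (eventually_gt_atTop 0)]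
    with a ha h1 h2 h3
  refine qHat_eq_zero _ _ _ h1 h2 hτ0 (lt_of_eq_of_lt ?_ ha)
  have hn : (a.1 : ℝ) ≠ 0 := by exact_mod_cast h3.ne'
  field_simp

end ErrorModel

/-! ### Measurability of ordered eigenvalues -/

section Eigenvalues

variable {Ω : Type*} [MeasurableSpace Ω] {p : ℕ} {A : Ω → Matrix (Fin p) (Fin p) ℂ}

theorem trace_pow_eq_sum {A : Matrix (Fin p) (Fin p) ℂ} (hA : A.IsHermitian) (k : ℕ) :
    (A ^ k).trace = ∑ i, (hA.eigenvalues₀ i : ℂ) ^ k := by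
  have h1 : A ^ k = Unitary.conjStarAlgAut ℂ _ hA.eigenvectorUnitary
      (Matrix.diagonal (RCLike.ofReal ∘ hA.eigenvalues) ^ k) := by
    rw [map_pow, ← hA.spectral_theorem]
  rw [h1, Unitary.conjStarAlgAut_apply, Matrix.trace_mul_comm, ← mul_assoc,
    Unitary.coe_star_mul_self, one_mul, Matrix.diagonal_pow, Matrix.trace_diagonal]
  rw [← Equiv.sum_comp (Fintype.equivOfCardEq (Fintype.card_fin (Fintype.card (Fin p))))]
  simp [Matrix.IsHermitian.eigenvalues]

theorem measurable_pow_apply (hm : ∀ i j, Measurable fun ω => A ω i j) (k : ℕ) :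
    ∀ i j, Measurable fun ω => (A ω ^ k) i j := by
  induction k with
  | zero => intro i j; simp only [pow_zero]; exact measurable_const
  | succ k ih =>
    intro i j
    simp only [pow_succ, Matrix.mul_apply]
    exact Finset.measurable_fun_sum _ fun l _ => (ih i l).mul (hm l j)

theorem measurable_sum_eval (hA : ∀ ω, (A ω).IsHermitian)
    (hm : ∀ i j, Measurable fun ω => A ω i j) (q : Polynomial ℝ) :
    Measurable fun ω => ∑ i, q.eval ((hA ω).eigenvalues₀ i) := by
  have hpow : ∀ k : ℕ, Measurable fun ω => ∑ i, (hA ω).eigenvalues₀ i ^ k := by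
    intro k
    have h1 : ∀ ω, ∑ i, (hA ω).eigenvalues₀ i ^ k = ((A ω ^ k).trace).re := by
      intro ω
      rw [trace_pow_eq_sum (hA ω), ← Complex.ofReal_re (∑ i, (hA ω).eigenvalues₀ i ^ k)]
      push_cast
      rfl
    simp only [h1]
    refine Complex.measurable_re.comp ?_
    exact Finset.measurable_fun_sum _ fun i _ => measurable_pow_apply hm k i i
  simp only [Polynomial.eval_eq_sum_range]
  have h2 : ∀ ω, ∑ i, ∑ k ∈ Finset.range (q.natDegree + 1),
      q.coeff k * (hA ω).eigenvalues₀ i ^ k = ∑ k ∈ Finset.range (q.natDegree + 1),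
      q.coeff k * ∑ i, (hA ω).eigenvalues₀ i ^ k := fun ω => by
    rw [Finset.sum_comm]
    simp only [Finset.mul_sum]
  simp only [h2]
  exact Finset.measurable_fun_sum _ fun k _ => (hpow k).const_mul _

/-- The indicator of a half-line is a pointwise limit of polynomials on the whole line. -/
theorem exists_polynomial_tendsto_indicator (t : ℝ) :
    ∃ q : ℕ → Polynomial ℝ, ∀ s : ℝ,
      Tendsto (fun m => (q m).eval s) atTop (𝓝 (if t < s then 1 else 0)) := by
  let f : ℕ → ℝ → ℝ := fun m s => max 0 (min 1 ((m : ℝ) * (s - t)))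
  have hf : ∀ m, Continuous (f m) := fun m => by fun_prop
  have hq := fun m : ℕ => exists_polynomial_near_of_continuousOn (-(m : ℝ)) m (f m)
    (hf m).continuousOn (1 / ((m : ℝ) + 1)) (by positivity)
  choose q hq using hq
  refine ⟨q, fun s => ?_⟩
  have hfl : Tendsto (fun m => f m s) atTop (𝓝 (if t < s then 1 else 0)) := by
    split_ifs with h
    · refine tendsto_const_nhds.congr' ?_
      have h1 : Tendsto (fun m : ℕ => (m : ℝ) * (s - t)) atTop atTop :=
        tendsto_natCast_atTop_atTop.atTop_mul_const (sub_pos.2 h)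
      filter_upwards [h1.eventually_ge_atTop 1] with m hm
      simp only [f]
      rw [min_eq_left hm, max_eq_right zero_le_one]
    · refine tendsto_const_nhds.congr fun m => ?_
      have h1 : (m : ℝ) * (s - t) ≤ 0 :=
        mul_nonpos_of_nonneg_of_nonpos (Nat.cast_nonneg m) (by linarith)
      simp only [f]
      rw [max_eq_left ((min_le_right _ _).trans h1)]
  have hd : Tendsto (fun m => (q m).eval s - f m s) atTop (𝓝 0) := by
    refine squeeze_zero_norm' ?_ (tendsto_one_div_add_atTop_nhds_zero_nat (𝕜 := ℝ))
    filter_upwards [tendsto_natCast_atTop_atTop.eventually_ge_atTop |s|] with m hm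
    exact (hq m s ⟨(abs_le.1 hm).1, (abs_le.1 hm).2⟩).le
  simpa using hd.add hfl

theorem lt_antitone_iff_lt_sum {N : ℕ} {lam : Fin N → ℝ} (hlam : Antitone lam) (t : ℝ)
    (j : Fin N) : t < lam j ↔ (j : ℝ) < ∑ i, if t < lam i then (1 : ℝ) else 0 := by
  rw [Finset.sum_boole, Nat.cast_lt]
  constructor
  · intro h
    have h1 : Finset.Iic j ⊆ Finset.univ.filter fun i => t < lam i := fun i hi => by
      simpa using h.trans_le (hlam (Finset.mem_Iic.1 hi))
    have h2 := Finset.card_le_card h1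
    rw [Fin.card_Iic] at h2
    omega
  · intro h
    by_contra hcon
    have h1 : (Finset.univ.filter fun i => t < lam i) ⊆ Finset.Iio j := fun i hi => by
      rw [Finset.mem_Iio]
      by_contra hij
      exact hcon ((Finset.mem_filter.1 hi).2.trans_le (hlam (not_lt.1 hij)))
    have h2 := Finset.card_le_card h1
    rw [Fin.card_Iio] at h2
    omega

/-- The ordered eigenvalues of a Hermitian matrix are measurable functions of its entries: sums of
polynomials of the eigenvalues are traces, indicators of half-lines are limits of polynomials, and
the number of eigenvalues above each level determines the ordered eigenvalues. -/
theorem measurable_eigenvalues₀ (hA : ∀ ω, (A ω).IsHermitian)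
    (hm : ∀ i j, Measurable fun ω => A ω i j) (j : Fin (Fintype.card (Fin p))) :
    Measurable fun ω => (hA ω).eigenvalues₀ j := by
  refine measurable_of_Ioi fun t => ?_
  obtain ⟨q, hq⟩ := exists_polynomial_tendsto_indicator t
  have hcount : Measurable fun ω => ∑ i, if t < (hA ω).eigenvalues₀ i then (1 : ℝ) else 0 := by
    refine measurable_of_tendsto_metrizable (fun m => measurable_sum_eval hA hm (q m)) ?_
    rw [tendsto_pi_nhds]
    exact fun ω => tendsto_finsetSum _ fun i _ => hq _
  have hset : (fun ω => (hA ω).eigenvalues₀ j) ⁻¹' Set.Ioi t =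
      {ω | ((j : ℕ) : ℝ) < ∑ i, if t < (hA ω).eigenvalues₀ i then (1 : ℝ) else 0} := by
    ext ω
    exact lt_antitone_iff_lt_sum (hA ω).eigenvalues₀_antitone t j
  rw [hset]
  exact measurableSet_lt measurable_const hcount

end Eigenvalues

/-! ### Measurability of the statistic -/

/-- A function of a Carathéodory kind, continuous in the parameter only on `Θ`, is measurable when
evaluated at a random parameter with values in `Θ`. -/
theorem measurable_comp_caratheodory {Ω 𝒳 E : Type*} [MeasurableSpace Ω] [MeasurableSpace 𝒳]
    [MetricSpace E] [SecondCountableTopology E] [MeasurableSpace E] [BorelSpace E]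
    {Θ : Set E} {φ : 𝒳 → E → ℝ} (hm : ∀ θ ∈ Θ, Measurable fun u => φ u θ)
    (hc : ∀ u, ContinuousOn (φ u) Θ) {U : Ω → 𝒳} (hU : Measurable U) {T : Ω → E}
    (hT : Measurable T) (hTΘ : ∀ ω, T ω ∈ Θ) : Measurable fun ω => φ (U ω) (T ω) := by
  have h := measurable_uncurry_of_continuous_of_measurable (u := fun (θ : Θ) u => φ u θ)
    (fun u => (hc u).domRestrict) (fun θ => hm θ θ.2)
  exact h.comp ((hT.subtype_mk (h := hTΘ)).prodMk hU)

section Statistic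

variable {Ω : Type*} [MeasurableSpace Ω] {p : ℕ} {xs : ℕ → Ω → EuclideanSpace ℝ (Fin p)}
  {η : ℕ → Ω → ℝ}

theorem measurable_mHat (hx : ∀ j, Measurable (xs j)) (hη : ∀ j, Measurable (η j)) (n k : ℕ)
    (i : Fin p) :
    Measurable fun ω => mHat n (fun j => xs j ω) (fun j => η j ω) (η k ω) i := by
  unfold mHat
  have hci : Measurable fun u : EuclideanSpace ℝ (Fin p) => u i := by fun_prop
  have hterm : ∀ j, Measurable fun ω =>
      (xs j ω i : ℂ) * Complex.exp (Complex.I * (η k ω : ℂ) * (η j ω : ℂ)) := fun j =>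
    (Complex.measurable_ofReal.comp (hci.comp (hx j))).mul (Complex.measurable_exp.comp
      (((Complex.measurable_ofReal.comp (hη k)).const_mul _).mul
        (Complex.measurable_ofReal.comp (hη j))))
  exact (Finset.measurable_fun_sum _ fun j _ => hterm j).const_mul _

theorem measurable_lambdaHat (hx : ∀ j, Measurable (xs j)) (hη : ∀ j, Measurable (η j)) (n j : ℕ) :
    Measurable fun ω => lambdaHat n (fun j => xs j ω) (fun j => η j ω) j := by
  unfold lambdaHat
  split_ifs with h
  · refine measurable_eigenvalues₀ (A := fun ω => MHat n (fun j => xs j ω) (fun j => η j ω))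
      (fun ω => MHat_isHermitian n _ _) (fun i l => ?_) _
    simp only [MHat, Matrix.smul_apply, Matrix.sum_apply, Matrix.vecMulVec_apply, Pi.star_apply]
    have hterm : ∀ k, Measurable fun ω =>
        mHat n (fun j => xs j ω) (fun j => η j ω) (η k ω) i *
          star (mHat n (fun j => xs j ω) (fun j => η j ω) (η k ω) l) := fun k =>
      (measurable_mHat hx hη n k i).mul
        (continuous_star.measurable.comp (measurable_mHat hx hη n k l))
    exact (Finset.measurable_fun_sum _ fun k _ => hterm k).const_smul (n : ℝ)⁻¹
  · exact measurable_const

theorem measurable_sStar (hx : ∀ j, Measurable (xs j)) (hη : ∀ j, Measurable (η j)) (n : ℕ)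
    (c₁ : ℝ) (j : ℕ) :
    Measurable fun ω => sStar n (fun j => xs j ω) (fun j => η j ω) c₁ j := by
  have hs : ∀ j, Measurable fun ω => sHat n (fun j => xs j ω) (fun j => η j ω) j := fun j =>
    (measurable_lambdaHat hx hη n j).div ((measurable_lambdaHat hx hη n j).add_const 1)
  exact ((((hs j).pow_const 2).add_const c₁).div
    (((hs (j + 1)).pow_const 2).add_const c₁)).sub_const 1

theorem measurable_rHat (hx : ∀ j, Measurable (xs j)) (hη : ∀ j, Measurable (η j)) (n : ℕ)
    (c₁ c₂ : ℝ) (j : ℕ) :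
    Measurable fun ω => rHat n (fun j => xs j ω) (fun j => η j ω) c₁ c₂ j :=
  ((measurable_sStar hx hη n c₁ (j + 1)).add_const c₂).div
    ((measurable_sStar hx hη n c₁ j).add_const c₂)

theorem qHat_eq_zero_iff (n : ℕ) (us : ℕ → EuclideanSpace ℝ (Fin p)) (ζ : ℕ → ℝ) (c₁ c₂ τ : ℝ) :
    qHat n us ζ c₁ c₂ τ = 0 ↔ ∀ j ∈ Finset.Icc 1 p, ¬ rHat n us ζ c₁ c₂ j ≤ τ := by
  unfold qHat
  rw [← Nat.bot_eq_zero, Finset.sup_eq_bot_iff]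
  constructor
  · intro h j hj hr
    have h0 := h j (Finset.mem_filter.2 ⟨hj, hr⟩)
    have h1 := (Finset.mem_Icc.1 hj).1
    simp at h0
    omega
  · intro h j hj
    exact absurd (Finset.mem_filter.1 hj).2 (h j (Finset.mem_filter.1 hj).1)

theorem measurableSet_qHat_eq_zero (hx : ∀ j, Measurable (xs j)) (hη : ∀ j, Measurable (η j))
    (n : ℕ) (c₁ c₂ τ : ℝ) :
    MeasurableSet {ω | qHat n (fun j => xs j ω) (fun j => η j ω) c₁ c₂ τ = 0} := by
  simp only [qHat_eq_zero_iff, Set.ofPred_forall]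
  refine Finset.measurableSet_biInter _ fun j _ => ?_
  exact (measurableSet_le (measurable_rHat hx hη n c₁ c₂ j) measurable_const).compl

theorem measurable_V0 (hx : ∀ j, Measurable (xs j)) (hη : ∀ j, Measurable (η j)) (n : ℕ)
    {w : EuclideanSpace ℝ (Fin p) → ℝ} (hw : Measurable w) :
    Measurable fun ω => V0 w n (fun j => xs j ω) (fun j => η j ω) :=
  (Finset.measurable_fun_sum _ fun j _ => (hη j).mul (hw.comp (hx j))).const_mul _

theorem measurable_V1 (hx : ∀ j, Measurable (xs j)) (hη : ∀ j, Measurable (η j)) (n : ℕ)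
    {K : EuclideanSpace ℝ (Fin p) → ℝ} (hK : Measurable K) (h : ℝ) :
    Measurable fun ω => V1 K h n (fun j => xs j ω) (fun j => η j ω) :=
  (Finset.measurable_fun_sum _ fun j _ => Finset.measurable_fun_sum _ fun k _ =>
    (((hη j).mul (hη k)).mul_const _).mul
      (hK.comp (((hx j).sub (hx k)).const_smul h⁻¹))).const_mul _

theorem measurable_Vn (hx : ∀ j, Measurable (xs j)) (hη : ∀ j, Measurable (η j)) (n : ℕ)
    {w K : EuclideanSpace ℝ (Fin p) → ℝ} (hw : Measurable w) (hK : Measurable K)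
    (h c₁ c₂ τ : ℝ) :
    Measurable fun ω => Vn w K h c₁ c₂ τ n (fun j => xs j ω) (fun j => η j ω) := by
  have hq := measurableSet_qHat_eq_zero hx hη n c₁ c₂ τ
  unfold Vn
  simp only [Nat.pos_iff_ne_zero]
  exact ((((measurable_V0 hx hη n hw).pow_const 2).mul
    (Measurable.ite hq measurable_const measurable_const)).add
    ((measurable_V1 hx hη n hK h).mul
      (Measurable.ite hq.compl measurable_const measurable_const))).abs

end Statistic

theorem measurable_inv_apply {Ω : Type*} [MeasurableSpace Ω] {d : ℕ}
    {A : Ω → Matrix (Fin d) (Fin d) ℝ} (hm : ∀ i j, Measurable fun ω => A ω i j) (i j : Fin d) :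
    Measurable fun ω => (A ω)⁻¹ i j := by
  have hA : Measurable fun ω => (fun i j => A ω i j : Fin d → Fin d → ℝ) :=
    measurable_pi_iff.2 fun i => measurable_pi_iff.2 fun j => hm i j
  have hof : Continuous fun f : Fin d → Fin d → ℝ => Matrix.of f := continuous_id
  have hdet : Continuous fun f : Fin d → Fin d → ℝ => (Matrix.of f).det := hof.matrix_det
  have hadj : Continuous fun f : Fin d → Fin d → ℝ => (Matrix.of f).adjugate i j :=
    hof.matrix_adjugate.matrix_elem i j
  simp only [Matrix.inv_def, Ring.inverse_eq_inv', Matrix.smul_apply, smul_eq_mul]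
  exact (hdet.measurable.comp hA).inv.mul (hadj.measurable.comp hA)

section Model

variable {Ω : Type*} [MeasurableSpace Ω] {P : Measure Ω} [IsProbabilityMeasure P] {p d : ℕ}
  {X : Ω → EuclideanSpace ℝ (Fin p)} {Y : Ω → ℝ}
  {x : ℕ → Ω → EuclideanSpace ℝ (Fin p)} {y : ℕ → Ω → ℝ}
  {g : EuclideanSpace ℝ (Fin p) → EuclideanSpace ℝ (Fin d) → ℝ}
  {Θ : Set (EuclideanSpace ℝ (Fin d))} {θs : EuclideanSpace ℝ (Fin d)}
  {K : EuclideanSpace ℝ (Fin p) → ℝ} {h : ℕ → ℝ}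

theorem measurable_residual (hreg : Regularity P X Y x y g Θ θs K h)
    {T : Ω → EuclideanSpace ℝ (Fin d)} (hTm : Measurable T) (hT : ∀ ω, T ω ∈ Θ) (j : ℕ) :
    Measurable fun ω => residual g (fun j => x j ω) (fun j => y j ω) (T ω) j :=
  (hreg.measurable_y j).sub (measurable_comp_caratheodory hreg.measurable_g
    (fun u => (hreg.contDiffOn_g u).continuousOn) (hreg.measurable_x j) hTm hT)

theorem measurable_sigmaHatSq (hreg : Regularity P X Y x y g Θ θs K h)
    (hne : (interior Θ).Nonempty) {w : EuclideanSpace ℝ (Fin p) → ℝ} (hw : Measurable w)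
    {T : Ω → EuclideanSpace ℝ (Fin d)} (hTm : Measurable T) (hT : ∀ ω, T ω ∈ Θ) (n : ℕ) :
    Measurable fun ω => sigmaHatSq g Θ w n (fun j => x j ω) (fun j => y j ω) (T ω) := by
  have hgr : ∀ j i, Measurable fun ω => grad g Θ (x j ω) (T ω) i := fun j i =>
    measurable_comp_caratheodory (φ := fun u θ => grad g Θ u θ i)
      (fun θ hθ => measurable_grad hreg.convex_Theta hne hreg.measurable_g hreg.contDiffOn_g hθ i)
      (fun u => (contDiffOn_grad hreg.convex_Theta hne hreg.contDiffOn_g u i).continuousOn)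
      (hreg.measurable_x j) hTm hT
  have hwx : ∀ j, Measurable fun ω => w (x j ω) := fun j => hw.comp (hreg.measurable_x j)
  have ha : ∀ i, Measurable fun ω => ((n : ℝ)⁻¹ • ∑ j ∈ Finset.range n,
      w (x j ω) • grad g Θ (x j ω) (T ω)) i := fun i => by
    simp only [Pi.smul_apply, Finset.sum_apply, smul_eq_mul]
    exact (Finset.measurable_fun_sum _ fun j _ => (hwx j).mul (hgr j i)).const_mul _
  have hG : ∀ i k, Measurable fun ω => ((n : ℝ)⁻¹ • ∑ j ∈ Finset.range n,
      Matrix.vecMulVec (grad g Θ (x j ω) (T ω)) (grad g Θ (x j ω) (T ω))) i k := fun i k => by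
    simp only [Matrix.smul_apply, Matrix.sum_apply, Matrix.vecMulVec_apply, smul_eq_mul]
    exact (Finset.measurable_fun_sum _ fun j _ => (hgr j i).mul (hgr j k)).const_mul _
  unfold sigmaHatSq
  refine Measurable.mul ?_ (Measurable.sub ?_ ?_)
  · exact (Finset.measurable_fun_sum _ fun j _ =>
      (measurable_residual hreg hTm hT j).pow_const 2).const_mul _
  · exact (Finset.measurable_fun_sum _ fun j _ => (hwx j).pow_const 2).const_mul _
  · simp only [dotProduct, Matrix.mulVec]
    exact Finset.measurable_fun_sum _ fun i _ => (ha i).mul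
      (Finset.measurable_fun_sum _ fun k _ => (measurable_inv_apply hG i k).mul (ha k))

theorem measurable_Tn (hreg : Regularity P X Y x y g Θ θs K h)
    (hne : (interior Θ).Nonempty) {w : EuclideanSpace ℝ (Fin p) → ℝ} (hw : Measurable w)
    {T : Ω → EuclideanSpace ℝ (Fin d)} (hTm : Measurable T) (hT : ∀ ω, T ω ∈ Θ)
    (b c₁ c₂ τ : ℝ) (n : ℕ) :
    Measurable fun ω => Tn g Θ w K b c₁ c₂ τ n (fun j => x j ω) (fun j => y j ω) (T ω) :=
  ((measurable_Vn hreg.measurable_x (measurable_residual hreg hTm hT) n hw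
    hreg.kernel_continuous.measurable b c₁ c₂ τ).const_mul _).div
    (measurable_sigmaHatSq hreg hne hw hTm hT n)

end Model

end HybridTest

end

/-! ### The limit distribution of the statistic -/

theorem mainTheorem1 {Ω : Type*} [MeasurableSpace Ω] (P : Measure Ω) [IsProbabilityMeasure P]
    {p d : ℕ}
    (X : Ω → EuclideanSpace ℝ (Fin p)) (Y : Ω → ℝ)
    (x : ℕ → Ω → EuclideanSpace ℝ (Fin p)) (y : ℕ → Ω → ℝ)
    (g : EuclideanSpace ℝ (Fin p) → EuclideanSpace ℝ (Fin d) → ℝ)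
    (Θ : Set (EuclideanSpace ℝ (Fin d))) (θs : EuclideanSpace ℝ (Fin d))
    (K : EuclideanSpace ℝ (Fin p) → ℝ) (h : ℕ → ℝ)
    (hreg : HybridTest.Regularity P X Y x y g Θ θs K h)
    -- the null hypothesis
    (hnull : HybridTest.NullHypothesis P X Y g Θ)
    -- the covariate is centred with finite second moments
    (hX2 : MemLp X 2 P) (hX0 : ∫ ω, X ω ∂P = 0)
    -- the weight function, with a non-degenerate limiting variance
    (w : EuclideanSpace ℝ (Fin p) → ℝ) (hw : Measurable w)
    (hw2 : MemLp (fun ω => w (X ω)) 2 P)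
    (hσ : 0 < HybridTest.sigmaSq P X Y g Θ w θs)
    -- the ridges and the threshold
    (c₁ c₂ : ℕ → ℝ) (hc₁_pos : ∀ᶠ n in atTop, 0 < c₁ n) (hc₂_pos : ∀ᶠ n in atTop, 0 < c₂ n)
    (hc₁ : Tendsto c₁ atTop (𝓝 0)) (hc₂ : Tendsto c₂ atTop (𝓝 0))
    (hc : Tendsto (fun n : ℕ => (n : ℝ) ^ 2 * c₁ n * c₂ n) atTop atTop)
    (τ : ℝ) (hτ0 : 0 < τ) (hτ1 : τ < 1)
    -- the least squares estimator
    (θhat : ℕ → Ω → EuclideanSpace ℝ (Fin d)) (hθm : ∀ n, Measurable (θhat n))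
    (hθ : ∀ n ω, HybridTest.IsLeastSquares g Θ n (fun j => x j ω) (fun j => y j ω) (θhat n ω)) :
    TendstoInDistribution
      (fun (n : ℕ) (ω : Ω) => HybridTest.Tn g Θ w K (h n) (c₁ n) (c₂ n) τ n
        (fun j => x j ω) (fun j => y j ω) (θhat n ω))
      atTop (id : ℝ → ℝ) (fun _ => P) HybridTest.chiSquareOne := by
  obtain ⟨hind, he0, heL⟩ := HybridTest.exists_error_of_null hreg hnull
  have hint := hreg.interior_of_null hnull
  have hne : (interior Θ).Nonempty := ⟨_, hint⟩
  have hvar : variance (fun ω => Y ω - g (X ω) θs) P = ∫ ω, (Y ω - g (X ω) θs) ^ 2 ∂P :=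
    variance_of_integral_eq_zero heL.1.aemeasurable he0
  have hvar0 : 0 < ∫ ω, (Y ω - g (X ω) θs) ^ 2 ∂P := by
    rw [← hvar]
    refine lt_of_le_of_ne (variance_nonneg _ _) fun h0 => ?_
    rw [HybridTest.sigmaSq, ← h0, zero_mul] at hσ
    exact lt_irrefl _ hσ
  obtain ⟨B, C, M⟩ := HybridTest.exists_errorModel hreg hnull hvar0
  have hT : ∀ n ω, θhat n ω ∈ Θ := fun n ω => (hθ n ω).1
  have hmin : ∀ n ω, IsMinOn (fun θ => ∑ j ∈ Finset.range n,
      HybridTest.ErrorModel.sqResidual g θs (x j ω, y j ω - g (x j ω) θs) θ) Θ (θhat n ω) :=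
    fun n ω => by
      simpa only [HybridTest.ErrorModel.sqResidual, sub_sub_sub_cancel_right] using (hθ n ω).2
  have hcons : Tendsto (fun a : ℕ × Ω => θhat a.1 a.2) (HybridTest.inProb P) (𝓝 θs) := by
    refine M.tendsto_leastSquares hT fun n ω => ?_
    have h1 := isMinOn_iff.1 (hmin n ω) θs M.mem
    refine mul_le_mul_of_nonneg_left (h1.trans_eq ?_) (by positivity)
    simp only [HybridTest.ErrorModel.sqResidual, sub_self, sub_zero]
  have hns := hreg.nonsingular
  set v := HybridTest.sigmaSq P X Y g Θ w θs with hv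
  -- the weighted residual average is asymptotically normal with variance `v`
  have hA : TendstoInDistribution (fun (n : ℕ) ω => √(n : ℝ) * HybridTest.V0 w n
      (fun j => x j ω) (HybridTest.residual g (fun j => x j ω) (fun j => y j ω) (θhat n ω)))
      atTop (fun z : ℝ => √v * z) (fun _ => P) (gaussianReal 0 1) := by
    have h1 := M.tendstoInDistribution_effWeight hns hw hw2
    rw [← hvar] at h1
    refine tendstoInDistribution_of_tendstoInMeasure_sub _ _ h1 ?_ fun n => ?_
    · have h2 := HybridTest.tendsto_inProb_iff.1
        (M.tendsto_sqrt_mul_avg_residual_sub hns hT hcons hmin hw hw2)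
      simp only [sub_sub_sub_cancel_right] at h2
      exact h2
    · exact ((HybridTest.measurable_V0 hreg.measurable_x
        (HybridTest.measurable_residual hreg (hθm n) (hT n)) n hw).const_mul _).aemeasurable
  have hσinv : TendstoInMeasure P (fun n ω => (HybridTest.sigmaHatSq g Θ w n (fun j => x j ω)
      (fun j => y j ω) (θhat n ω))⁻¹) atTop (fun _ => v⁻¹) :=
    HybridTest.tendsto_inProb_iff.1
      ((HybridTest.tendsto_sigmaHatSq M hns hT hcons hw hw2).inv₀ hσ.ne')
  have hmain := hA.continuous_comp_prodMk_of_tendstoInMeasure_const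
    (g := fun q : ℝ × ℝ => q.1 ^ 2 * q.2) (by fun_prop) hσinv
    (fun n => (HybridTest.measurable_sigmaHatSq hreg hne hw (hθm n) (hT n) n).inv.aemeasurable)
  have hq := M.eventually_qHat_eq_zero hns hT hcons hmin hX2 hX0 hc₁_pos hc₂_pos hc hτ0 hτ1
  have hTm := fun n => HybridTest.measurable_Tn hreg hne hw (hθm n) (hT n) (h n) (c₁ n) (c₂ n) τ n
  -- the statistic agrees with its moment part where the estimated dimension vanishes
  have hdiff : Tendsto (fun a : ℕ × Ω =>
      HybridTest.Tn g Θ w K (h a.1) (c₁ a.1) (c₂ a.1) τ a.1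
        (fun j => x j a.2) (fun j => y j a.2) (θhat a.1 a.2) -
      (√(a.1 : ℝ) * HybridTest.V0 w a.1 (fun j => x j a.2)
        (HybridTest.residual g (fun j => x j a.2) (fun j => y j a.2) (θhat a.1 a.2))) ^ 2 *
      (HybridTest.sigmaHatSq g Θ w a.1 (fun j => x j a.2) (fun j => y j a.2)
        (θhat a.1 a.2))⁻¹) (HybridTest.inProb P) (𝓝 0) := by
    refine tendsto_const_nhds.congr' ?_
    filter_upwards [hq] with a ha
    have ha' : HybridTest.qHat a.1 (fun j => x j a.2)
        (HybridTest.residual g (fun j => x j a.2) (fun j => y j a.2) (θhat a.1 a.2))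
        (c₁ a.1) (c₂ a.1) τ = 0 := by
      simp only [sub_sub_sub_cancel_right] at ha
      exact ha
    simp only [HybridTest.Tn, HybridTest.Vn, ha', if_true, lt_irrefl, if_false, mul_one,
      mul_zero, add_zero, abs_pow, sq_abs]
    rw [mul_pow, Real.sq_sqrt (Nat.cast_nonneg _), div_eq_mul_inv, sub_self]
  have hdiff' := HybridTest.tendsto_inProb_iff.1 hdiff
  have hfin := tendstoInDistribution_of_tendstoInMeasure_sub
    (fun (n : ℕ) (ω : Ω) => HybridTest.Tn g Θ w K (h n) (c₁ n) (c₂ n) τ n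
        (fun j => x j ω) (fun j => y j ω) (θhat n ω)) _ hmain hdiff'
    (fun n => (hTm n).aemeasurable)
  refine ⟨fun n => (hTm n).aemeasurable, aemeasurable_id, ?_⟩
  -- dividing by `v` turns the squared normal limit into the chi-square law
  have hmap : Measure.map id HybridTest.chiSquareOne =
      Measure.map (fun z : ℝ => (√v * z) ^ 2 * v⁻¹) (gaussianReal 0 1) := by
    rw [Measure.map_id, HybridTest.chiSquareOne]
    congr 1
    funext z
    rw [mul_pow, Real.sq_sqrt hσ.le]
    field_simp
  convert hfin.tendsto using 2
  exact congrArg 𝓝 (Subtype.ext hmap)
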